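/- Let $p$ be a prime, $L$ a finite unramified extension of $\mathbb{Q}_p$ with ring of integers $\mathcal{O}_L$, residue field $k$ and Frobenius automorphism $\sigma$, and let $r\ge 0$. **Conventions.** A $d$-dimensional formal group law over a commutative ring $A$ is $F\in A[[X,Y]]^d$ ($X=(x_1,\dots,x_d)$, $Y=(y_1,\dots,y_d)$) with $F(X,0)=X$, $F(X,F(Y,Z))=F(F(X,Y),Z)$ and $F(X,Y)=F(Y,X)$. A homomorphism from $F$ to a $d'$-dimensional $F'$ is $f\in A[[X]]^{d'}$ with $f(0)=0$ and $f(F(X,Y))=F'(f(X),f(Y))$; its linear coefficient is the matrix $D$ with $f(X)\equiv DX \bmod \deg 2$. The logarithm of $F$ over $\mathcal{O}_L$ is the homomorphism $\lambda\in L[[X]]^d$ over $L$ from $F$ to the $d$-dimensional additive formal group law with $\lambda(X)\equiv X\bmod\deg 2$. An action of a group $\mathcal{G}$ on $\Phi$ is a homomorphism $\mathcal{G}\to\mathrm{Aut}(\Phi)$. A pair $(F,f)$ of a formal group law $F$ (of any dimension) and a homomorphism $f:F\to\Phi$ is fixed for $(\Phi,\mathcal{G})$ if $s\circ f=f$ for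 all $s\in\mathcal{G}$; it is universal if for every fixed pair $(F',f')$ there is a unique homomorphism $g:F'\to F$ with $f'=f\circ g$. Let $\mathcal{E}=\mathcal{O}_L[[\blacktriangle]]$ be the ring of noncommutative power series with $\blacktriangle a=\sigma(a)\blacktriangle$ for $a\in\mathcal{O}_L$. It acts on the power series over $L$ without constant term, with $\blacktriangle$ acting by $x_i\mapsto x_i^p$ on the variables and by $\sigma$ on the coefficients. A tuple $\lambda\in L[[X]]^d$ without constant term is of type $u\in \mathrm{M}_d(\mathcal{E})$ if $u\equiv pI_d\bmod\blacktriangle$ and $u\lambda\equiv 0\bmod p$ (that is, $u\lambda\in p\,\mathcal{O}_L[[X]]^d$). For $0\le e\le r$, $I_{r,e}$ is the $r\times e$ matrix $\begin{pmatrix}I_e\\0\end{pmatrix}$. **I.** Let $\mathcal{G}^*\subset \mathrm{M}_r(\mathcal{O}_L)$ be any set of matrices. The following conditions are equivalent: (i) $\mathrm{rk}_{\mathcal{O}_L}\bigcap_{D\in\mathcal{G}^*}\mathrm{Ker}\,D=\dim_k\bigcap_{D\in\mathcal{G}^*}\mathrm{Ker}(D\otimes k)$; (ii) if $x\in\mathcal{O}_L^r$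 is such that for every $D\in\mathcal{G}^*$ there is $y_D\in\mathcal{O}_L^r$ with $Dx=py_D$, then there is $x'\in\mathcal{O}_L^r$ with $Dx'=y_D$ for every $D\in\mathcal{G}^*$; (iii) there are $0\le e\le r$ and $Q\in\mathrm{GL}_r(\mathcal{O}_L)$ such that for every $D\in\mathcal{G}^*$ $$Q^{-1}DQ=\begin{pmatrix}0&\hat D\\0&\tilde D\end{pmatrix},\qquad \hat D\in\mathrm{M}_{e,r-e}(\mathcal{O}_L),\ \tilde D\in\mathrm{M}_{r-e}(\mathcal{O}_L),$$ and there are finitely many (possibly no) $D_1,\dots,D_m\in\mathcal{G}^*$ and matrices $\hat C_i\in\mathrm{M}_{r-e,e}(\mathcal{O}_L)$, $\tilde C_i\in\mathrm{M}_{r-e}(\mathcal{O}_L)$ with $\sum_{i=1}^m(\hat C_i\hat D_i+\tilde C_i\tilde D_i)\in\mathrm{GL}_{r-e}(\mathcal{O}_L)$. **II.** Let $\Phi$ be an $r$-dimensional formal group law over $\mathcal{O}_L$ with logarithm $\Lambda$, let a group $\mathcal{G}$ act on $\Phi$, and let $\mathcal{G}^*$ be the set of the $D\in\mathrm{M}_r(\mathcal{O}_L)$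 such that $\Lambda^{-1}\circ(D+I_r)\Lambda$ is the automorphism of $\Phi$ given by some element of $\mathcal{G}$. If $\mathcal{G}^*$ satisfies one of the conditions (i), (ii), (iii), then $(\Phi,\mathcal{G})$ has a universal fixed pair. Moreover, for any $e$ and $Q$ as in (iii), if $\Lambda$ is of type $v$, then there is a universal fixed pair $(F,f)$ for $(\Phi,\mathcal{G})$, with $F$ of dimension $e$, such that the linear coefficient of $f$ is $QI_{r,e}$ and the logarithm of $F$ is of type $u$, where $u$ is the upper-left $e\times e$ block of $Q^{-1}vQ$. -/

import Mathlib

open scoped MatrixGroups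

noncomputable section

/-- The composite `g ∘ f` of tuples of formal power series. -/
def seriesComp {A ι σ τ : Type*} [CommRing A] (g : ι → MvPowerSeries σ A)
    (f : σ → MvPowerSeries τ A) : ι → MvPowerSeries τ A :=
  fun i => (g i).subst f

/-- The matrix `D` with `f(X) ≡ D X mod deg 2` (for `f` without constant term). -/
def linearCoeff {A : Type*} [CommRing A] {d d' : ℕ} (f : Fin d' → MvPowerSeries (Fin d) A) :
    Matrix (Fin d') (Fin d) A :=
  Matrix.of fun i j => MvPowerSeries.coeff (Finsupp.single j 1) (f i)

/-- The product `D f` of a matrix and a column of power series. -/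
def matrixMulSeries {A σ : Type*} [CommRing A] {d d' : ℕ} (D : Matrix (Fin d') (Fin d) A)
    (f : Fin d → MvPowerSeries σ A) : Fin d' → MvPowerSeries σ A :=
  fun i => ∑ j, D i j • f j

/-- The tuple of series obtained by applying a ring homomorphism to all the coefficients. -/
def mapSeries {A B ι σ : Type*} [CommRing A] [CommRing B] (φ : A →+* B)
    (f : ι → MvPowerSeries σ A) : ι → MvPowerSeries σ B :=
  fun i => (f i).map φ

/-- `d`-dimensional (commutative) formal group laws over `A`; the variables `X` and `Y` are
indexed by the left and the right summand. -/
@[ext]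
structure FormalGroupLaw (A : Type*) [CommRing A] (d : ℕ) where
  toSeries : Fin d → MvPowerSeries (Fin d ⊕ Fin d) A
  /-- `F(X, 0) = X` -/
  add_zero : seriesComp toSeries (Sum.elim MvPowerSeries.X 0) =
    (MvPowerSeries.X : Fin d → MvPowerSeries (Fin d) A)
  /-- `F(X, F(Y, Z)) = F(F(X, Y), Z)` -/
  assoc :
    let x : Fin d → MvPowerSeries (Fin d ⊕ Fin d ⊕ Fin d) A := fun i => .X (.inl i)
    let y : Fin d → MvPowerSeries (Fin d ⊕ Fin d ⊕ Fin d) A := fun i => .X (.inr (.inl i))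
    let z : Fin d → MvPowerSeries (Fin d ⊕ Fin d ⊕ Fin d) A := fun i => .X (.inr (.inr i))
    seriesComp toSeries (Sum.elim x (seriesComp toSeries (Sum.elim y z))) =
      seriesComp toSeries (Sum.elim (seriesComp toSeries (Sum.elim x y)) z)
  /-- `F(X, Y) = F(Y, X)` -/
  comm : toSeries = seriesComp toSeries
    (Sum.elim (fun i => .X (.inr i)) (fun i => .X (.inl i)))

namespace FormalGroupLaw

open MvPowerSeries

theorem constantCoeff_toSeries {A : Type*} [CommRing A] {d : ℕ} (F : FormalGroupLaw A d)
    (i : Fin d) : constantCoeff (F.toSeries i) = 0 := by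
  have h := congrArg constantCoeff (congrFun F.add_zero i)
  have hs : HasSubst (Sum.elim X 0 : Fin d ⊕ Fin d → MvPowerSeries (Fin d) A) :=
    hasSubst_of_constantCoeff_zero (by rintro (s | s) <;> simp)
  rw [seriesComp, constantCoeff_subst hs, constantCoeff_X, finsum_eq_single _ 0] at h
  · simpa using h
  · intro m hm
    obtain ⟨j, hj⟩ : ∃ j, m j ≠ 0 := by
      by_contra hc
      push Not at hc
      exact hm (Finsupp.ext hc)
    rw [Finsupp.prod, map_prod, Finset.prod_eq_zero (Finsupp.mem_support_iff.mpr hj), smul_zero]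
    rcases j with j | j <;> simp [hj]

variable {A : Type*} [CommRing A] {d d' d'' : ℕ}

/-- The condition that a tuple `f` of power series is a homomorphism from `F` to `F'`. -/
structure IsHom (F : FormalGroupLaw A d) (F' : FormalGroupLaw A d')
    (f : Fin d' → MvPowerSeries (Fin d) A) : Prop where
  /-- `f(0) = 0` -/
  zero : ∀ i, constantCoeff (f i) = 0
  /-- `f(F(X, Y)) = F'(f(X), f(Y))` -/
  map_add : seriesComp f F.toSeries = seriesComp F'.toSeries
    (Sum.elim (seriesComp f fun i => X (.inl i)) (seriesComp f fun i => X (.inr i)))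

/-- `Hom_A(F, F')` -/
@[ext]
structure Hom (F : FormalGroupLaw A d) (F' : FormalGroupLaw A d') where
  toSeries : Fin d' → MvPowerSeries (Fin d) A
  isHom : IsHom F F' toSeries

theorem seriesComp_assoc {ι σ τ υ : Type*} [Finite σ] [Finite τ]
    (h : ι → MvPowerSeries σ A) (g : σ → MvPowerSeries τ A) (f : τ → MvPowerSeries υ A)
    (hg : ∀ i, constantCoeff (g i) = 0) (hf : ∀ i, constantCoeff (f i) = 0) :
    seriesComp (seriesComp h g) f = seriesComp h (seriesComp g f) := by
  funext i
  exact subst_comp_subst_apply (hasSubst_of_constantCoeff_zero hg)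
    (hasSubst_of_constantCoeff_zero hf) (h i)

theorem constantCoeff_seriesComp {ι σ τ : Type*} [Finite σ]
    (g : ι → MvPowerSeries σ A) (f : σ → MvPowerSeries τ A)
    (hg : ∀ i, constantCoeff (g i) = 0) (hf : ∀ i, constantCoeff (f i) = 0) (i : ι) :
    constantCoeff (seriesComp g f i) = 0 :=
  constantCoeff_subst_eq_zero (hasSubst_of_constantCoeff_zero hf) hf (hg i)

theorem seriesComp_sumElim {ι ι' σ τ : Type*} (g : ι → MvPowerSeries σ A)
    (h : ι' → MvPowerSeries σ A) (f : σ → MvPowerSeries τ A) :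
    seriesComp (Sum.elim g h) f = Sum.elim (seriesComp g f) (seriesComp h f) := by
  funext i
  rcases i with i | i <;> rfl

theorem X_seriesComp {σ τ : Type*} [Finite σ] {ι : Type*} (j : ι → σ)
    (f : σ → MvPowerSeries τ A) (hf : ∀ i, constantCoeff (f i) = 0) :
    seriesComp (fun i => X (j i)) f = f ∘ j := by
  funext i
  exact subst_X (hasSubst_of_constantCoeff_zero hf) (j i)

theorem IsHom.comp {F : FormalGroupLaw A d} {F' : FormalGroupLaw A d'}
    {F'' : FormalGroupLaw A d''} {g : Fin d'' → MvPowerSeries (Fin d') A}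
    {f : Fin d' → MvPowerSeries (Fin d) A} (hg : IsHom F' F'' g) (hf : IsHom F F' f) :
    IsHom F F'' (seriesComp g f) := by
  refine ⟨constantCoeff_seriesComp g f hg.zero hf.zero, ?_⟩
  have hX : ∀ j : Fin d → Fin d ⊕ Fin d, ∀ i,
      constantCoeff (X (j i) : MvPowerSeries (Fin d ⊕ Fin d) A) = 0 := fun j i => by simp
  have hl := constantCoeff_seriesComp f _ hf.zero (hX .inl)
  have hr := constantCoeff_seriesComp f _ hf.zero (hX .inr)
  have hs : ∀ i, constantCoeff ((Sum.elim (seriesComp f fun i => X (.inl i))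
      (seriesComp f fun i => X (.inr i)) :
        Fin d' ⊕ Fin d' → MvPowerSeries (Fin d ⊕ Fin d) A) i) = 0 := by
    rintro (i | i)
    · exact hl i
    · exact hr i
  have hX' : ∀ j : Fin d' → Fin d' ⊕ Fin d', ∀ i,
      constantCoeff (X (j i) : MvPowerSeries (Fin d' ⊕ Fin d') A) = 0 := fun j i => by simp
  rw [seriesComp_assoc _ _ _ hf.zero F.constantCoeff_toSeries, hf.map_add,
    ← seriesComp_assoc _ _ _ F'.constantCoeff_toSeries hs, hg.map_add,
    seriesComp_assoc _ _ _ ?_ hs, seriesComp_sumElim,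
    seriesComp_assoc _ _ _ (hX' .inl) hs, seriesComp_assoc _ _ _ (hX' .inr) hs,
    X_seriesComp _ _ hs, X_seriesComp _ _ hs,
    seriesComp_assoc _ _ _ hf.zero (hX .inl), seriesComp_assoc _ _ _ hf.zero (hX .inr)]
  · rfl
  · rintro (i | i)
    · exact constantCoeff_seriesComp g _ hg.zero (hX' .inl) i
    · exact constantCoeff_seriesComp g _ hg.zero (hX' .inr) i

theorem seriesComp_X {ι σ : Type*} (f : ι → MvPowerSeries σ A) : seriesComp f X = f := by
  funext i
  simp [seriesComp, subst_self]

theorem IsHom.id (F : FormalGroupLaw A d) : IsHom F F X := by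
  refine ⟨fun i => by simp, ?_⟩
  have hX : ∀ j : Fin d → Fin d ⊕ Fin d, ∀ i,
      constantCoeff (X (j i) : MvPowerSeries (Fin d ⊕ Fin d) A) = 0 := fun j i => by simp
  have h1 := X_seriesComp (A := A) (_root_.id : Fin d → Fin d) _ F.constantCoeff_toSeries
  have h2 := X_seriesComp (A := A) (_root_.id : Fin d → Fin d) _ (hX .inl)
  have h3 := X_seriesComp (A := A) (_root_.id : Fin d → Fin d) _ (hX .inr)
  simp only [_root_.id] at h1 h2 h3
  change seriesComp (fun i => X i) _ = seriesComp _ (Sum.elim (seriesComp (fun i => X i) _)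
    (seriesComp (fun i => X i) _))
  rw [h1, h2, h3]
  have : (Sum.elim ((fun i => X (.inl i)) ∘ fun i => i) ((fun i => X (.inr i)) ∘ fun i => i) :
      Fin d ⊕ Fin d → MvPowerSeries (Fin d ⊕ Fin d) A) = X := by
    funext i
    rcases i with i | i <;> rfl
  exact (congrArg _ this |>.trans (seriesComp_X _)).symm

/-- Composition of homomorphisms. -/
def Hom.comp {F : FormalGroupLaw A d} {F' : FormalGroupLaw A d'} {F'' : FormalGroupLaw A d''}
    (g : Hom F' F'') (f : Hom F F') : Hom F F'' :=
  ⟨seriesComp g.toSeries f.toSeries, g.isHom.comp f.isHom⟩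

/-- The monoid of endomorphisms under composition. -/
instance (F : FormalGroupLaw A d) : Monoid (Hom F F) where
  mul g f := g.comp f
  one := ⟨X, IsHom.id F⟩
  mul_assoc h g f := Hom.ext (seriesComp_assoc _ _ _ g.isHom.zero f.isHom.zero)
  one_mul f := Hom.ext (X_seriesComp (_root_.id : Fin d → Fin d) _ f.isHom.zero)
  mul_one f := Hom.ext (seriesComp_X _)

/-- The group of automorphisms. -/
abbrev Aut (F : FormalGroupLaw A d) : Type _ := (Hom F F)ˣ

/-- The pair `(F, f)` is fixed for `Φ` with the action `ρ`. -/
def IsFixedPair {G : Type*} [Group G] {Φ : FormalGroupLaw A d} (ρ : G →* Aut Φ)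
    (F : FormalGroupLaw A d') (f : Hom F Φ) : Prop :=
  ∀ s : G, Hom.comp (ρ s : Hom Φ Φ) f = f

/-- The pair `(F, f)` is a universal fixed pair for `Φ` with the action `ρ`. -/
def IsUniversalFixedPair {G : Type*} [Group G] {Φ : FormalGroupLaw A d} (ρ : G →* Aut Φ)
    (F : FormalGroupLaw A d') (f : Hom F Φ) : Prop :=
  IsFixedPair ρ F f ∧
    ∀ (n : ℕ) (F' : FormalGroupLaw A n) (f' : Hom F' Φ), IsFixedPair ρ F' f' →
      ∃! g : Hom F' F, f' = f.comp g

theorem mapSeries_seriesComp {B ι σ τ : Type*} [CommRing B] [Finite σ] (φ : A →+* B)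
    (g : ι → MvPowerSeries σ A) (f : σ → MvPowerSeries τ A)
    (hf : ∀ i, constantCoeff (f i) = 0) :
    mapSeries φ (seriesComp g f) = seriesComp (mapSeries φ g) (mapSeries φ f) := by
  funext i
  exact map_subst (hasSubst_of_constantCoeff_zero hf) (g i)

theorem mapSeries_sumElim {B ι ι' σ : Type*} [CommRing B] (φ : A →+* B)
    (g : ι → MvPowerSeries σ A) (h : ι' → MvPowerSeries σ A) :
    mapSeries φ (Sum.elim g h) = Sum.elim (mapSeries φ g) (mapSeries φ h) := by
  funext i
  rcases i with i | i <;> rfl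

theorem mapSeries_X {B ι σ : Type*} [CommRing B] (φ : A →+* B) (j : ι → σ) :
    mapSeries φ (fun i => X (j i)) = fun i => X (j i) := by
  funext i
  simp [mapSeries]

theorem constantCoeff_sumElim {ι ι' σ : Type*} {g : ι → MvPowerSeries σ A}
    {h : ι' → MvPowerSeries σ A} (hg : ∀ i, constantCoeff (g i) = 0)
    (hh : ∀ i, constantCoeff (h i) = 0) (i : ι ⊕ ι') :
    constantCoeff (Sum.elim g h i) = 0 := by
  rcases i with i | i
  · exact hg i
  · exact hh i

/-- The formal group law over `B` obtained from one over `A` by applying a ring homomorphism to the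
coefficients. -/
def map {B : Type*} [CommRing B] (φ : A →+* B) (F : FormalGroupLaw A d) : FormalGroupLaw B d where
  toSeries := mapSeries φ F.toSeries
  add_zero := by
    have h := congrArg (mapSeries φ) F.add_zero
    rw [mapSeries_seriesComp _ _ _ (constantCoeff_sumElim (by simp) (by simp)),
      mapSeries_sumElim] at h
    convert h using 2
    · congr 1
      · exact (mapSeries_X φ fun i => i).symm
      · funext i
        simp [mapSeries]
    · exact (mapSeries_X φ fun i => i).symm
  assoc := by
    intro x y z
    have h := congrArg (mapSeries φ) F.assoc
    have hF := F.constantCoeff_toSeries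
    have hX : ∀ j : Fin d → Fin d ⊕ Fin d ⊕ Fin d, ∀ i,
        constantCoeff (X (j i) : MvPowerSeries (Fin d ⊕ Fin d ⊕ Fin d) A) = 0 := fun j i => by simp
    have hx := hX .inl
    have hy := hX fun i => .inr (.inl i)
    have hz := hX fun i => .inr (.inr i)
    have hyz := constantCoeff_sumElim hy hz
    have hxy := constantCoeff_sumElim hx hy
    rw [mapSeries_seriesComp _ _ _ (constantCoeff_sumElim hx
        (constantCoeff_seriesComp _ _ hF hyz)),
      mapSeries_seriesComp _ _ _ (constantCoeff_sumElim
        (constantCoeff_seriesComp _ _ hF hxy) hz),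
      mapSeries_sumElim, mapSeries_sumElim, mapSeries_seriesComp _ _ _ hyz,
      mapSeries_seriesComp _ _ _ hxy, mapSeries_sumElim, mapSeries_sumElim,
      mapSeries_X, mapSeries_X, mapSeries_X] at h
    exact h
  comm := by
    have h := congrArg (mapSeries φ) F.comm
    rwa [mapSeries_seriesComp _ _ _ (constantCoeff_sumElim (by simp) (by simp)),
      mapSeries_sumElim, mapSeries_X, mapSeries_X] at h

/-- The direct sum of `d` copies of the additive formal group law: `F(X, Y) = X + Y`. -/
def additive (A : Type*) [CommRing A] (d : ℕ) : FormalGroupLaw A d where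
  toSeries i := X (.inl i) + X (.inr i)
  add_zero := by
    have hs : HasSubst (Sum.elim X 0 : Fin d ⊕ Fin d → MvPowerSeries (Fin d) A) :=
      hasSubst_of_constantCoeff_zero (constantCoeff_sumElim (by simp) (by simp))
    funext i
    simp [seriesComp, subst_add hs, subst_X hs]
  assoc := by
    intro x y z
    have hx : ∀ i, constantCoeff (x i) = 0 := by simp [x]
    have hy : ∀ i, constantCoeff (y i) = 0 := by simp [y]
    have hz : ∀ i, constantCoeff (z i) = 0 := by simp [z]
    have key : ∀ a b : Fin d → MvPowerSeries (Fin d ⊕ Fin d ⊕ Fin d) A,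
        (∀ i, constantCoeff (a i) = 0) → (∀ i, constantCoeff (b i) = 0) →
        seriesComp (fun i : Fin d => (X (.inl i) + X (.inr i) : MvPowerSeries (Fin d ⊕ Fin d) A))
          (Sum.elim a b) = a + b := by
      intro a b ha hb
      have hs := hasSubst_of_constantCoeff_zero (constantCoeff_sumElim ha hb)
      funext i
      simp [seriesComp, subst_add hs, subst_X hs]
    rw [key y z hy hz, key x y hx hy, key _ _ hx (by simp [hy, hz]),
      key _ _ (by simp [hx, hy]) hz, _root_.add_assoc]
  comm := by
    have hs : HasSubst (Sum.elim (fun i => X (.inr i)) (fun i => X (.inl i)) :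
        Fin d ⊕ Fin d → MvPowerSeries (Fin d ⊕ Fin d) A) :=
      hasSubst_of_constantCoeff_zero (constantCoeff_sumElim (by simp) (by simp))
    funext i
    simp [seriesComp, subst_add hs, subst_X hs, _root_.add_comm]

/-- `lam` is the logarithm of the formal group law `F` over `A`, with coefficients in the
`A`-algebra `K`: the homomorphism over `K` from `F` to the additive formal group law with
`lam(X) ≡ X mod deg 2`. -/
def IsLogarithm {K : Type*} [CommRing K] [Algebra A K] (F : FormalGroupLaw A d)
    (lam : Fin d → MvPowerSeries (Fin d) K) : Prop :=
  IsHom (F.map (algebraMap A K)) (additive K d) lam ∧ linearCoeff lam = 1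

/-- `mu` is the inverse of `lam` under composition. -/
def IsCompInverse {K : Type*} [CommRing K] (lam mu : Fin d → MvPowerSeries (Fin d) K) : Prop :=
  (∀ i, constantCoeff (mu i) = 0) ∧ seriesComp lam mu = X ∧ seriesComp mu lam = X

/-- For a group acting on `Φ`, with logarithm `Lam`: the matrices `D` such that
`Lam⁻¹ ∘ (D + 1) Lam` is the automorphism given by an element of the group. -/
def linearizedAction {K : Type*} [CommRing K] [Algebra A K] {G : Type*} [Group G]
    {Φ : FormalGroupLaw A d} (ρ : G →* Aut Φ) (Lam : Fin d → MvPowerSeries (Fin d) K) :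
    Set (Matrix (Fin d) (Fin d) A) :=
  {D | ∃ mu, IsCompInverse Lam mu ∧ ∃ s : G,
    seriesComp mu (matrixMulSeries ((D + 1).map (algebraMap A K)) Lam) =
      mapSeries (algebraMap A K) (ρ s : Hom Φ Φ).toSeries}

end FormalGroupLaw

/-- The ring `R[[T]]` of power series with the commutation rule `T a = σ(a) T`; the series with
coefficients `a n` is `∑ a n T ^ n`. -/
@[ext]
structure SkewPowerSeries {R : Type*} [CommRing R] (σ : R →+* R) where
  coeff : ℕ → R

namespace SkewPowerSeries

variable {R : Type*} [CommRing R] {σ : R →+* R}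

instance : Zero (SkewPowerSeries σ) := ⟨⟨0⟩⟩
instance : Add (SkewPowerSeries σ) := ⟨fun a b => ⟨a.coeff + b.coeff⟩⟩
instance : Neg (SkewPowerSeries σ) := ⟨fun a => ⟨-a.coeff⟩⟩

/-- The constant series. -/
def const (σ : R →+* R) (a : R) : SkewPowerSeries σ := ⟨fun n => if n = 0 then a else 0⟩

instance : One (SkewPowerSeries σ) := ⟨const σ 1⟩
instance : Mul (SkewPowerSeries σ) := ⟨fun a b =>
  ⟨fun n => ∑ ij ∈ Finset.HasAntidiagonal.antidiagonal n, a.coeff ij.1 * (σ ^ ij.1) (b.coeff ij.2)⟩⟩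

theorem coeff_zero (n : ℕ) : (0 : SkewPowerSeries σ).coeff n = 0 := rfl
theorem coeff_add (a b : SkewPowerSeries σ) (n : ℕ) :
    (a + b).coeff n = a.coeff n + b.coeff n := rfl
theorem coeff_neg (a : SkewPowerSeries σ) (n : ℕ) : (-a).coeff n = -a.coeff n := rfl
theorem coeff_one (n : ℕ) : (1 : SkewPowerSeries σ).coeff n = if n = 0 then 1 else 0 := rfl
theorem coeff_mul (a b : SkewPowerSeries σ) (n : ℕ) : (a * b).coeff n =
    ∑ ij ∈ Finset.HasAntidiagonal.antidiagonal n, a.coeff ij.1 * (σ ^ ij.1) (b.coeff ij.2) := rfl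

instance : Ring (SkewPowerSeries σ) where
  add_assoc a b c := by ext n; simp [coeff_add, add_assoc]
  zero_add a := by ext n; simp [coeff_add, coeff_zero]
  add_zero a := by ext n; simp [coeff_add, coeff_zero]
  add_comm a b := by ext n; simp [coeff_add, add_comm]
  neg_add_cancel a := by ext n; simp [coeff_add, coeff_neg, coeff_zero]
  left_distrib a b c := by
    ext n; simp [coeff_add, coeff_mul, mul_add, Finset.sum_add_distrib]
  right_distrib a b c := by
    ext n; simp [coeff_add, coeff_mul, add_mul, Finset.sum_add_distrib]
  zero_mul a := by ext n; simp [coeff_mul, coeff_zero]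
  mul_zero a := by ext n; simp [coeff_mul, coeff_zero]
  one_mul a := by
    ext n
    rw [coeff_mul, Finset.sum_eq_single (0, n)]
    · simp [coeff_one]
    · rintro ⟨i, j⟩ hij hne
      rw [Finset.HasAntidiagonal.mem_antidiagonal] at hij
      have : i ≠ 0 := by rintro rfl; simp_all
      simp [coeff_one, this]
    · simp
  mul_one a := by
    ext n
    rw [coeff_mul, Finset.sum_eq_single (n, 0)]
    · simp [coeff_one]
    · rintro ⟨i, j⟩ hij hne
      rw [Finset.HasAntidiagonal.mem_antidiagonal] at hij
      have : j ≠ 0 := by rintro rfl; simp_all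
      simp [coeff_one, this]
    · simp
  mul_assoc a b c := by
    ext n
    simp only [coeff_mul, Finset.sum_mul, Finset.mul_sum, map_sum, map_mul, Finset.sum_sigma']
    apply Finset.sum_nbij' (fun ⟨⟨_i, j⟩, ⟨k, l⟩⟩ ↦ ⟨(k, l + j), (l, j)⟩)
      (fun ⟨⟨i, _j⟩, ⟨k, l⟩⟩ ↦ ⟨(i + k, l), (i, k)⟩)
    · rintro ⟨⟨i, j⟩, ⟨k, l⟩⟩ h
      simp only [Finset.mem_sigma, Finset.HasAntidiagonal.mem_antidiagonal] at h ⊢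
      obtain ⟨rfl, rfl⟩ := h
      exact ⟨by ring, trivial⟩
    · rintro ⟨⟨i, j⟩, ⟨k, l⟩⟩ h
      simp only [Finset.mem_sigma, Finset.HasAntidiagonal.mem_antidiagonal] at h ⊢
      obtain ⟨rfl, rfl⟩ := h
      exact ⟨by ring, trivial⟩
    · rintro ⟨⟨i, j⟩, ⟨k, l⟩⟩ h
      simp only [Finset.mem_sigma, Finset.HasAntidiagonal.mem_antidiagonal] at h ⊢
      obtain ⟨rfl, rfl⟩ := h
      rfl
    · rintro ⟨⟨i, j⟩, ⟨k, l⟩⟩ h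
      simp only [Finset.mem_sigma, Finset.HasAntidiagonal.mem_antidiagonal] at h ⊢
      obtain ⟨rfl, rfl⟩ := h
      rfl
    · rintro ⟨⟨i, j⟩, ⟨k, l⟩⟩ h
      simp only [Finset.mem_sigma, Finset.HasAntidiagonal.mem_antidiagonal] at h
      obtain ⟨rfl, rfl⟩ := h
      simp only [pow_add, RingHom.mul_def, RingHom.comp_apply, mul_assoc]
  nsmul := nsmulRec
  zsmul := zsmulRec

end SkewPowerSeries

/-- The ring of integers of a finite extension `L` of `ℚ_[p]`. -/
abbrev PadicRingOfIntegers (p : ℕ) [Fact p.Prime] (L : Type*) [Field L] [Algebra ℤ_[p] L] :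
    Type _ := integralClosure ℤ_[p] L

section
variable (p : ℕ) [Fact p.Prime] (L : Type*) [Field L] [Algebra ℚ_[p] L] [Algebra ℤ_[p] L]
  [IsScalarTower ℤ_[p] ℚ_[p] L] [FiniteDimensional ℚ_[p] L]

theorem padicRingOfIntegers_finite : Module.Finite ℤ_[p] (PadicRingOfIntegers p L) :=
  IsIntegralClosure.finite ℤ_[p] ℚ_[p] L _

theorem padicRingOfIntegers_torsionFree :
    Module.IsTorsionFree ℤ_[p] (PadicRingOfIntegers p L) := by
  have : Module.IsTorsionFree ℤ_[p] L := Module.IsTorsionFree.trans_faithfulSMul ℤ_[p] ℚ_[p] L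
  infer_instance

theorem padicRingOfIntegers_isAdicComplete :
    IsAdicComplete (Ideal.span {(p : PadicRingOfIntegers p L)}) (PadicRingOfIntegers p L) := by
  have := padicRingOfIntegers_finite p L
  have h1 : (IsLocalRing.maximalIdeal ℤ_[p]).map (algebraMap ℤ_[p] (PadicRingOfIntegers p L)) =
      Ideal.span {(p : PadicRingOfIntegers p L)} := by
    rw [PadicInt.maximalIdeal_eq_span_p, Ideal.map_span]; simp
  rw [← h1, IsAdicComplete.map_algebraMap_iff, ← AdicCompletion.of_bijective_iff]
  have := padicRingOfIntegers_torsionFree p L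
  have : Module.Free ℤ_[p] (PadicRingOfIntegers p L) := Module.free_of_finite_type_torsion_free'
  let I := IsLocalRing.maximalIdeal ℤ_[p]
  let b := Module.finBasis ℤ_[p] (PadicRingOfIntegers p L)
  let M := Fin (Module.finrank ℤ_[p] (PadicRingOfIntegers p L)) → ℤ_[p]
  let e : M →ₗ[ℤ_[p]] TensorProduct ℤ_[p] (AdicCompletion I ℤ_[p]) M :=
    ((AdicCompletion.of I ℤ_[p]).rTensor _) ∘ₗ (TensorProduct.lid ℤ_[p] _).symm.toLinearMap
  have he : Function.Bijective e :=
    (LinearEquiv.rTensor M (AdicCompletion.ofLinearEquiv I ℤ_[p])).bijective.comp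
      (TensorProduct.lid ℤ_[p] M).symm.bijective
  have hc : (AdicCompletion.of I M : _ → _) = AdicCompletion.ofTensorProduct I M ∘ e := by
    ext1 x
    have h1 : AdicCompletion.of I ℤ_[p] 1 = 1 := rfl
    simp [e, h1]
  have hM : Function.Bijective (AdicCompletion.of I M) := by
    rw [hc]
    exact Function.Bijective.comp
      (AdicCompletion.ofTensorProduct_bijective_of_finite_of_isNoetherian I M) he
  have hcomp : (AdicCompletion.of I (PadicRingOfIntegers p L) : _ → _) =
      AdicCompletion.congr I b.equivFun.symm ∘ AdicCompletion.of I M ∘ b.equivFun := by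
    ext1 x
    have := AdicCompletion.map_of I b.equivFun.symm.toLinearMap (b.equivFun x)
    simpa using this.symm
  rw [hcomp]
  exact (AdicCompletion.congr I b.equivFun.symm).bijective.comp (hM.comp b.equivFun.bijective)

theorem padicRingOfIntegers_finite_quotient :
    Finite (PadicRingOfIntegers p L ⧸ Ideal.span {(p : PadicRingOfIntegers p L)}) := by
  have := padicRingOfIntegers_finite p L
  have h1 : (IsLocalRing.maximalIdeal ℤ_[p]).map (algebraMap ℤ_[p] (PadicRingOfIntegers p L)) =
      Ideal.span {(p : PadicRingOfIntegers p L)} := by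
    rw [PadicInt.maximalIdeal_eq_span_p, Ideal.map_span]; simp
  rw [← h1]
  have : Finite (ℤ_[p] ⧸ IsLocalRing.maximalIdeal ℤ_[p]) :=
    Finite.of_equiv _ (PadicInt.residueField (p := p)).symm.toEquiv
  exact Module.finite_of_finite (ℤ_[p] ⧸ IsLocalRing.maximalIdeal ℤ_[p])

instance padicRingOfIntegers_isLocalRing : IsLocalRing (PadicRingOfIntegers p L) := by
  have := padicRingOfIntegers_isAdicComplete p L
  have := padicRingOfIntegers_finite_quotient p L
  set I := Ideal.span {(p : PadicRingOfIntegers p L)} with hI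
  have hj : I ≤ (⊥ : Ideal (PadicRingOfIntegers p L)).jacobson := IsAdicComplete.le_jacobson_bot I
  have hl : ∀ y : PadicRingOfIntegers p L, IsUnit (Ideal.Quotient.mk I y) → IsUnit y := by
    intro y hy
    obtain ⟨z', hz⟩ := isUnit_iff_exists_inv.mp hy
    obtain ⟨z, rfl⟩ := Ideal.Quotient.mk_surjective z'
    rw [← map_mul, ← map_one (Ideal.Quotient.mk I), Ideal.Quotient.eq] at hz
    have hu : IsUnit (1 + (y * z - 1)) := by
      simpa [add_comm] using Ideal.mem_jacobson_bot.mp (hj hz) 1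
    exact isUnit_of_mul_isUnit_left (by simpa using hu)
  refine IsLocalRing.of_isUnit_or_isUnit_one_sub_self fun x => ?_
  obtain ⟨a, b, hab, h⟩ : ∃ a b : ℕ, a < b ∧
      Ideal.Quotient.mk I x ^ (a + 1) = Ideal.Quotient.mk I x ^ (b + 1) := by
    obtain ⟨a, b, hne, h⟩ :=
      Finite.exists_ne_map_eq_of_infinite fun n : ℕ => Ideal.Quotient.mk I x ^ (n + 1)
    rcases lt_or_gt_of_ne hne with hlt | hlt
    · exact ⟨a, b, hlt, h⟩
    · exact ⟨b, a, hlt, h.symm⟩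
  obtain ⟨c, rfl⟩ := Nat.exists_eq_add_of_lt hab
  have hper : ∀ k n, Ideal.Quotient.mk I x ^ (a + 1 + n + k * (c + 1)) =
      Ideal.Quotient.mk I x ^ (a + 1 + n) := by
    intro k n
    induction k with
    | zero => simp
    | succ k ih =>
      rw [← ih, show a + 1 + n + (k + 1) * (c + 1) = (a + c + 1 + 1) + (n + k * (c + 1)) by ring,
        pow_add, ← h, ← pow_add]
      congr 1
      ring
  set N := (a + 1) * (c + 1) with hN
  have hidem : Ideal.Quotient.mk I (x ^ N) * Ideal.Quotient.mk I (x ^ N) =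
      Ideal.Quotient.mk I (x ^ N) := by
    have := hper (a + 1) ((a + 1) * c)
    rw [map_pow, ← pow_add]
    convert this using 2 <;> simp only [hN] <;> ring
  have hmem : x ^ N * x ^ N - x ^ N ∈ I := by
    rw [← Ideal.Quotient.eq, map_mul, hidem]
  have hmem' : x ^ N - x ^ N * x ^ N ∈ I := by simpa using I.neg_mem hmem
  obtain ⟨z, hz, hzx⟩ := HenselianRing.is_henselian (I := I)
    (Polynomial.X ^ 2 - Polynomial.X : Polynomial (PadicRingOfIntegers p L))
    (by monicity!) (x ^ N) (by simpa [pow_two] using hmem) (by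
      refine IsUnit.of_mul_eq_one (Ideal.Quotient.mk I (2 * x ^ N - 1)) ?_
      simp only [Polynomial.derivative_sub, Polynomial.derivative_X_pow, Polynomial.derivative_X]
      rw [← map_mul, ← map_one (Ideal.Quotient.mk I), Ideal.Quotient.eq]
      simp only [Polynomial.eval_sub, Polynomial.eval_mul, Polynomial.eval_pow,
        Polynomial.eval_X, Polynomial.eval_one, Polynomial.eval_C]
      convert I.mul_mem_left 4 hmem using 1
      push_cast
      ring)
  have hN0 : N ≠ 0 := by positivity
  have hz' : z * (z - 1) = 0 := by
    have : z ^ 2 - z = 0 := by simpa [Polynomial.IsRoot] using hz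
    linear_combination this
  rcases mul_eq_zero.mp hz' with h0 | h0
  · right
    subst h0
    have hx0 : Ideal.Quotient.mk I x ^ N = 0 := by
      rw [← map_pow, Ideal.Quotient.eq_zero_iff_mem]
      simpa using I.neg_mem hzx
    refine hl _ ?_
    rw [map_sub, map_one]
    exact IsNilpotent.isUnit_one_sub ⟨N, hx0⟩
  · left
    have hz1 : z = 1 := sub_eq_zero.mp h0
    subst hz1
    refine hl _ ?_
    have : Ideal.Quotient.mk I x ^ N = 1 := by
      rw [← map_pow, ← map_one (Ideal.Quotient.mk I), eq_comm, Ideal.Quotient.eq]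
      exact hzx
    exact IsUnit.of_pow_eq_one this hN0

/-- `σ` is the Frobenius automorphism of `L` over `ℚ_[p]`: on the ring of integers it reduces to
`x ↦ x ^ p` modulo `p`. -/
def IsPadicFrobenius (σ : L ≃ₐ[ℚ_[p]] L) : Prop :=
  ∀ x : PadicRingOfIntegers p L, ∃ y : PadicRingOfIntegers p L,
    σ (x : L) = (x : L) ^ p + p * (y : L)

theorem existsUnique_isPadicFrobenius [Algebra.Unramified ℤ_[p] (PadicRingOfIntegers p L)] :
    ∃! σ : L ≃ₐ[ℚ_[p]] L, IsPadicFrobenius p L σ := by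
  have := padicRingOfIntegers_isAdicComplete p L
  have := padicRingOfIntegers_finite p L
  have := padicRingOfIntegers_torsionFree p L
  have : Module.Free ℤ_[p] (PadicRingOfIntegers p L) := Module.free_of_finite_type_torsion_free'
  have : Algebra.FinitePresentation ℤ_[p] (PadicRingOfIntegers p L) :=
    Algebra.FinitePresentation.of_finiteType.mp inferInstance
  have : Algebra.Etale ℤ_[p] (PadicRingOfIntegers p L) :=
    Algebra.Etale.of_formallyUnramified_of_flat
  set I := Ideal.span {(p : PadicRingOfIntegers p L)} with hI
  have hinj : Function.Injective (algebraMap ℤ_[p] (PadicRingOfIntegers p L)) :=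
    FaithfulSMul.algebraMap_injective _ _
  have hint : Algebra.IsIntegral ℤ_[p] (PadicRingOfIntegers p L) := inferInstance
  have hfrac : IsFractionRing (PadicRingOfIntegers p L) L :=
    integralClosure.isFractionRing_of_finite_extension ℚ_[p] L
  have hloc : IsLocalHom (algebraMap ℤ_[p] (PadicRingOfIntegers p L)) :=
    RingHom.IsIntegral.isLocalHom (algebraMap_isIntegral_iff.mpr hint) hinj
  have hpn : I ≠ ⊤ := by
    rw [hI, Ne, Ideal.span_singleton_eq_top]
    intro h
    have h' : IsUnit (algebraMap ℤ_[p] (PadicRingOfIntegers p L) (p : ℤ_[p])) := by simpa using h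
    exact PadicInt.prime_p.not_isUnit (hloc.map_nonunit _ h')
  have : Nontrivial (PadicRingOfIntegers p L ⧸ I) := Ideal.Quotient.nontrivial_iff.mpr hpn
  have hp0 : (p : PadicRingOfIntegers p L ⧸ I) = 0 := by
    rw [← map_natCast (Ideal.Quotient.mk I), Ideal.Quotient.eq_zero_iff_mem]
    exact Ideal.mem_span_singleton_self _
  have : CharP (PadicRingOfIntegers p L ⧸ I) p := (CharP.charP_iff_prime_eq_zero Fact.out).mpr hp0
  have hfermat : ∀ a : ℤ_[p], (p : ℤ_[p]) ∣ a ^ p - a := by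
    intro a
    rw [← Ideal.mem_span_singleton, ← PadicInt.maximalIdeal_eq_span_p, ← PadicInt.ker_toZMod,
      RingHom.mem_ker, map_sub, map_pow, ZMod.pow_card, sub_self]
  let f : PadicRingOfIntegers p L →ₐ[ℤ_[p]] PadicRingOfIntegers p L ⧸ I :=
    { (frobenius (PadicRingOfIntegers p L ⧸ I) p).comp (Ideal.Quotient.mk I) with
      commutes' := by
        intro a
        simp only [RingHom.toMonoidHom_eq_coe, OneHom.toFun_eq_coe, MonoidHom.toOneHom_coe,
          MonoidHom.coe_coe, RingHom.coe_comp, Function.comp_apply, frobenius_def]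
        change _ = Ideal.Quotient.mk I (algebraMap _ _ a)
        rw [← map_pow, Ideal.Quotient.eq, ← map_pow, ← map_sub]
        obtain ⟨c, hc⟩ := hfermat a
        rw [hc, hI, Ideal.mem_span_singleton]
        exact ⟨algebraMap _ _ c, by simp⟩ }
  obtain ⟨g, hg⟩ := Algebra.FormallySmooth.exists_mkₐ_comp_eq_of_isAdicComplete (I := I) f
  have hgp : ∀ x, ∃ y, g x = x ^ p + p * y := by
    intro x
    have h1 : Ideal.Quotient.mk I (g x) = Ideal.Quotient.mk I (x ^ p) := by
      simpa [f, frobenius_def] using congr($hg x)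
    rw [Ideal.Quotient.eq, hI, Ideal.mem_span_singleton] at h1
    obtain ⟨y, hy⟩ := h1
    exact ⟨y, by linear_combination hy⟩
  have hginj : Function.Injective g := by
    rw [← AlgHom.coe_toRingHom, RingHom.injective_iff_ker_eq_bot]
    refine Ideal.eq_bot_of_comap_eq_bot (R := ℤ_[p]) ?_
    rw [eq_bot_iff]
    intro a ha
    have ha' : algebraMap ℤ_[p] (PadicRingOfIntegers p L) a = 0 := by
      simpa [RingHom.mem_ker] using ha
    exact hinj (by simpa using ha')
  let h : PadicRingOfIntegers p L →ₐ[ℤ_[p]] L := (integralClosure ℤ_[p] L).val.comp g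
  have hhinj : Function.Injective h := Subtype.val_injective.comp hginj
  let k : L →ₐ[ℤ_[p]] L := IsFractionRing.liftAlgHom (K := L) hhinj
  let k' : L →ₐ[ℚ_[p]] L := k.extendScalarsOfIsLocalization ℚ_[p] (nonZeroDivisors ℤ_[p])
  have hk : ∀ x : PadicRingOfIntegers p L, k' (x : L) = (g x : L) := fun x =>
    IsFractionRing.lift_algebraMap (K := L) hhinj x
  refine ⟨AlgEquiv.ofBijective k' (Algebra.IsAlgebraic.algHom_bijective k'), fun x => ?_, ?_⟩
  · obtain ⟨y, hy⟩ := hgp x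
    refine ⟨y, ?_⟩
    rw [AlgEquiv.coe_ofBijective, hk, hy]
    simp
  · intro τ hτ
    have hIbot : ⨅ i : ℕ, I ^ i = ⊥ := by
      have : IsNoetherianRing (PadicRingOfIntegers p L) := IsNoetherianRing.of_finite ℤ_[p] _
      exact Ideal.iInf_pow_eq_bot_of_isLocalRing I hpn
    have hτg : (τ.restrictScalars ℤ_[p]).mapIntegralClosure.toAlgHom = g := by
      refine Algebra.FormallyUnramified.ext_of_iInf I hIbot fun x => ?_
      obtain ⟨y, hy⟩ := hτ x
      obtain ⟨z, hz⟩ := hgp x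
      rw [Ideal.Quotient.eq, hI, Ideal.mem_span_singleton]
      refine ⟨y - z, Subtype.ext ?_⟩
      have : (((τ.restrictScalars ℤ_[p]).mapIntegralClosure x : PadicRingOfIntegers p L) : L)
        = τ (x : L) := rfl
      simp [hz, this, hy]
      ring
    ext x
    obtain ⟨a, b, hb, rfl⟩ := IsFractionRing.div_surjective (A := PadicRingOfIntegers p L) x
    have hx : ∀ a : PadicRingOfIntegers p L, τ (a : L) = k' (a : L) := by
      intro a
      rw [hk, ← hτg]
      rfl
    rw [map_div₀, map_div₀]
    exact congrArg₂ _ (hx a) (hx b)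

variable [Algebra.Unramified ℤ_[p] (PadicRingOfIntegers p L)]

/-- The Frobenius automorphism of an unramified extension `L` of `ℚ_[p]`. -/
def padicFrobenius : L ≃ₐ[ℚ_[p]] L :=
  (existsUnique_isPadicFrobenius p L).choose

/-- The Frobenius automorphism of the ring of integers. -/
def padicFrobeniusInt : PadicRingOfIntegers p L →+* PadicRingOfIntegers p L :=
  ((padicFrobenius p L).restrictScalars ℤ_[p]).mapIntegralClosure.toAlgHom.toRingHom

/-- The ring `𝓔 = 𝒪_L[[▲]]` of noncommutative power series with `▲ a = σ(a) ▲`. -/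
abbrev HondaRing : Type _ := SkewPowerSeries (padicFrobeniusInt p L)

/-- The operator `▲` on power series over `L`: it raises the variables to the power `p` and acts
on the coefficients by the Frobenius automorphism. -/
def frobeniusOperator {ι : Type*} (f : MvPowerSeries ι L) : MvPowerSeries ι L :=
  MvPowerSeries.expand p (Fact.out : p.Prime).ne_zero
    (f.map (padicFrobenius p L).toAlgHom.toRingHom)

variable {p L}

/-- The action `(∑ cₙ ▲ ^ n) f = ∑ cₙ ▲ ^ n f` of `𝓔` on power series without constant term. The
coefficient of `▲ ^ n f` at a monomial of degree less than `p ^ n` vanishes, so that the terms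
with `n` greater than the degree of the monomial contribute nothing. -/
def HondaRing.act {ι : Type*} (c : HondaRing p L) (f : MvPowerSeries ι L) : MvPowerSeries ι L :=
  fun m => ∑ n ∈ Finset.range (m.degree + 1),
    (c.coeff n : L) * MvPowerSeries.coeff m ((frobeniusOperator p L)^[n] f)

/-- The power series `lam` (without constant term) are of type `u`: `u ≡ p` modulo `▲` and
`u lam ≡ 0` modulo `p`. -/
def IsOfHondaType {d : ℕ} (u : Matrix (Fin d) (Fin d) (HondaRing p L))
    (lam : Fin d → MvPowerSeries (Fin d) L) : Prop :=
  (∀ i, MvPowerSeries.constantCoeff (lam i) = 0) ∧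
  (u.map fun c => c.coeff 0) = (p : Matrix (Fin d) (Fin d) (PadicRingOfIntegers p L)) ∧
  ∀ i m, ∃ c : PadicRingOfIntegers p L,
    MvPowerSeries.coeff m (∑ j, (u i j).act (lam j)) = p * (c : L)

end

section MatrixConditions

/-- The decomposition of `r` indices into the first `e` and the last `r - e` ones. -/
def blockIndex {e r : ℕ} (h : e ≤ r) : Fin e ⊕ Fin (r - e) ≃ Fin r :=
  finSumFinEquiv.trans (finCongr (Nat.add_sub_of_le h))

/-- A square matrix of size `r` written with blocks of sizes `e` and `r - e`. -/
def blockForm {R : Type*} {e r : ℕ} (h : e ≤ r) (M : Matrix (Fin r) (Fin r) R) :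
    Matrix (Fin e ⊕ Fin (r - e)) (Fin e ⊕ Fin (r - e)) R :=
  M.submatrix (blockIndex h) (blockIndex h)

/-- The matrix `I_{r,e}` with the identity matrix on top of a zero matrix. -/
def stdInclusion (R : Type*) [CommRing R] (r e : ℕ) : Matrix (Fin r) (Fin e) R :=
  Matrix.of fun i j => if (i : ℕ) = j then 1 else 0

variable {O : Type*} [CommRing O] {r : ℕ}

/-- The rank of the common kernel equals the dimension, over the residue field, of the common
kernel of the reductions. -/
def KernelRankCondition [IsLocalRing O] (S : Set (Matrix (Fin r) (Fin r) O)) : Prop :=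
  Module.finrank O ↥(⨅ D ∈ S, LinearMap.ker D.mulVecLin) =
    Module.finrank (IsLocalRing.ResidueField O)
      ↥(⨅ D ∈ S, LinearMap.ker (D.map (IsLocalRing.residue O)).mulVecLin)

/-- If every `D x` is divisible by `p`, then the quotients `D x / p` are the images of one vector
under the `D`. -/
def KernelLiftCondition (p : ℕ) (S : Set (Matrix (Fin r) (Fin r) O)) : Prop :=
  ∀ (x : Fin r → O) (y : Matrix (Fin r) (Fin r) O → Fin r → O),
    (∀ D ∈ S, D.mulVec x = (p : O) • y D) → ∃ x' : Fin r → O, ∀ D ∈ S, D.mulVec x' = y D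

/-- For every `D` in `S`, the first `e` columns of `Q⁻¹ D Q` are zero, and the remaining columns
`D̂ D` (rows of index less than `e`) and `D̃ D` (the other rows) of finitely many of these
matrices generate an invertible matrix `∑ Ĉᵢ D̂ᵢ + C̃ᵢ D̃ᵢ`. -/
def IsBlockTriangularization {e : ℕ} (h : e ≤ r) (Q : GL (Fin r) O)
    (S : Set (Matrix (Fin r) (Fin r) O)) : Prop :=
  ∃ (Dhat : Matrix (Fin r) (Fin r) O → Matrix (Fin e) (Fin (r - e)) O)
    (Dtilde : Matrix (Fin r) (Fin r) O → Matrix (Fin (r - e)) (Fin (r - e)) O),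
    (∀ D ∈ S, blockForm h ((Q⁻¹ : GL (Fin r) O).val * D * Q.val) =
      Matrix.fromBlocks 0 (Dhat D) 0 (Dtilde D)) ∧
    ∃ (m : ℕ) (D : Fin m → Matrix (Fin r) (Fin r) O)
      (Chat : Fin m → Matrix (Fin (r - e)) (Fin e) O)
      (Ctilde : Fin m → Matrix (Fin (r - e)) (Fin (r - e)) O),
      (∀ i, D i ∈ S) ∧
      IsUnit (∑ i, (Chat i * Dhat (D i) + Ctilde i * Dtilde (D i)))

/-- A block triangularization exists. -/
def KernelBlockCondition (S : Set (Matrix (Fin r) (Fin r) O)) : Prop :=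
  ∃ (e : ℕ) (h : e ≤ r) (Q : GL (Fin r) O), IsBlockTriangularization h Q S

end MatrixConditions

end

noncomputable section

/-! ### Order estimates for substitution and the formal inverse function theorem -/

section PowerSeries

open MvPowerSeries

variable {A : Type*} [CommRing A]

/-! Write `J = Q I_{r,e}` and `R = I_{r,e}ᵀ Q⁻¹`, so that `R J = 1`. Condition (iii) says, free of
blocks, that every `D` in the set kills `J` and that finitely many of them satisfy `∑ Bₖ Dₖ = 1 - J
R`. Both halves of the theorem run on this identity.

Part I. The ring of integers is a local principal ideal domain whose maximal ideal is generated by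
`p`. The common kernel `N` is saturated, so it is a direct summand and a basis of it stays
independent modulo `p` inside the common kernel of the reductions. Condition (i) says that this
reduced basis spans. Condition (ii) says that every `x` whose reduction lies in that kernel is
congruent modulo `p` to an element of `N`, which is the same thing. From (ii), duality over the
residue field and Nakayama show that the rows of the matrices `D` span the whole annihilator of `N`
(`row_mem_of_annihilates`). If the columns of `J` form a basis of `N`, the rows of `1 - J R` lie in
this annihilator, which gives the identity. Conversely, the identity produces `x' = ∑ Bₖ y_{Dₖ}`.

Part II. Let `aₖ` be the automorphisms with linear coefficients `Dₖ + 1`. The tuple `T(X) = J R X +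
∑ Bₖ (aₖ(X) - X)` has linear coefficient 1, so it is invertible over the integers, and at a fixed
point `x` it takes the value `J R x`. Hence every fixed point is `f(R x)` with `f = T⁻¹(J X)`. That
`f` is itself fixed, by the whole group, is seen over the fraction field: `w = Λ⁻¹(J X)` is fixed
because `(D + 1) J = J`, and `f` is `w` after a change of variables `λ`. Sums of fixed points are
fixed, so `Φ` restricts to a formal group law `F` through `f`. The same formula gives `Λ ∘ f = J λ`,
and `λ` is the logarithm of `F` (`FormalGroupLaw.exists_isUniversalFixedPair`).

The type comes from Honda's argument (`IsOfHondaType.subst`): if `v Λ ≡ 0` modulo `p` and `f` is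
integral, then `v (Λ ∘ f) ≡ 0` modulo `p`. Inserting `Λ ∘ f = Q I_{r,e} λ`, multiplying by `Q⁻¹` and
keeping the first `e` rows gives `u λ ≡ 0`. -/

theorem le_order_finsuppProd {σ τ : Type*} (f : σ → MvPowerSeries τ A)
    (hf : ∀ i, constantCoeff (f i) = 0) (d : σ →₀ ℕ) :
    (d.degree : ℕ∞) ≤ (d.prod fun i k => f i ^ k).order := by
  refine le_trans ?_ (le_order_prod _ _)
  rw [Finsupp.degree_apply, Nat.cast_sum]
  exact Finset.sum_le_sum fun i _ => le_order_pow_of_constantCoeff_eq_zero _ (hf i)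

/-- A monomial of degree `n` in series without constant term has order at least `n`, so only
finitely many terms matter. The index set does not depend on `f` or `g`, so two substitutions can be
compared term by term. -/
theorem coeff_subst_eq_sum {σ τ : Type*} [Finite σ] (g : MvPowerSeries σ A)
    (f : σ → MvPowerSeries τ A) (hf : ∀ i, constantCoeff (f i) = 0) (m : τ →₀ ℕ) {N : ℕ}
    (hN : m.degree ≤ N) :
    coeff m (g.subst f) = ∑ d ∈ (Finsupp.finite_of_degree_le (σ := σ) N).toFinset,
      coeff d g * coeff m (d.prod fun i k => f i ^ k) := by
  rw [coeff_subst (hasSubst_of_constantCoeff_zero hf)]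
  refine finsum_eq_finsetSum_of_support_subset _ fun d hd => ?_
  simp only [Set.Finite.coe_toFinset, Set.mem_ofPred_eq]
  by_contra hlt
  refine hd ?_
  change _ • _ = _
  rw [coeff_of_lt_order (f := d.prod _), smul_zero]
  exact lt_of_lt_of_le (by exact_mod_cast hN.trans_lt (not_le.mp hlt)) (le_order_finsuppProd f hf d)

theorem le_order_sub {τ : Type*} {f g : MvPowerSeries τ A} {n : ℕ∞} (hf : n ≤ f.order)
    (hg : n ≤ g.order) : n ≤ (f - g).order := by
  rw [sub_eq_add_neg]
  exact (le_min hf (by rwa [order_neg])).trans min_order_le_add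

theorem le_order_add {τ : Type*} {f g : MvPowerSeries τ A} {n : ℕ∞} (hf : n ≤ f.order)
    (hg : n ≤ g.order) : n ≤ (f + g).order :=
  (le_min hf hg).trans min_order_le_add

theorem order_le_order_subst {σ τ : Type*} [Finite σ] (g : MvPowerSeries σ A)
    (f : σ → MvPowerSeries τ A) (hf : ∀ i, constantCoeff (f i) = 0) :
    g.order ≤ (g.subst f).order := by
  refine le_trans ?_ (le_order_subst (hasSubst_of_constantCoeff_zero hf) g)
  conv_lhs => rw [← one_mul g.order]
  gcongr
  exact le_iInf fun i => one_le_order_iff_constCoeff_eq_zero.mpr (hf i)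

/-- Replacing the factors `f i` by `X i` one at a time, each replacement trades a factor of order at
least 1 for a difference of order at least 2 and so gains one degree. -/
theorem le_order_finsuppProd_sub {σ : Type*} (f : σ → MvPowerSeries σ A)
    (hf : ∀ i, 2 ≤ (f i - X i).order) (d : σ →₀ ℕ) :
    (d.degree : ℕ∞) + 1 ≤
      ((d.prod fun i k => f i ^ k) - d.prod fun i k => (X i : MvPowerSeries σ A) ^ k).order := by
  classical
  have hf0 : ∀ i, constantCoeff (f i) = 0 := by
    intro i
    have h := coeff_of_lt_order (f := f i - X i) (d := 0)
      (lt_of_lt_of_le (by simp) (hf i))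
    simpa using h
  induction d using Finsupp.induction_linear with
  | zero => simp
  | add d d' h h' =>
    rw [Finsupp.prod_add_index' (by simp) (by intros; rw [pow_add]),
      Finsupp.prod_add_index' (by simp) (by intros; rw [pow_add])]
    rw [show ∀ a b a' b' : MvPowerSeries σ A, a * b - a' * b' = (a - a') * b + a' * (b - b') by
      intros; ring]
    refine le_order_add (le_trans ?_ le_order_mul) (le_trans ?_ le_order_mul)
    · refine le_trans (le_of_eq ?_) (add_le_add h (le_order_finsuppProd f hf0 d'))
      simp only [map_add, Nat.cast_add]
      ring
    · refine le_trans (le_of_eq ?_) (add_le_add (le_order_finsuppProd X (by simp) d) h')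
      simp only [map_add, Nat.cast_add]
      ring
  | single i k =>
    rw [Finsupp.prod_single_index (by simp), Finsupp.prod_single_index (by simp),
      Finsupp.degree_single]
    induction k with
    | zero => simp
    | succ k ih =>
      rw [show f i ^ (k + 1) - X i ^ (k + 1) = (f i ^ k - X i ^ k) * f i + X i ^ k * (f i - X i) by
        ring]
      refine le_order_add (le_trans ?_ le_order_mul) (le_trans ?_ le_order_mul)
      · push_cast
        exact add_le_add ih (one_le_order_iff_constCoeff_eq_zero.mpr (hf0 i))
      · refine le_trans (le_of_eq ?_) (add_le_add
          (le_order_pow_of_constantCoeff_eq_zero k (constantCoeff_X i)) (hf i))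
        push_cast
        rw [add_assoc, one_add_one_eq_two]

/-- If `f ≡ X mod deg 2`, then `g ∘ f ≡ g` to one degree more than the order of `g`. -/
theorem le_order_subst_sub_self {σ : Type*} [Finite σ] (f : σ → MvPowerSeries σ A)
    (hf : ∀ i, 2 ≤ (f i - X i).order) (g : MvPowerSeries σ A) :
    g.order + 1 ≤ (g.subst f - g).order := by
  have hf0 : ∀ i, constantCoeff (f i) = 0 := by
    intro i
    have h := coeff_of_lt_order (f := f i - X i) (d := 0)
      (lt_of_lt_of_le (by simp) (hf i))
    simpa using h
  refine le_order fun m hm => ?_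
  have hself : g = g.subst (X : σ → MvPowerSeries σ A) := by rw [subst_self]; rfl
  have h2 := congrArg (coeff m) hself
  rw [coeff_subst_eq_sum g X (by simp) m le_rfl] at h2
  rw [map_sub, h2, coeff_subst_eq_sum g f hf0 m le_rfl, ← Finset.sum_sub_distrib]
  refine Finset.sum_eq_zero fun d _ => ?_
  rw [← mul_sub, ← map_sub]
  by_cases hd : coeff d g = 0
  · rw [hd, zero_mul]
  · rw [coeff_of_lt_order (f := _ - _), mul_zero]
    refine lt_of_lt_of_le (hm.trans_le ?_) (le_order_finsuppProd_sub f hf d)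
    gcongr
    exact order_le hd

/-- Neumann series: the operator `T g = g - g ∘ f` raises the order, so `1 - T`, which is
composition with `f`, is inverted by `∑ Tᵏ`. The left inverse is this sum applied to `X`. -/
theorem exists_seriesComp_eq_X {σ : Type*} [Finite σ] (f : σ → MvPowerSeries σ A)
    (hf : ∀ i, 2 ≤ (f i - X i).order) :
    ∃ g : σ → MvPowerSeries σ A, (∀ i, 2 ≤ (g i - X i).order) ∧ seriesComp g f = X := by
  have hf0 : ∀ i, constantCoeff (f i) = 0 := by
    intro i
    have h := coeff_of_lt_order (f := f i - X i) (d := 0)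
      (lt_of_lt_of_le (by simp) (hf i))
    simpa using h
  have hs := hasSubst_of_constantCoeff_zero hf0
  let T : MvPowerSeries σ A → MvPowerSeries σ A := fun g => g - g.subst f
  have hT : ∀ i k, ((k + 1 : ℕ) : ℕ∞) ≤ (T^[k] (X i)).order := by
    intro i k
    induction k with
    | zero => simpa using one_le_order_iff_constCoeff_eq_zero.mpr (constantCoeff_X i)
    | succ k ih =>
      rw [Function.iterate_succ_apply']
      change _ ≤ (_ - _ : MvPowerSeries σ A).order
      rw [← order_neg, neg_sub]
      refine le_trans ?_ (le_order_subst_sub_self f hf _)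
      push_cast at ih ⊢
      gcongr
  let P : σ → ℕ → MvPowerSeries σ A := fun i n => ∑ k ∈ Finset.range n, T^[k] (X i)
  -- As `Tᵏ X` has order at least `k + 1`, the coefficient at `m` of the partial sums is constant
  -- from `m.degree` on; this is the limit of the partial sums.
  let g : σ → MvPowerSeries σ A := fun i m => coeff m (P i (m.degree + 1))
  have hg : ∀ i (n : ℕ), ((n + 1 : ℕ) : ℕ∞) ≤ (g i - P i n).order := by
    intro i n
    refine le_order fun m hm => ?_
    have hm' : m.degree < n + 1 := by exact_mod_cast hm
    have hstep : ∀ k, m.degree ≤ k → coeff m (P i k) = coeff m (P i m.degree) := by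
      intro k hk
      induction k, hk using Nat.le_induction with
      | base => rfl
      | succ k hk ih =>
        change coeff m (∑ k ∈ Finset.range (k + 1), T^[k] (X i)) = _
        rw [Finset.sum_range_succ, map_add, coeff_of_lt_order (f := T^[k] (X i)), add_zero]
        · exact ih
        · exact lt_of_lt_of_le (by exact_mod_cast Nat.lt_succ_of_le hk) (hT i k)
    rw [map_sub, sub_eq_zero]
    change coeff m (P i (m.degree + 1)) = _
    rw [hstep _ (Nat.le_succ _), hstep n (by omega)]
  have hP : ∀ i n, (P i n).subst f = X i - T^[n] (X i) := by
    intro i n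
    induction n with
    | zero =>
      simp only [P, Finset.range_zero, Finset.sum_empty, Function.iterate_zero, id, sub_self]
      rw [← coe_substAlgHom hs, map_zero]
    | succ n ih =>
      have : P i (n + 1) = P i n + T^[n] (X i) := Finset.sum_range_succ _ _
      rw [this, subst_add hs, ih, Function.iterate_succ_apply']
      change _ = _ - (T^[n] (X i) - (T^[n] (X i)).subst f)
      ring
  refine ⟨g, fun i => ?_, funext fun i => ?_⟩
  · have h := hg i 1
    simpa [P] using h
  · rw [← sub_eq_zero, ← order_eq_top_iff, ENat.eq_top_iff_forall_ge]
    intro n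
    have h1 : seriesComp g f i - X i = (g i - P i n).subst f - T^[n] (X i) := by
      rw [subst_sub hs, hP]
      simp only [seriesComp]
      ring
    rw [h1]
    refine le_order_sub ?_ ?_
    · exact le_trans (by exact_mod_cast Nat.le_succ n)
        ((hg i n).trans (order_le_order_subst _ f hf0))
    · exact le_trans (by exact_mod_cast Nat.le_succ n) (hT i n)

theorem two_le_order_sub_X_iff {d : ℕ} {f : Fin d → MvPowerSeries (Fin d) A} :
    (∀ i, 2 ≤ (f i - X i).order) ↔ (∀ i, constantCoeff (f i) = 0) ∧ linearCoeff f = 1 := by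
  classical
  constructor
  · intro h
    refine ⟨fun i => ?_, ?_⟩
    · simpa using coeff_of_lt_order (f := f i - X i) (d := 0) (lt_of_lt_of_le (by simp) (h i))
    · ext i j
      have := coeff_of_lt_order (f := f i - X i) (d := Finsupp.single j 1)
        (lt_of_lt_of_le (by simp) (h i))
      rw [map_sub, sub_eq_zero] at this
      rw [linearCoeff, Matrix.of_apply, this, coeff_X, Matrix.one_apply]
      simp [Finsupp.single_left_inj, eq_comm]
  · rintro ⟨h0, h1⟩ i
    refine le_order fun m hm => ?_
    have hm' : m.degree < 2 := by exact_mod_cast hm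
    interval_cases hd : m.degree
    · rw [Finsupp.degree_eq_zero_iff] at hd
      subst hd
      simpa using h0 i
    · obtain ⟨j, rfl⟩ : ∃ j, m = Finsupp.single j 1 := by
        rw [Finsupp.degree_apply] at hd
        obtain ⟨j, hj⟩ := (Finsupp.sum_eq_one_iff m).mp hd
        exact ⟨j, hj⟩
      have := congrFun (congrFun h1 i) j
      rw [linearCoeff, Matrix.of_apply, Matrix.one_apply] at this
      rw [map_sub, this, coeff_X]
      simp [Finsupp.single_left_inj, eq_comm]

/-- The formal inverse function theorem. -/
theorem exists_isCompInverse {d : ℕ} (f : Fin d → MvPowerSeries (Fin d) A)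
    (hf0 : ∀ i, constantCoeff (f i) = 0) (hf1 : linearCoeff f = 1) :
    ∃ g, FormalGroupLaw.IsCompInverse f g ∧ linearCoeff g = 1 := by
  obtain ⟨g, hg, hgf⟩ := exists_seriesComp_eq_X f (two_le_order_sub_X_iff.mpr ⟨hf0, hf1⟩)
  obtain ⟨h, hh, hhg⟩ := exists_seriesComp_eq_X g hg
  obtain ⟨hg0, hg1⟩ := two_le_order_sub_X_iff.mp hg
  refine ⟨g, ⟨hg0, ?_, hgf⟩, hg1⟩
  -- The left inverse `g` of `f` has a left inverse `h` of its own, and `h = h ∘ (g ∘ f) = f`; so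
  -- `g` is a two-sided inverse.
  have hfh : f = h := by
    have h1 := FormalGroupLaw.seriesComp_assoc h g f hg0 hf0
    rw [hhg, hgf, FormalGroupLaw.seriesComp_X] at h1
    rw [← h1]
    exact (FormalGroupLaw.X_seriesComp (_root_.id : Fin d → Fin d) f hf0).symm
  rw [hfh, hhg]

end PowerSeries

end

noncomputable section

/-! ### Matrices acting on tuples of series, and linear coefficients -/

section MatrixSeries

open MvPowerSeries

variable {A : Type*} [CommRing A] {σ τ : Type*} {d d' d'' : ℕ}

theorem matrixMulSeries_mul (M : Matrix (Fin d'') (Fin d') A) (N : Matrix (Fin d') (Fin d) A)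
    (f : Fin d → MvPowerSeries σ A) :
    matrixMulSeries (M * N) f = matrixMulSeries M (matrixMulSeries N f) := by
  funext i
  simp only [matrixMulSeries, Matrix.mul_apply, Finset.sum_smul, Finset.smul_sum, smul_smul]
  exact Finset.sum_comm

theorem matrixMulSeries_one (f : Fin d → MvPowerSeries σ A) : matrixMulSeries 1 f = f := by
  funext i
  simp [matrixMulSeries, Matrix.one_apply, ite_smul]

theorem matrixMulSeries_zero_right (M : Matrix (Fin d') (Fin d) A) :
    matrixMulSeries M (0 : Fin d → MvPowerSeries σ A) = 0 := by
  funext i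
  simp [matrixMulSeries]

theorem matrixMulSeries_add_right (M : Matrix (Fin d') (Fin d) A)
    (f g : Fin d → MvPowerSeries σ A) :
    matrixMulSeries M (f + g) = matrixMulSeries M f + matrixMulSeries M g := by
  funext i
  simp [matrixMulSeries, Finset.sum_add_distrib]

theorem seriesComp_matrixMulSeries [Finite σ] (M : Matrix (Fin d') (Fin d) A)
    (f : Fin d → MvPowerSeries σ A) (g : σ → MvPowerSeries τ A)
    (hg : ∀ i, constantCoeff (g i) = 0) :
    seriesComp (matrixMulSeries M f) g = matrixMulSeries M (seriesComp f g) := by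
  have hs := hasSubst_of_constantCoeff_zero hg
  funext i
  simp only [seriesComp, matrixMulSeries]
  rw [← coe_substAlgHom hs, map_sum]
  exact Finset.sum_congr rfl fun j _ => map_smul _ _ _

theorem seriesComp_add [Finite σ] {ι : Type*} (f f' : ι → MvPowerSeries σ A)
    (g : σ → MvPowerSeries τ A) (hg : ∀ i, constantCoeff (g i) = 0) :
    seriesComp (f + f') g = seriesComp f g + seriesComp f' g :=
  funext fun _ => subst_add (hasSubst_of_constantCoeff_zero hg) _ _

theorem seriesComp_sub [Finite σ] {ι : Type*} (f f' : ι → MvPowerSeries σ A)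
    (g : σ → MvPowerSeries τ A) (hg : ∀ i, constantCoeff (g i) = 0) :
    seriesComp (f - f') g = seriesComp f g - seriesComp f' g :=
  funext fun _ => subst_sub (hasSubst_of_constantCoeff_zero hg) _ _

theorem seriesComp_sum [Finite σ] {ι κ : Type*} (s : Finset κ) (f : κ → ι → MvPowerSeries σ A)
    (g : σ → MvPowerSeries τ A) (hg : ∀ i, constantCoeff (g i) = 0) :
    seriesComp (∑ k ∈ s, f k) g = ∑ k ∈ s, seriesComp (f k) g := by
  funext i
  simp only [seriesComp, Finset.sum_apply]
  rw [← coe_substAlgHom (hasSubst_of_constantCoeff_zero hg), map_sum]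

theorem X_seriesComp_self [Finite σ] (f : σ → MvPowerSeries τ A)
    (hf : ∀ i, constantCoeff (f i) = 0) : seriesComp X f = f :=
  FormalGroupLaw.X_seriesComp (_root_.id : σ → σ) f hf

theorem constantCoeff_matrixMulSeries (M : Matrix (Fin d') (Fin d) A)
    (f : Fin d → MvPowerSeries σ A) (hf : ∀ i, constantCoeff (f i) = 0) (i : Fin d') :
    constantCoeff (matrixMulSeries M f i) = 0 := by
  simp [matrixMulSeries, hf, ← coeff_zero_eq_constantCoeff_apply] at hf ⊢

theorem mapSeries_matrixMulSeries {B : Type*} [CommRing B] (φ : A →+* B)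
    (M : Matrix (Fin d') (Fin d) A) (f : Fin d → MvPowerSeries σ A) :
    mapSeries φ (matrixMulSeries M f) = matrixMulSeries (M.map φ) (mapSeries φ f) := by
  funext i
  ext m
  simp [mapSeries, matrixMulSeries, coeff_map]

theorem constantCoeff_mapSeries {B ι : Type*} [CommRing B] (φ : A →+* B)
    (f : ι → MvPowerSeries σ A) (hf : ∀ i, constantCoeff (f i) = 0) (i : ι) :
    constantCoeff (mapSeries φ f i) = 0 := by
  simp [mapSeries, hf]

theorem mapSeries_injective {B ι : Type*} [CommRing B] {φ : A →+* B}
    (hφ : Function.Injective φ) :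
    Function.Injective (mapSeries φ : (ι → MvPowerSeries σ A) → (ι → MvPowerSeries σ B)) :=
  fun _ _ h => funext fun i => MvPowerSeries.ext fun m => hφ <| by
    simpa [mapSeries] using congrArg (coeff m) (congrFun h i)

theorem linearCoeff_matrixMulSeries (M : Matrix (Fin d'') (Fin d') A)
    (f : Fin d' → MvPowerSeries (Fin d) A) :
    linearCoeff (matrixMulSeries M f) = M * linearCoeff f := by
  ext i j
  simp [linearCoeff, matrixMulSeries, Matrix.mul_apply]

theorem linearCoeff_add (f g : Fin d' → MvPowerSeries (Fin d) A) :
    linearCoeff (f + g) = linearCoeff f + linearCoeff g := by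
  ext i j
  simp [linearCoeff]

theorem linearCoeff_sub (f g : Fin d' → MvPowerSeries (Fin d) A) :
    linearCoeff (f - g) = linearCoeff f - linearCoeff g := by
  ext i j
  simp [linearCoeff]

theorem linearCoeff_sum {κ : Type*} (s : Finset κ) (f : κ → Fin d' → MvPowerSeries (Fin d) A) :
    linearCoeff (∑ k ∈ s, f k) = ∑ k ∈ s, linearCoeff (f k) := by
  ext i j
  simp [linearCoeff, Matrix.sum_apply]

theorem linearCoeff_X : linearCoeff (X : Fin d → MvPowerSeries (Fin d) A) = 1 := by
  ext i j
  rw [linearCoeff, Matrix.of_apply, coeff_X, Matrix.one_apply]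
  simp [Finsupp.single_left_inj, eq_comm]

theorem linearCoeff_mapSeries {B : Type*} [CommRing B] (φ : A →+* B)
    (f : Fin d' → MvPowerSeries (Fin d) A) :
    linearCoeff (mapSeries φ f) = (linearCoeff f).map φ := by
  ext i j
  simp [linearCoeff, mapSeries]

/-- The chain rule at the origin: monomials of degree at least 2 in `f` have no linear part, and the
constant monomial has none either. -/
theorem linearCoeff_seriesComp (g : Fin d'' → MvPowerSeries (Fin d') A)
    (f : Fin d' → MvPowerSeries (Fin d) A) (hf : ∀ i, constantCoeff (f i) = 0) :
    linearCoeff (seriesComp g f) = linearCoeff g * linearCoeff f := by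
  classical
  ext i j
  simp only [linearCoeff, seriesComp, Matrix.mul_apply, Matrix.of_apply]
  rw [coeff_subst_eq_sum (g i) f hf _ (N := 1) (by simp)]
  rw [← Finset.sum_image (s := Finset.univ) (g := fun k : Fin d' => Finsupp.single k 1)
    (f := fun n => coeff n (g i) * coeff (Finsupp.single j 1) (n.prod fun i k => f i ^ k))
    (fun a _ b _ h => by simpa [Finsupp.single_left_inj] using h) |>.trans (Finset.sum_congr rfl
      fun k _ => by rw [Finsupp.prod_single_index (by simp), pow_one])]
  refine (Finset.sum_subset ?_ ?_).symm
  · intro n hn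
    obtain ⟨k, -, rfl⟩ := Finset.mem_image.mp hn
    simp
  · intro n hn hn'
    have hn1 : n.degree ≤ 1 := by simpa using hn
    rcases Nat.le_one_iff_eq_zero_or_eq_one.mp hn1 with h | h
    · rw [Finsupp.degree_eq_zero_iff] at h
      subst h
      simp [coeff_one]
    · rw [Finsupp.degree_apply] at h
      obtain ⟨k, rfl⟩ := (Finsupp.sum_eq_one_iff n).mp h
      exact absurd (Finset.mem_image_of_mem _ (Finset.mem_univ k)) hn'

end MatrixSeries

/-! ### Formal group laws as addition of points, homomorphisms and logarithms -/

namespace FormalGroupLaw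

open MvPowerSeries

variable {A : Type*} [CommRing A] {d d' d'' : ℕ} {τ υ : Type*}

/-- The sum of two tuples of power series with respect to a formal group law. -/
def sum (F : FormalGroupLaw A d) (a b : Fin d → MvPowerSeries τ A) : Fin d → MvPowerSeries τ A :=
  seriesComp F.toSeries (Sum.elim a b)

theorem constantCoeff_sum (F : FormalGroupLaw A d) {a b : Fin d → MvPowerSeries τ A}
    (ha : ∀ i, constantCoeff (a i) = 0) (hb : ∀ i, constantCoeff (b i) = 0) (i : Fin d) :
    constantCoeff (F.sum a b i) = 0 :=
  constantCoeff_seriesComp _ _ F.constantCoeff_toSeries (constantCoeff_sumElim ha hb) i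

theorem sum_seriesComp [Finite τ] (F : FormalGroupLaw A d) {a b : Fin d → MvPowerSeries τ A}
    (ha : ∀ i, constantCoeff (a i) = 0) (hb : ∀ i, constantCoeff (b i) = 0)
    {c : τ → MvPowerSeries υ A} (hc : ∀ i, constantCoeff (c i) = 0) :
    seriesComp (F.sum a b) c = F.sum (seriesComp a c) (seriesComp b c) := by
  rw [sum, seriesComp_assoc _ _ _ (constantCoeff_sumElim ha hb) hc, seriesComp_sumElim]
  rfl

theorem IsHom.map_sum {F : FormalGroupLaw A d} {F' : FormalGroupLaw A d'}
    {f : Fin d' → MvPowerSeries (Fin d) A} (hf : IsHom F F' f) {a b : Fin d → MvPowerSeries τ A}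
    (ha : ∀ i, constantCoeff (a i) = 0) (hb : ∀ i, constantCoeff (b i) = 0) :
    seriesComp f (F.sum a b) = F'.sum (seriesComp f a) (seriesComp f b) := by
  have hab := constantCoeff_sumElim ha hb
  have hX : ∀ j : Fin d → Fin d ⊕ Fin d, ∀ i,
      constantCoeff (X (j i) : MvPowerSeries (Fin d ⊕ Fin d) A) = 0 := fun j i => by simp
  have hl := constantCoeff_seriesComp f _ hf.zero (hX .inl)
  have hr := constantCoeff_seriesComp f _ hf.zero (hX .inr)
  rw [sum, ← seriesComp_assoc _ _ _ F.constantCoeff_toSeries hab, hf.map_add]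
  change seriesComp (F'.sum _ _) _ = _
  rw [sum_seriesComp _ hl hr hab, seriesComp_assoc _ _ _ (hX .inl) hab,
    seriesComp_assoc _ _ _ (hX .inr) hab, X_seriesComp _ _ hab, X_seriesComp _ _ hab]
  rfl

theorem sum_zero (F : FormalGroupLaw A d) {a : Fin d → MvPowerSeries τ A}
    (ha : ∀ i, constantCoeff (a i) = 0) : F.sum a 0 = a := by
  have h := congrArg (fun g => seriesComp g a) F.add_zero
  have hX : ∀ i, constantCoeff (X i : MvPowerSeries (Fin d) A) = 0 := fun i => by simp
  have h0 : seriesComp (0 : Fin d → MvPowerSeries (Fin d) A) a = 0 := by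
    funext i
    simp only [seriesComp, Pi.zero_apply]
    rw [← coe_substAlgHom (hasSubst_of_constantCoeff_zero ha), map_zero]
  change seriesComp (F.sum _ _) _ = _ at h
  rwa [sum_seriesComp _ hX (by simp) ha, X_seriesComp_self _ ha, h0] at h

theorem sum_assoc (F : FormalGroupLaw A d) {a b c : Fin d → MvPowerSeries τ A}
    (ha : ∀ i, constantCoeff (a i) = 0) (hb : ∀ i, constantCoeff (b i) = 0)
    (hc : ∀ i, constantCoeff (c i) = 0) : F.sum a (F.sum b c) = F.sum (F.sum a b) c := by
  have h := congrArg (fun g => seriesComp g (Sum.elim a (Sum.elim b c))) F.assoc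
  have habc := constantCoeff_sumElim ha (constantCoeff_sumElim hb hc)
  have hX : ∀ j : Fin d → Fin d ⊕ Fin d ⊕ Fin d, ∀ i,
      constantCoeff (X (j i) : MvPowerSeries (Fin d ⊕ Fin d ⊕ Fin d) A) = 0 := fun j i => by simp
  have hx := hX .inl
  have hy := hX fun i => .inr (.inl i)
  have hz := hX fun i => .inr (.inr i)
  change seriesComp (F.sum _ (F.sum _ _)) _ = seriesComp (F.sum (F.sum _ _) _) _ at h
  rwa [sum_seriesComp _ hx (F.constantCoeff_sum hy hz) habc, sum_seriesComp _ hy hz habc,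
    sum_seriesComp _ (F.constantCoeff_sum hx hy) hz habc, sum_seriesComp _ hx hy habc,
    X_seriesComp _ _ habc, X_seriesComp _ _ habc, X_seriesComp _ _ habc] at h

theorem sum_comm (F : FormalGroupLaw A d) {a b : Fin d → MvPowerSeries τ A}
    (ha : ∀ i, constantCoeff (a i) = 0) (hb : ∀ i, constantCoeff (b i) = 0) :
    F.sum a b = F.sum b a := by
  have hab := constantCoeff_sumElim ha hb
  have hX : ∀ j : Fin d → Fin d ⊕ Fin d, ∀ i,
      constantCoeff (X (j i) : MvPowerSeries (Fin d ⊕ Fin d) A) = 0 := fun j i => by simp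
  have h := congrArg (fun g => seriesComp g (Sum.elim a b)) F.comm
  change _ = seriesComp (F.sum _ _) _ at h
  rwa [sum_seriesComp _ (hX .inr) (hX .inl) hab, X_seriesComp _ _ hab, X_seriesComp _ _ hab] at h

theorem sum_X (F : FormalGroupLaw A d) :
    F.sum (fun i => X (.inl i)) (fun i => X (.inr i)) = F.toSeries := by
  have : (Sum.elim (fun i => X (.inl i)) (fun i => X (.inr i)) :
      Fin d ⊕ Fin d → MvPowerSeries (Fin d ⊕ Fin d) A) = X := by
    funext i
    rcases i with i | i <;> rfl
  rw [sum, this, seriesComp_X]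

theorem additive_sum {a b : Fin d → MvPowerSeries τ A} (ha : ∀ i, constantCoeff (a i) = 0)
    (hb : ∀ i, constantCoeff (b i) = 0) : (additive A d).sum a b = a + b := by
  have hs := hasSubst_of_constantCoeff_zero (constantCoeff_sumElim ha hb)
  funext i
  simp [sum, additive, seriesComp, subst_add hs, subst_X hs]

theorem mapSeries_sum {B : Type*} [CommRing B] (φ : A →+* B) (F : FormalGroupLaw A d)
    {a b : Fin d → MvPowerSeries τ A} (ha : ∀ i, constantCoeff (a i) = 0)
    (hb : ∀ i, constantCoeff (b i) = 0) :
    mapSeries φ (F.sum a b) = (F.map φ).sum (mapSeries φ a) (mapSeries φ b) := by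
  rw [sum, mapSeries_seriesComp _ _ _ (constantCoeff_sumElim ha hb), mapSeries_sumElim]
  rfl

/-- The formal group law on a subvariety, given by a closed embedding `f` with the retraction `rt`,
that is stable under the addition of `Φ`. -/
def restrict (Φ : FormalGroupLaw A d) (f : Fin d → MvPowerSeries (Fin d') A)
    (s : Fin d' → MvPowerSeries (Fin d' ⊕ Fin d') A) (rt : Fin d' → MvPowerSeries (Fin d) A)
    (hf : ∀ i, constantCoeff (f i) = 0) (hs : ∀ i, constantCoeff (s i) = 0)
    (hrt : seriesComp rt f = X)
    (h : seriesComp f s = Φ.sum (seriesComp f fun i => X (.inl i))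
      (seriesComp f fun i => X (.inr i))) : FormalGroupLaw A d' := by
  have hX : ∀ j : Fin d' → Fin d' ⊕ Fin d', ∀ i,
      constantCoeff (X (j i) : MvPowerSeries (Fin d' ⊕ Fin d') A) = 0 := fun j i => by simp
  -- Because of the retraction, composition with `f` is injective, so each axiom for `s` can be
  -- checked after composing with `f`, where it becomes the axiom for `Φ`.
  have inj : ∀ {υ : Type} (a b : Fin d' → MvPowerSeries υ A), (∀ i, constantCoeff (a i) = 0) →
      (∀ i, constantCoeff (b i) = 0) → seriesComp f a = seriesComp f b → a = b := by
    intro υ a b ha hb hab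
    have := congrArg (seriesComp rt) hab
    rwa [← seriesComp_assoc _ _ _ hf ha, ← seriesComp_assoc _ _ _ hf hb, hrt,
      X_seriesComp_self _ ha, X_seriesComp_self _ hb] at this
  have key : ∀ {υ : Type} (a b : Fin d' → MvPowerSeries υ A), (∀ i, constantCoeff (a i) = 0) →
      (∀ i, constantCoeff (b i) = 0) →
      seriesComp f (seriesComp s (Sum.elim a b)) = Φ.sum (seriesComp f a) (seriesComp f b) := by
    intro υ a b ha hb
    have hab := constantCoeff_sumElim ha hb
    rw [← seriesComp_assoc _ _ _ hs hab, h, sum_seriesComp _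
      (constantCoeff_seriesComp _ _ hf (hX .inl)) (constantCoeff_seriesComp _ _ hf (hX .inr)) hab,
      seriesComp_assoc _ _ _ (hX .inl) hab, seriesComp_assoc _ _ _ (hX .inr) hab,
      X_seriesComp _ _ hab, X_seriesComp _ _ hab]
    rfl
  have hs' : ∀ {υ : Type} (a b : Fin d' → MvPowerSeries υ A), (∀ i, constantCoeff (a i) = 0) →
      (∀ i, constantCoeff (b i) = 0) → ∀ i, constantCoeff (seriesComp s (Sum.elim a b) i) = 0 :=
    fun a b ha hb => constantCoeff_seriesComp _ _ hs (constantCoeff_sumElim ha hb)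
  have hf' : ∀ {υ : Type} (a : Fin d' → MvPowerSeries υ A), (∀ i, constantCoeff (a i) = 0) →
      ∀ i, constantCoeff (seriesComp f a i) = 0 :=
    fun a ha => constantCoeff_seriesComp _ _ hf ha
  refine ⟨s, ?_, ?_, ?_⟩
  · have hX1 : ∀ i, constantCoeff (X i : MvPowerSeries (Fin d') A) = 0 := fun i => by simp
    have h0 : ∀ i, constantCoeff ((0 : Fin d' → MvPowerSeries (Fin d') A) i) = 0 := fun i => by simp
    refine inj _ _ (hs' _ _ hX1 h0) hX1 ?_
    have hf0 : seriesComp f (0 : Fin d' → MvPowerSeries (Fin d') A) = 0 :=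
      funext fun i => subst_zero_of_constantCoeff_zero (hf i)
    rw [key _ _ hX1 h0, hf0, seriesComp_X, sum_zero _ hf]
  · intro x y z
    have hx : ∀ i, constantCoeff (x i) = 0 := fun i => by simp [x]
    have hy : ∀ i, constantCoeff (y i) = 0 := fun i => by simp [y]
    have hz : ∀ i, constantCoeff (z i) = 0 := fun i => by simp [z]
    refine inj _ _ (hs' _ _ hx (hs' _ _ hy hz)) (hs' _ _ (hs' _ _ hx hy) hz) ?_
    rw [key _ _ hx (hs' _ _ hy hz), key _ _ hy hz, key _ _ (hs' _ _ hx hy) hz, key _ _ hx hy,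
      sum_assoc _ (hf' _ hx) (hf' _ hy) (hf' _ hz)]
  · refine inj _ _ hs (hs' _ _ (hX .inr) (hX .inl)) ?_
    rw [key _ _ (hX .inr) (hX .inl), h, sum_comm _ (hf' _ (hX .inl)) (hf' _ (hX .inr))]

theorem IsHom.map {B : Type*} [CommRing B] (φ : A →+* B) {F : FormalGroupLaw A d}
    {F' : FormalGroupLaw A d'} {f : Fin d' → MvPowerSeries (Fin d) A} (hf : IsHom F F' f) :
    IsHom (F.map φ) (F'.map φ) (mapSeries φ f) := by
  have hX : ∀ j : Fin d → Fin d ⊕ Fin d, ∀ i,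
      constantCoeff (X (j i) : MvPowerSeries (Fin d ⊕ Fin d) A) = 0 := fun j i => by simp
  refine ⟨constantCoeff_mapSeries _ _ hf.zero, ?_⟩
  have h := congrArg (mapSeries φ) hf.map_add
  rw [mapSeries_seriesComp _ _ _ F.constantCoeff_toSeries, mapSeries_seriesComp _ _ _
    (constantCoeff_sumElim (constantCoeff_seriesComp _ _ hf.zero (hX .inl))
      (constantCoeff_seriesComp _ _ hf.zero (hX .inr))), mapSeries_sumElim,
    mapSeries_seriesComp _ _ _ (hX .inl), mapSeries_seriesComp _ _ _ (hX .inr), mapSeries_X,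
    mapSeries_X] at h
  exact h

/-- The inverse under composition of a homomorphism is a homomorphism. -/
theorem IsHom.of_isCompInverse {F F' : FormalGroupLaw A d} {f g : Fin d → MvPowerSeries (Fin d) A}
    (hf : IsHom F F' f) (hg : IsCompInverse f g) : IsHom F' F g := by
  obtain ⟨hg0, hfg, hgf⟩ := hg
  have hX : ∀ j : Fin d → Fin d ⊕ Fin d, ∀ i,
      constantCoeff (X (j i) : MvPowerSeries (Fin d ⊕ Fin d) A) = 0 := fun j i => by simp
  have hl := constantCoeff_seriesComp g _ hg0 (hX .inl)
  have hr := constantCoeff_seriesComp g _ hg0 (hX .inr)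
  refine ⟨hg0, ?_⟩
  change _ = F.sum _ _
  have h := congrArg (seriesComp g) (hf.map_sum hl hr)
  rw [← seriesComp_assoc g f _ hf.zero (F.constantCoeff_sum hl hr), hgf,
    X_seriesComp_self _ (F.constantCoeff_sum hl hr), ← seriesComp_assoc f g _ hg0 (hX .inl),
    ← seriesComp_assoc f g _ hg0 (hX .inr), hfg, X_seriesComp_self _ (hX .inl),
    X_seriesComp_self _ (hX .inr)] at h
  rw [h, sum_X]

/-- Homomorphisms between additive formal group laws in characteristic zero are linear. -/
theorem IsHom.eq_linear {K : Type*} [CommRing K] [IsDomain K] [CharZero K]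
    {g : Fin d' → MvPowerSeries (Fin d) K} (hg : IsHom (additive K d) (additive K d') g) :
    g = matrixMulSeries (linearCoeff g) X := by
  have hX : ∀ i, constantCoeff (X i : MvPowerSeries (Fin d) K) = 0 := fun i => by simp
  -- Putting `Y = X` gives `g(2X) = 2 g(X)`. In degree `n` this reads `(2ⁿ - 2) c = 0`, and `2ⁿ - 2`
  -- vanishes only for `n = 1`.
  have h := hg.map_sum hX hX
  rw [seriesComp_X, additive_sum hX hX, additive_sum hg.zero hg.zero] at h
  funext i
  have hi := congrFun h i
  have h2 : (X + X : Fin d → MvPowerSeries (Fin d) K) = (fun _ : Fin d => (2 : K)) • X := by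
    funext i
    simp [two_smul]
  rw [seriesComp, h2, ← rescale_eq_subst] at hi
  ext m
  have hm := congrArg (coeff m) hi
  rw [coeff_rescale, Pi.add_apply, _root_.map_add] at hm
  simp only [Finsupp.prod, Finset.prod_pow_eq_pow_sum] at hm
  change 2 ^ m.degree * _ = _ at hm
  have hm2 : ((2 ^ m.degree - 2 : ℤ) : K) * coeff m (g i) = 0 := by
    push_cast
    linear_combination hm
  have hrhs : coeff m (matrixMulSeries (linearCoeff g) X i) =
      ∑ j, linearCoeff g i j * coeff m (X j : MvPowerSeries (Fin d) K) := by
    simp [matrixMulSeries]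
  classical
  rw [hrhs]
  by_cases h1 : m.degree = 1
  · rw [Finsupp.degree_apply] at h1
    obtain ⟨k, rfl⟩ := (Finsupp.sum_eq_one_iff m).mp h1
    rw [Finset.sum_eq_single k]
    · simp [linearCoeff]
    · intro j _ hj
      rw [coeff_X, if_neg (by simpa [Finsupp.single_left_inj] using hj.symm), mul_zero]
    · simp
  · rw [Finset.sum_eq_zero]
    · rcases mul_eq_zero.mp hm2 with h0 | h0
      · exfalso
        rw [Int.cast_eq_zero, sub_eq_zero] at h0
        apply h1
        have : (2 : ℤ) ^ m.degree = 2 ^ 1 := by rw [h0, pow_one]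
        exact_mod_cast Int.pow_right_injective (by norm_num) this
      · exact h0
    · intro j _
      rw [coeff_X, if_neg (by rintro rfl; simp at h1), mul_zero]

theorem exists_isCompInverse_log {K : Type*} [CommRing K] [Algebra A K] {F : FormalGroupLaw A d}
    {lam : Fin d → MvPowerSeries (Fin d) K} (hlam : F.IsLogarithm lam) :
    ∃ mu, IsCompInverse lam mu ∧ linearCoeff mu = 1 :=
  exists_isCompInverse lam hlam.1.zero hlam.2

/-- A homomorphism to an additive formal group law is a linear transform of the logarithm. -/
theorem IsHom.eq_matrixMulSeries_log {K : Type*} [CommRing K] [Algebra A K] [IsDomain K]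
    [CharZero K] {F : FormalGroupLaw A d} {lam : Fin d → MvPowerSeries (Fin d) K}
    (hlam : F.IsLogarithm lam) {g : Fin d' → MvPowerSeries (Fin d) K}
    (hg : IsHom (F.map (algebraMap A K)) (additive K d') g) :
    g = matrixMulSeries (linearCoeff g) lam := by
  obtain ⟨mu, hmu, hmu1⟩ := exists_isCompInverse_log hlam
  have h := (hg.comp (hlam.1.of_isCompInverse hmu)).eq_linear
  rw [linearCoeff_seriesComp _ _ hmu.1, hmu1, Matrix.mul_one] at h
  have h' := congrArg (fun g => seriesComp g lam) h
  rwa [seriesComp_assoc _ _ _ hmu.1 hlam.1.zero, hmu.2.2, seriesComp_X,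
    seriesComp_matrixMulSeries _ _ _ hlam.1.zero, X_seriesComp_self _ hlam.1.zero] at h'

/-- The left side is a homomorphism to an additive formal group law, hence determined by its linear
coefficient. Thus the logarithms turn every homomorphism into its linear coefficient. -/
theorem IsLogarithm.seriesComp_hom {K : Type*} [CommRing K] [Algebra A K] [IsDomain K]
    [CharZero K] {F : FormalGroupLaw A d} {F' : FormalGroupLaw A d'}
    {lam : Fin d → MvPowerSeries (Fin d) K} {lam' : Fin d' → MvPowerSeries (Fin d') K}
    (hlam : F.IsLogarithm lam) (hlam' : F'.IsLogarithm lam')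
    {f : Fin d' → MvPowerSeries (Fin d) A} (hf : IsHom F F' f) :
    seriesComp lam' (mapSeries (algebraMap A K) f) =
      matrixMulSeries ((linearCoeff f).map (algebraMap A K)) lam := by
  have h0 := constantCoeff_mapSeries (algebraMap A K) f hf.zero
  rw [(hlam'.1.comp (hf.map (algebraMap A K))).eq_matrixMulSeries_log hlam,
    linearCoeff_seriesComp _ _ h0, hlam'.2, Matrix.one_mul, linearCoeff_mapSeries]

/-- Conjugation by the logarithm turns an automorphism into multiplication by its linear
coefficient. This removes the logarithm from the description of the set `𝒢*`. -/
theorem linearizedAction_eq_range {K : Type*} [CommRing K] [Algebra A K] [IsDomain K] [CharZero K]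
    (hinj : Function.Injective (algebraMap A K)) {G : Type*} [Group G] {Φ : FormalGroupLaw A d}
    (ρ : G →* Aut Φ) {Lam : Fin d → MvPowerSeries (Fin d) K} (hLam : Φ.IsLogarithm Lam) :
    linearizedAction ρ Lam = Set.range fun s => linearCoeff (ρ s : Hom Φ Φ).toSeries - 1 := by
  have h0 := hLam.1.zero
  ext D
  constructor
  · rintro ⟨mu, hmu, s, hs⟩
    refine ⟨s, ?_⟩
    have h1 := congrArg (seriesComp Lam) hs
    rw [hLam.seriesComp_hom hLam (ρ s : Hom Φ Φ).isHom, ← seriesComp_assoc _ _ _ hmu.1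
      (constantCoeff_matrixMulSeries _ _ h0), hmu.2.1,
      X_seriesComp_self _ (constantCoeff_matrixMulSeries _ _ h0)] at h1
    have h2 := congrArg linearCoeff h1
    rw [linearCoeff_matrixMulSeries, linearCoeff_matrixMulSeries, hLam.2, Matrix.mul_one,
      Matrix.mul_one] at h2
    simp only [← Matrix.map_injective hinj h2, add_sub_cancel_right]
  · rintro ⟨s, rfl⟩
    obtain ⟨mu, hmu, -⟩ := exists_isCompInverse_log hLam
    refine ⟨mu, hmu, s, ?_⟩
    have hs0 := constantCoeff_mapSeries (algebraMap A K) _ (ρ s : Hom Φ Φ).isHom.zero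
    rw [sub_add_cancel, ← hLam.seriesComp_hom hLam (ρ s : Hom Φ Φ).isHom,
      ← seriesComp_assoc _ _ _ h0 hs0, hmu.2.2, X_seriesComp_self _ hs0]

end FormalGroupLaw

end

noncomputable section

/-! ### A tuple that becomes linear at the fixed points -/

section FixedPoints

open MvPowerSeries

variable {A : Type*} [CommRing A] {σ τ : Type*} {d d' d'' : ℕ}

/-- The tuple `P X + ∑ Bₖ (aₖ(X) - X)`, which agrees with `P X` at the common fixed points of the
transformations `aₖ`. -/
def fixedPointSeries {m : ℕ} (P : Matrix (Fin d) (Fin d) A) (B : Fin m → Matrix (Fin d) (Fin d) A)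
    (a : Fin m → Fin d → MvPowerSeries (Fin d) A) : Fin d → MvPowerSeries (Fin d) A :=
  matrixMulSeries P X + ∑ k, matrixMulSeries (B k) (a k - X)

variable {m : ℕ} (P : Matrix (Fin d) (Fin d) A) (B : Fin m → Matrix (Fin d) (Fin d) A)
  (a : Fin m → Fin d → MvPowerSeries (Fin d) A)

theorem constantCoeff_fixedPointSeries (ha : ∀ k i, constantCoeff (a k i) = 0) (i : Fin d) :
    constantCoeff (fixedPointSeries P B a i) = 0 := by
  simp only [fixedPointSeries, Pi.add_apply, Finset.sum_apply, map_add, map_sum]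
  rw [constantCoeff_matrixMulSeries _ _ (by simp), Finset.sum_eq_zero, add_zero]
  exact fun k _ => constantCoeff_matrixMulSeries _ _ (by simp [ha]) _

theorem linearCoeff_fixedPointSeries :
    linearCoeff (fixedPointSeries P B a) = P + ∑ k, B k * (linearCoeff (a k) - 1) := by
  simp only [fixedPointSeries, linearCoeff_add, linearCoeff_sum, linearCoeff_matrixMulSeries,
    linearCoeff_sub, linearCoeff_X, Matrix.mul_one]

theorem fixedPointSeries_seriesComp (x : Fin d → MvPowerSeries τ A)
    (hx : ∀ i, constantCoeff (x i) = 0) (hax : ∀ k, seriesComp (a k) x = x) :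
    seriesComp (fixedPointSeries P B a) x = matrixMulSeries P x := by
  rw [fixedPointSeries, seriesComp_add _ _ _ hx, seriesComp_matrixMulSeries _ _ _ hx,
    X_seriesComp_self _ hx, seriesComp_sum _ _ _ hx, Finset.sum_eq_zero, add_zero]
  intro k _
  rw [seriesComp_matrixMulSeries _ _ _ hx, seriesComp_sub _ _ _ hx, hax, X_seriesComp_self _ hx,
    sub_self, matrixMulSeries_zero_right]

theorem mapSeries_fixedPointSeries {C : Type*} [CommRing C] (φ : A →+* C) :
    mapSeries φ (fixedPointSeries P B a) =
      fixedPointSeries (P.map φ) (fun k => (B k).map φ) fun k => mapSeries φ (a k) := by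
  have hadd : ∀ f g : Fin d → MvPowerSeries (Fin d) A,
      mapSeries φ (f + g) = mapSeries φ f + mapSeries φ g := fun f g => by
    funext i; simp [mapSeries]
  have hsub : ∀ f g : Fin d → MvPowerSeries (Fin d) A,
      mapSeries φ (f - g) = mapSeries φ f - mapSeries φ g := fun f g => by
    funext i; simp [mapSeries]
  have hsum : ∀ f : Fin m → Fin d → MvPowerSeries (Fin d) A,
      mapSeries φ (∑ k, f k) = ∑ k, mapSeries φ (f k) := fun f => by
    funext i; simp [mapSeries]
  have hX : mapSeries φ (X : Fin d → MvPowerSeries (Fin d) A) = X := FormalGroupLaw.mapSeries_X φ id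
  simp only [fixedPointSeries, hadd, hsum, mapSeries_matrixMulSeries, hsub, hX]

end FixedPoints

/-! ### Construction of the universal fixed pair -/

namespace FormalGroupLaw

open MvPowerSeries

variable {A : Type*} [CommRing A] {r e : ℕ}

/-- The hypotheses `hJ` and `hB` are the block-free form of condition (iii). `hB` makes the tuple
`T` invertible over `A`, which yields the factorization of fixed tuples; `hJ` makes the resulting
parametrization fixed. The last conclusion is what later determines the type of `lam`. -/
theorem exists_isUniversalFixedPair {K : Type*} [CommRing K] [Algebra A K] [IsDomain K]
    [CharZero K] (hinj : Function.Injective (algebraMap A K)) (Φ : FormalGroupLaw A r)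
    (Lam : Fin r → MvPowerSeries (Fin r) K) (hLam : Φ.IsLogarithm Lam) {G : Type*} [Group G]
    (ρ : G →* Φ.Aut) (J : Matrix (Fin r) (Fin e) A) (R : Matrix (Fin e) (Fin r) A)
    (hRJ : R * J = 1) (hJ : ∀ s, (linearCoeff (ρ s : Hom Φ Φ).toSeries - 1) * J = 0)
    {m : ℕ} (B : Fin m → Matrix (Fin r) (Fin r) A) (s : Fin m → G)
    (hB : ∑ k, B k * (linearCoeff (ρ (s k) : Hom Φ Φ).toSeries - 1) = 1 - J * R) :
    ∃ (F : FormalGroupLaw A e) (f : F.Hom Φ) (lam : Fin e → MvPowerSeries (Fin e) K),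
      IsUniversalFixedPair ρ F f ∧ linearCoeff f.toSeries = J ∧ F.IsLogarithm lam ∧
      seriesComp Lam (mapSeries (algebraMap A K) f.toSeries) =
        matrixMulSeries (J.map (algebraMap A K)) lam := by
  set φ := algebraMap A K with hφ
  let a : G → Fin r → MvPowerSeries (Fin r) A := fun g => (ρ g : Hom Φ Φ).toSeries
  have ha : ∀ g, IsHom Φ Φ (a g) := fun g => (ρ g : Hom Φ Φ).isHom
  have hL0 := hLam.1.zero
  -- Its linear coefficient is `J R + (1 - J R) = 1`, so `T` has an inverse `S` with coefficients in
  -- `A`, and the fixed points lie over the image of `J`.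
  let T := fixedPointSeries (J * R) B fun k => a (s k)
  have hT0 : ∀ i, constantCoeff (T i) = 0 :=
    constantCoeff_fixedPointSeries _ _ _ fun k => (ha (s k)).zero
  have hT1 : linearCoeff T = 1 := by
    rw [linearCoeff_fixedPointSeries, hB, add_sub_cancel]
  obtain ⟨S, ⟨hS0, hTS, hST⟩, hS1⟩ := exists_isCompInverse T hT0 hT1
  have hXe : ∀ i, constantCoeff (X i : MvPowerSeries (Fin e) A) = 0 := fun i => by simp
  have hXeK : ∀ i, constantCoeff (X i : MvPowerSeries (Fin e) K) = 0 := fun i => by simp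
  have hJX := constantCoeff_matrixMulSeries J _ hXe
  let f := seriesComp S (matrixMulSeries J X)
  have hf0 : ∀ i, constantCoeff (f i) = 0 := constantCoeff_seriesComp _ _ hS0 hJX
  have hf1 : linearCoeff f = J := by
    rw [linearCoeff_seriesComp _ _ hJX, hS1, Matrix.one_mul, linearCoeff_matrixMulSeries,
      linearCoeff_X, Matrix.mul_one]
  have hTf : seriesComp T f = matrixMulSeries J X := by
    rw [← seriesComp_assoc _ _ _ hS0 hJX, hTS, X_seriesComp_self _ hJX]
  let rt := matrixMulSeries R T
  have hrt : seriesComp rt f = X := by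
    rw [seriesComp_matrixMulSeries _ _ _ hf0, hTf, ← matrixMulSeries_mul, hRJ, matrixMulSeries_one]
  -- every fixed tuple factors through `f`
  have fac : ∀ {υ : Type} (x : Fin r → MvPowerSeries υ A), (∀ i, constantCoeff (x i) = 0) →
      (∀ g, seriesComp (a g) x = x) → x = seriesComp f (matrixMulSeries R x) := by
    intro υ x hx hax
    have h1 := fixedPointSeries_seriesComp (J * R) B (fun k => a (s k)) x hx fun k => hax _
    have hRx := constantCoeff_matrixMulSeries R _ hx
    rw [seriesComp_assoc _ _ _ hJX hRx, seriesComp_matrixMulSeries _ _ _ hRx,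
      X_seriesComp_self _ hRx, ← matrixMulSeries_mul, ← h1, ← seriesComp_assoc _ _ _ hT0 hx, hST,
      X_seriesComp_self _ hx]
  -- the fixed tuple over `K`
  obtain ⟨mu, hmu, hmu1⟩ := exists_isCompInverse_log hLam
  have hJXK := constantCoeff_matrixMulSeries (J.map φ) _ hXeK
  let w := seriesComp mu (matrixMulSeries (J.map φ) X)
  have hw0 : ∀ i, constantCoeff (w i) = 0 := constantCoeff_seriesComp _ _ hmu.1 hJXK
  have hLw : seriesComp Lam w = matrixMulSeries (J.map φ) X := by
    rw [← seriesComp_assoc _ _ _ hmu.1 hJXK, hmu.2.1, X_seriesComp_self _ hJXK]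
  have hw1 : linearCoeff w = J.map φ := by
    rw [linearCoeff_seriesComp _ _ hJXK, hmu1, Matrix.one_mul, linearCoeff_matrixMulSeries,
      linearCoeff_X, Matrix.mul_one]
  have haK : ∀ g, ∀ i, constantCoeff (mapSeries φ (a g) i) = 0 := fun g =>
    constantCoeff_mapSeries _ _ (ha g).zero
  -- After applying `Lam`, the action on `w` is multiplication of `J X` by the linear coefficient of
  -- `a g`, which fixes `J`.
  have hwfix : ∀ g, seriesComp (mapSeries φ (a g)) w = w := by
    intro g
    have h1 := hLam.seriesComp_hom hLam (ha g)
    have h2 : (linearCoeff (a g)).map φ * J.map φ = J.map φ := by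
      rw [← Matrix.map_mul]
      congr 1
      have := hJ g
      rwa [Matrix.sub_mul, Matrix.one_mul, sub_eq_zero] at this
    have h3 : seriesComp Lam (seriesComp (mapSeries φ (a g)) w) = seriesComp Lam w := by
      rw [← seriesComp_assoc _ _ _ (haK g) hw0, h1, seriesComp_matrixMulSeries _ _ _ hw0, hLw,
        ← matrixMulSeries_mul, h2]
    have h4 := congrArg (seriesComp mu) h3
    rwa [← seriesComp_assoc _ _ _ hL0 (constantCoeff_seriesComp _ _ (haK g) hw0),
      ← seriesComp_assoc _ _ _ hL0 hw0, hmu.2.2, X_seriesComp_self _ hw0,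
      X_seriesComp_self _ (constantCoeff_seriesComp _ _ (haK g) hw0)] at h4
  have hRw := constantCoeff_matrixMulSeries (R.map φ) _ hw0
  have hfK0 := constantCoeff_mapSeries φ f hf0
  have hTK0 := constantCoeff_mapSeries φ T hT0
  have hmapX : mapSeries φ (X : Fin e → MvPowerSeries (Fin e) A) = X := mapSeries_X φ id
  have hmapX' : mapSeries φ (X : Fin r → MvPowerSeries (Fin r) A) = X := mapSeries_X φ id
  have hfK : mapSeries φ f = seriesComp (mapSeries φ S) (matrixMulSeries (J.map φ) X) := by
    rw [mapSeries_seriesComp _ _ _ hJX, mapSeries_matrixMulSeries, hmapX]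
  -- The coefficients of `w` lie in `K`, so the argument of `fac` is repeated with the images of `T`
  -- and `S` over `K`.
  have hwf : w = seriesComp (mapSeries φ f) (matrixMulSeries (R.map φ) w) := by
    have h1 := fixedPointSeries_seriesComp ((J * R).map φ) (fun k => (B k).map φ)
      (fun k => mapSeries φ (a (s k))) w hw0 fun k => hwfix _
    rw [← mapSeries_fixedPointSeries] at h1
    change seriesComp (mapSeries φ T) w = _ at h1
    have hSTK : seriesComp (mapSeries φ S) (mapSeries φ T) = X := by
      rw [← mapSeries_seriesComp _ _ _ hT0, hST, hmapX']
    rw [hfK, seriesComp_assoc _ _ _ hJXK hRw, seriesComp_matrixMulSeries _ _ _ hRw,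
      X_seriesComp_self _ hRw, ← matrixMulSeries_mul, ← Matrix.map_mul, ← h1,
      ← seriesComp_assoc _ _ _ hTK0 hw0, hSTK, X_seriesComp_self _ hw0]
  have hRw1 : linearCoeff (matrixMulSeries (R.map φ) w) = 1 := by
    rw [linearCoeff_matrixMulSeries, hw1, ← Matrix.map_mul, hRJ]
    simp
  -- Since `w = f ∘ (R w)` and `R w` has linear coefficient `R J = 1`, inverting `R w` expresses `f`
  -- through `w`. This inverse turns out to be the logarithm of `F`.
  obtain ⟨lam, ⟨hlam0, hRwlam, -⟩, hlam1⟩ := exists_isCompInverse _ hRw hRw1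
  have hfw : mapSeries φ f = seriesComp w lam := by
    rw [hwf, seriesComp_assoc _ _ _ hRw hlam0, hRwlam, seriesComp_X]
  have hLf : seriesComp Lam (mapSeries φ f) = matrixMulSeries (J.map φ) lam := by
    rw [hfw, ← seriesComp_assoc _ _ _ hw0 hlam0, hLw, seriesComp_matrixMulSeries _ _ _ hlam0,
      X_seriesComp_self _ hlam0]
  -- The series `f` is built from the finitely many elements `s k` only; it is fixed by the whole
  -- group because `w` is.
  have hffix : ∀ g, seriesComp (a g) f = f := by
    intro g
    apply mapSeries_injective hinj
    rw [mapSeries_seriesComp _ _ _ hf0, hfw, ← seriesComp_assoc _ _ _ hw0 hlam0, hwfix]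
  -- the formal group law
  have hX : ∀ j : Fin e → Fin e ⊕ Fin e, ∀ i,
      constantCoeff (X (j i) : MvPowerSeries (Fin e ⊕ Fin e) A) = 0 := fun j i => by simp
  have hfX : ∀ (j : Fin e → Fin e ⊕ Fin e) (i : Fin r),
      constantCoeff (seriesComp f (fun i => X (j i)) i) = 0 :=
    fun j => constantCoeff_seriesComp f _ hf0 (hX j)
  have hfXfix : ∀ (j : Fin e → Fin e ⊕ Fin e) g,
      seriesComp (a g) (seriesComp f fun i => X (j i)) = seriesComp f fun i => X (j i) := by
    intro j g
    rw [← seriesComp_assoc _ _ _ hf0 (hX j), hffix]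
  -- The sum in `Φ` of two independent points of `f` is fixed, as the group acts by homomorphisms.
  -- Hence it factors through `f`, and the factor `R y` is the addition law of `F`.
  let y : Fin r → MvPowerSeries (Fin e ⊕ Fin e) A :=
    Φ.sum (seriesComp f fun i => X (.inl i)) (seriesComp f fun i => X (.inr i))
  have hy : y = Φ.sum (seriesComp f fun i => X (.inl i)) (seriesComp f fun i => X (.inr i)) := rfl
  have hy0 : ∀ i, constantCoeff (y i) = 0 := Φ.constantCoeff_sum (hfX .inl) (hfX .inr)
  have hyfix : ∀ g, seriesComp (a g) y = y := by
    intro g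
    rw [(ha g).map_sum (hfX .inl) (hfX .inr), hfXfix, hfXfix]
  have hsum : y = seriesComp f (matrixMulSeries R y) := fac y hy0 hyfix
  have hs0 : ∀ i, constantCoeff (matrixMulSeries R y i) = 0 :=
    constantCoeff_matrixMulSeries R _ hy0
  let F := Φ.restrict f _ rt hf0 hs0 hrt hsum.symm
  let f' : Hom F Φ := ⟨f, hf0, hsum.symm⟩
  have hRJK : R.map φ * J.map φ = 1 := by
    rw [← Matrix.map_mul, hRJ]
    simp
  -- In this form the additivity of `lam` follows from that of `Lam` and from `f` being a
  -- homomorphism.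
  have hlamR : lam = matrixMulSeries (R.map φ) (seriesComp Lam (mapSeries φ f)) := by
    rw [hLf, ← matrixMulSeries_mul, hRJK, matrixMulSeries_one]
  refine ⟨F, f', lam, ⟨fun g => Hom.ext (hffix g), ?_⟩, hf1, ⟨⟨hlam0, ?_⟩, hlam1⟩, hLf⟩
  · intro n F' h hh
    have hh0 := h.isHom.zero
    have hg0 := constantCoeff_matrixMulSeries R _ hh0
    have hfac := fac h.toSeries hh0 fun g => congrArg Hom.toSeries (hh g)
    have inj : ∀ {υ : Type} (a b : Fin e → MvPowerSeries υ A), (∀ i, constantCoeff (a i) = 0) →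
        (∀ i, constantCoeff (b i) = 0) → seriesComp f a = seriesComp f b → a = b := by
      intro υ a b ha hb hab
      have := congrArg (seriesComp rt) hab
      rwa [← seriesComp_assoc _ _ _ hf0 ha, ← seriesComp_assoc _ _ _ hf0 hb, hrt,
        X_seriesComp_self _ ha, X_seriesComp_self _ hb] at this
    have hX' : ∀ j : Fin n → Fin n ⊕ Fin n, ∀ i,
        constantCoeff (X (j i) : MvPowerSeries (Fin n ⊕ Fin n) A) = 0 := fun j i => by simp
    have hgX := fun j : Fin n → Fin n ⊕ Fin n => constantCoeff_seriesComp _ _ hg0 (hX' j)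
    refine ⟨⟨matrixMulSeries R h.toSeries, hg0, ?_⟩, Hom.ext hfac, ?_⟩
    · refine inj _ _ (constantCoeff_seriesComp _ _ hg0 F'.constantCoeff_toSeries)
        (F.constantCoeff_sum (hgX .inl) (hgX .inr)) ?_
      rw [← seriesComp_assoc _ _ _ hg0 F'.constantCoeff_toSeries, ← hfac]
      change _ = seriesComp f'.toSeries (F.sum _ _)
      rw [f'.isHom.map_sum (hgX .inl) (hgX .inr)]
      change _ = Φ.sum (seriesComp f _) (seriesComp f _)
      rw [← seriesComp_assoc f _ _ hg0 (hX' .inl), ← seriesComp_assoc f _ _ hg0 (hX' .inr), ← hfac]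
      exact h.isHom.map_add
    · intro g hg
      refine Hom.ext (inj _ _ g.isHom.zero hg0 ?_)
      rw [← hfac]
      exact (congrArg Hom.toSeries hg).symm
  · have hmapfX : ∀ j : Fin e → Fin e ⊕ Fin e, seriesComp (mapSeries φ f) (fun i => X (j i)) =
        mapSeries φ (seriesComp f fun i => X (j i)) := by
      intro j
      rw [mapSeries_seriesComp _ _ _ (hX j), mapSeries_X]
    have hXK : ∀ j : Fin e → Fin e ⊕ Fin e, ∀ i,
        constantCoeff (X (j i) : MvPowerSeries (Fin e ⊕ Fin e) K) = 0 := fun j i => by simp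
    have hfXK := fun j : Fin e → Fin e ⊕ Fin e => constantCoeff_seriesComp _ _ hfK0 (hXK j)
    have hlX : ∀ j : Fin e → Fin e ⊕ Fin e, seriesComp lam (fun i => X (j i)) =
        matrixMulSeries (R.map φ)
          (seriesComp Lam (seriesComp (mapSeries φ f) fun i => X (j i))) := by
      intro j
      rw [hlamR, seriesComp_matrixMulSeries _ _ _ (hXK j), seriesComp_assoc _ _ _ hfK0 (hXK j)]
    change _ = (additive K e).sum _ _
    have hl0 := fun j : Fin e → Fin e ⊕ Fin e => constantCoeff_seriesComp _ _ hlam0 (hXK j)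
    rw [additive_sum (hl0 .inl) (hl0 .inr), hlX, hlX, ← matrixMulSeries_add_right,
      ← additive_sum (constantCoeff_seriesComp _ _ hL0 (hfXK _))
        (constantCoeff_seriesComp _ _ hL0 (hfXK _)), ← hLam.1.map_sum (hfXK .inl) (hfXK .inr),
      hmapfX, hmapfX, ← mapSeries_sum _ _ (hfX .inl) (hfX .inr),
      ← hy, hsum,
      mapSeries_seriesComp _ _ _ hs0,
      ← seriesComp_assoc _ _ _ hfK0 (constantCoeff_mapSeries _ _ hs0),
      hLf, ← seriesComp_matrixMulSeries _ _ _ (constantCoeff_mapSeries _ _ hs0),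
      ← matrixMulSeries_mul, hRJK, matrixMulSeries_one]
    rfl

end FormalGroupLaw

end

noncomputable section

/-! ### The ring of integers of an unramified extension and the lift of Frobenius -/

section Integers

variable (p : ℕ) [Fact p.Prime] (L : Type*) [Field L] [Algebra ℚ_[p] L] [Algebra ℤ_[p] L]
  [IsScalarTower ℤ_[p] ℚ_[p] L] [FiniteDimensional ℚ_[p] L]

theorem padicRingOfIntegers_isLocalHom :
    IsLocalHom (algebraMap ℤ_[p] (PadicRingOfIntegers p L)) := by
  have := padicRingOfIntegers_torsionFree p L
  have hint : Algebra.IsIntegral ℤ_[p] (PadicRingOfIntegers p L) := inferInstance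
  exact RingHom.IsIntegral.isLocalHom (algebraMap_isIntegral_iff.mpr hint)
    (FaithfulSMul.algebraMap_injective _ _)

theorem padicRingOfIntegers_isNoetherianRing : IsNoetherianRing (PadicRingOfIntegers p L) :=
  have := padicRingOfIntegers_finite p L
  IsNoetherianRing.of_finite ℤ_[p] _

theorem padicRingOfIntegers_prime_ne_zero : (p : PadicRingOfIntegers p L) ≠ 0 := by
  have := padicRingOfIntegers_torsionFree p L
  intro h
  have h' : algebraMap ℤ_[p] (PadicRingOfIntegers p L) (p : ℤ_[p]) =
      algebraMap ℤ_[p] (PadicRingOfIntegers p L) 0 := by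
    simpa using h
  exact PadicInt.prime_p.ne_zero (FaithfulSMul.algebraMap_injective _ _ h')

variable [Algebra.Unramified ℤ_[p] (PadicRingOfIntegers p L)]

/-- Unramifiedness means that the maximal ideal of `ℤ_[p]` generates the maximal ideal upstairs, so
`p` remains a uniformizer. -/
theorem padicRingOfIntegers_maximalIdeal :
    IsLocalRing.maximalIdeal (PadicRingOfIntegers p L) =
      Ideal.span {(p : PadicRingOfIntegers p L)} := by
  have := padicRingOfIntegers_isLocalHom p L
  have := padicRingOfIntegers_finite p L
  rw [← Algebra.FormallyUnramified.map_maximalIdeal (R := ℤ_[p]),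
    PadicInt.maximalIdeal_eq_span_p, Ideal.map_span]
  simp

theorem padicRingOfIntegers_isPrincipalIdealRing :
    IsPrincipalIdealRing (PadicRingOfIntegers p L) := by
  have := padicRingOfIntegers_isNoetherianRing p L
  have h := padicRingOfIntegers_maximalIdeal p L
  have hp : (IsLocalRing.maximalIdeal (PadicRingOfIntegers p L)).IsPrincipal := ⟨⟨p, h⟩⟩
  exact ((tfae_of_isNoetherianRing_of_isLocalRing_of_isDomain
    (PadicRingOfIntegers p L)).out 0 4 :).mpr hp

theorem padicFrobenius_isPadicFrobenius : IsPadicFrobenius p L (padicFrobenius p L) :=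
  (existsUnique_isPadicFrobenius p L).choose_spec.1

theorem coe_padicFrobeniusInt_pow (n : ℕ) (x : PadicRingOfIntegers p L) :
    (((padicFrobeniusInt p L ^ n) x : PadicRingOfIntegers p L) : L) =
      ((padicFrobenius p L).toAlgHom.toRingHom ^ n) (x : L) := by
  induction n with
  | zero => rfl
  | succ n ih =>
    rw [pow_succ', pow_succ', RingHom.mul_def, RingHom.mul_def, RingHom.comp_apply,
      RingHom.comp_apply, ← ih]
    rfl

theorem residue_padicFrobeniusInt_pow (n : ℕ) (x : PadicRingOfIntegers p L) :
    IsLocalRing.residue _ ((padicFrobeniusInt p L ^ n) x) =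
      IsLocalRing.residue (PadicRingOfIntegers p L) x ^ p ^ n := by
  induction n with
  | zero => simp
  | succ n ih =>
    obtain ⟨y, hy⟩ := padicFrobenius_isPadicFrobenius p L ((padicFrobeniusInt p L ^ n) x)
    have hy' : padicFrobeniusInt p L ((padicFrobeniusInt p L ^ n) x) =
        ((padicFrobeniusInt p L ^ n) x) ^ p + p * y := Subtype.ext (by push_cast; exact hy)
    have hp : IsLocalRing.residue (PadicRingOfIntegers p L) (p : PadicRingOfIntegers p L) = 0 := by
      rw [IsLocalRing.residue_eq_zero_iff, padicRingOfIntegers_maximalIdeal]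
      exact Ideal.mem_span_singleton_self _
    rw [pow_succ', RingHom.mul_def, RingHom.comp_apply, hy', map_add, map_mul, map_pow, ih, hp,
      zero_mul, add_zero, ← pow_mul, pow_succ]

theorem padicRingOfIntegers_residueField_charP :
    CharP (IsLocalRing.ResidueField (PadicRingOfIntegers p L)) p := by
  refine (CharP.charP_iff_prime_eq_zero Fact.out).mpr ?_
  rw [← map_natCast (IsLocalRing.residue (PadicRingOfIntegers p L)),
    IsLocalRing.residue_eq_zero_iff, padicRingOfIntegers_maximalIdeal]
  exact Ideal.mem_span_singleton_self _

open MvPowerSeries in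
/-- On power series with integral coefficients, the powers of the Frobenius operator reduce to
the powers of the Frobenius map modulo `p`. -/
theorem dvd_expand_map_padicFrobeniusInt_sub_pow {τ : Type*} (n : ℕ)
    (f : MvPowerSeries τ (PadicRingOfIntegers p L)) :
    (p : MvPowerSeries τ (PadicRingOfIntegers p L)) ∣
      expand (p ^ n) (pow_ne_zero n (Fact.out : p.Prime).ne_zero)
        (f.map (padicFrobeniusInt p L ^ n)) - f ^ p ^ n := by
  have := padicRingOfIntegers_residueField_charP p L
  have hp0 := (Fact.out : p.Prime).ne_zero
  set red := IsLocalRing.residue (PadicRingOfIntegers p L)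
  -- Over the residue field, of characteristic `p`, the power `f ^ pⁿ` is obtained by raising the
  -- coefficients and the variables to the power `pⁿ`.
  have h : (expand (p ^ n) (pow_ne_zero n hp0) (f.map (padicFrobeniusInt p L ^ n)) -
      f ^ p ^ n).map red = 0 := by
    rw [map_sub, map_pow, map_expand, sub_eq_zero, ← map_iterateFrobenius_expand p hp0, map_expand]
    congr 1
    ext m
    simp only [coeff_map, iterateFrobenius_def]
    exact residue_padicFrobeniusInt_pow p L n _
  have hc : ∀ m, ∃ c, coeff m (expand (p ^ n) (pow_ne_zero n hp0)
      (f.map (padicFrobeniusInt p L ^ n)) - f ^ p ^ n) = p * c := by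
    intro m
    have hm := congrArg (coeff m) h
    rw [coeff_map, map_zero, IsLocalRing.residue_eq_zero_iff, padicRingOfIntegers_maximalIdeal,
      Ideal.mem_span_singleton] at hm
    exact hm
  choose c hc using hc
  let q : MvPowerSeries τ (PadicRingOfIntegers p L) := c
  refine ⟨q, MvPowerSeries.ext fun m => ?_⟩
  rw [hc, ← map_natCast (C : PadicRingOfIntegers p L →+* MvPowerSeries τ _), coeff_C_mul]
  rfl

end Integers

/-! ### Honda's lemma: types under integral substitution -/

section HondaType

open MvPowerSeries

variable {p : ℕ} [Fact p.Prime] {L : Type*} [Field L] [Algebra ℚ_[p] L] [Algebra ℤ_[p] L]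
  [IsScalarTower ℤ_[p] ℚ_[p] L] [FiniteDimensional ℚ_[p] L]
  [Algebra.Unramified ℤ_[p] (PadicRingOfIntegers p L)]

theorem frobeniusOperator_iterate {τ : Type*} (n : ℕ) (f : MvPowerSeries τ L) :
    (frobeniusOperator p L)^[n] f = expand (p ^ n) (pow_ne_zero n (Fact.out : p.Prime).ne_zero)
      (f.map ((padicFrobenius p L).toAlgHom.toRingHom ^ n)) := by
  induction n with
  | zero =>
    simp only [pow_zero, expand_one_apply, Function.iterate_zero, id]
    ext m
    rw [coeff_map]
    rfl
  | succ n ih =>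
    rw [Function.iterate_succ_apply', ih, frobeniusOperator, map_expand]
    simp only [pow_succ', expand_mul p (Fact.out : p.Prime).ne_zero (p ^ n)
      (pow_ne_zero n (Fact.out : p.Prime).ne_zero)]
    congr 2

/-- The exponents in `▲ⁿ f` are multiples of `pⁿ > n`, and there is no constant term. -/
theorem coeff_frobeniusOperator_iterate_of_lt {τ : Type*} {f : MvPowerSeries τ L}
    (hf : constantCoeff f = 0) {n : ℕ} {m : τ →₀ ℕ} (hn : m.degree < n) :
    coeff m ((frobeniusOperator p L)^[n] f) = 0 := by
  have hp := (Fact.out : p.Prime)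
  rw [frobeniusOperator_iterate]
  by_cases h : ∀ i, p ^ n ∣ m i
  · have hm : m = 0 := by
      ext i
      by_contra h0
      have h1 : p ^ n ≤ m i := Nat.le_of_dvd (Nat.pos_of_ne_zero h0) (h i)
      have h2 : n < p ^ n := Nat.lt_pow_self hp.one_lt
      have h3 : m i ≤ m.degree := Finsupp.le_degree i m
      omega
    rw [hm, coeff_zero_eq_constantCoeff_apply, constantCoeff_expand]
    simp [hf]
  · push Not at h
    obtain ⟨i, hi⟩ := h
    exact coeff_expand_of_not_dvd _ _ _ hi

/-- The extra terms vanish, so one range of summation serves all monomials of bounded degree. This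
is what permits exchanging sums over monomials and over powers of `▲`. -/
theorem HondaRing.coeff_act {τ : Type*} (c : HondaRing p L) {f : MvPowerSeries τ L}
    (hf : constantCoeff f = 0) {m : τ →₀ ℕ} {N : ℕ} (hN : m.degree < N) :
    coeff m (c.act f) =
      ∑ n ∈ Finset.range N, (c.coeff n : L) * coeff m ((frobeniusOperator p L)^[n] f) := by
  refine Finset.sum_subset (Finset.range_subset_range.mpr hN) fun n _ hn => ?_
  rw [coeff_frobeniusOperator_iterate_of_lt hf (by simpa using hn), mul_zero]

theorem padicFrobenius_pow_mem (n : ℕ) {x : L} (hx : x ∈ integralClosure ℤ_[p] L) :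
    ((padicFrobenius p L).toAlgHom.toRingHom ^ n) x ∈ integralClosure ℤ_[p] L := by
  have := coe_padicFrobeniusInt_pow p L n ⟨x, hx⟩
  rw [← this]
  exact Subtype.property _

theorem sum_coeff_zero_mul {d : ℕ} {v : Matrix (Fin d) (Fin d) (HondaRing p L)}
    (hv : (v.map fun c => c.coeff 0) = (p : Matrix (Fin d) (Fin d) (PadicRingOfIntegers p L)))
    (i : Fin d) (a : Fin d → L) : ∑ j, ((v i j).coeff 0 : L) * a j = p * a i := by
  have h : ∀ j, (v i j).coeff 0 = if i = j then (p : PadicRingOfIntegers p L) else 0 := by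
    intro j
    have := congrFun (congrFun hv i) j
    rw [Matrix.map_apply, Matrix.natCast_apply] at this
    rw [this]
    split_ifs <;> simp
  rw [Finset.sum_eq_single i]
  · simp [h]
  · intro j _ hj
    simp [h, hj.symm]
  · simp

/-- The denominators of a tuple of power series that has a type. -/
theorem IsOfHondaType.pow_mul_coeff_mem {d : ℕ} {v : Matrix (Fin d) (Fin d) (HondaRing p L)}
    {lam : Fin d → MvPowerSeries (Fin d) L} (hv : IsOfHondaType v lam) (k : ℕ) :
    ∀ (m : Fin d →₀ ℕ) (j : Fin d), (¬ ∀ i, p ^ (k + 1) ∣ m i) →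
      (p : L) ^ k * coeff m (lam j) ∈ integralClosure ℤ_[p] L := by
  obtain ⟨h0, hv0, hv1⟩ := hv
  -- The constant term of `v` being `p`, the relation `v lam ≡ 0` expresses `p` times a coefficient
  -- at `m` through the terms with `▲ⁿ`, `n ≥ 1`. These involve only coefficients at `m / pⁿ`, which
  -- have smaller denominators.
  induction k using Nat.strong_induction_on with
  | _ k ih =>
  intro m j hm
  obtain ⟨c, hc⟩ := hv1 j m
  simp only [map_sum] at hc
  have hact : ∀ l, coeff m ((v j l).act (lam l)) = ((v j l).coeff 0 : L) * coeff m (lam l) +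
      ∑ n ∈ Finset.range m.degree, ((v j l).coeff (n + 1) : L) *
        coeff m ((frobeniusOperator p L)^[n + 1] (lam l)) := by
    intro l
    rw [HondaRing.coeff_act _ (h0 l) (Nat.lt_succ_self _), Finset.sum_range_succ', add_comm]
    rfl
  simp only [hact, Finset.sum_add_distrib, sum_coeff_zero_mul hv0] at hc
  have hpL : (p : L) ≠ 0 := by
    intro h
    apply padicRingOfIntegers_prime_ne_zero p L
    exact Subtype.ext (by simpa using h)
  -- The truncated exponent `k - 1` says too little at `k = 0`; there `p` does not divide `m`, so
  -- these terms vanish, as the first clause records.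
  have key : ∀ n l, (k = 0 → coeff m ((frobeniusOperator p L)^[n + 1] (lam l)) = 0) ∧
      (p : L) ^ (k - 1) * coeff m ((frobeniusOperator p L)^[n + 1] (lam l)) ∈
        integralClosure ℤ_[p] L := by
    intro n l
    rw [frobeniusOperator_iterate]
    by_cases h : ∀ i, p ^ (n + 1) ∣ m i
    · have hnk : n + 1 ≤ k := by
        by_contra hlt
        exact hm fun i => (pow_dvd_pow p (by omega)).trans (h i)
      refine ⟨fun hk => by omega, ?_⟩
      obtain ⟨m', rfl⟩ : ∃ m' : Fin d →₀ ℕ, m = p ^ (n + 1) • m' := by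
        choose m' hm' using h
        exact ⟨Finsupp.equivFunOnFinite.symm m', Finsupp.ext fun i => by simp [hm' i]⟩
      rw [coeff_expand_smul, coeff_map]
      have h1 := ih (k - (n + 1)) (by omega) m' l (by
        intro hall
        refine hm fun i => ?_
        have := mul_dvd_mul_left (p ^ (n + 1)) (hall i)
        rw [← pow_add, show n + 1 + (k - (n + 1) + 1) = k + 1 by omega] at this
        simpa using this)
      have h2 := padicFrobenius_pow_mem (n + 1) h1
      rw [map_mul, map_pow, map_natCast] at h2
      rw [show k - 1 = n + (k - (n + 1)) by omega, pow_add, mul_assoc]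
      exact mul_mem (pow_mem (natCast_mem _ p) n) h2
    · push Not at h
      obtain ⟨i, hi⟩ := h
      rw [coeff_expand_of_not_dvd _ _ _ hi]
      simp
  rcases k with _ | k
  · have hsum : ∑ l, ∑ n ∈ Finset.range m.degree, ((v j l).coeff (n + 1) : L) *
        coeff m ((frobeniusOperator p L)^[n + 1] (lam l)) = 0 :=
      Finset.sum_eq_zero fun l _ => Finset.sum_eq_zero fun n _ => by
        rw [(key n l).1 rfl, mul_zero]
    rw [hsum, add_zero] at hc
    rw [pow_zero, one_mul, mul_left_cancel₀ hpL hc]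
    exact c.2
  · have hsum : (p : L) ^ k * ∑ l, ∑ n ∈ Finset.range m.degree, ((v j l).coeff (n + 1) : L) *
        coeff m ((frobeniusOperator p L)^[n + 1] (lam l)) ∈ integralClosure ℤ_[p] L := by
      simp only [Finset.mul_sum]
      refine sum_mem fun l _ => sum_mem fun n _ => ?_
      rw [mul_left_comm]
      exact mul_mem (Subtype.property _) (key n l).2
    have : (p : L) ^ (k + 1) * coeff m (lam j) = (p : L) ^ (k + 1) * c - (p : L) ^ k *
        ∑ l, ∑ n ∈ Finset.range m.degree, ((v j l).coeff (n + 1) : L) *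
        coeff m ((frobeniusOperator p L)^[n + 1] (lam l)) := by
      linear_combination (p : L) ^ k * hc
    rw [this]
    exact sub_mem (mul_mem (pow_mem (natCast_mem _ p) _) c.2) hsum

theorem exists_pow_dvd_and_not_dvd {σ : Type*} {m : σ →₀ ℕ} (hm : m ≠ 0) {p : ℕ} (hp : 1 < p) :
    ∃ k, (∀ i, p ^ k ∣ m i) ∧ ¬ ∀ i, p ^ (k + 1) ∣ m i := by
  by_contra! h
  have hall : ∀ k, ∀ i, p ^ k ∣ m i := by
    intro k
    induction k with
    | zero => simp
    | succ k ih => exact h k ih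
  refine hm (Finsupp.ext fun i => ?_)
  exact Nat.eq_zero_of_dvd_of_lt (hall (m i) i) (Nat.lt_pow_self hp)

/-- A congruence modulo `p` raised to the power `pᵏ` becomes a congruence modulo `pᵏ⁺¹`. The gain
outweighs by one factor `p` the denominator `pᵏ` that a coefficient at such a monomial can have. -/
theorem pow_succ_dvd_finsuppProd_sub {R σ : Type*} [CommRing R] [Fintype σ] {p : ℕ} {g h : σ → R}
    (hgh : ∀ i, (p : R) ∣ g i - h i) {k : ℕ} (m : σ →₀ ℕ) :
    (p : R) ^ (k + 1) ∣ ((p ^ k • m).prod fun i n => g i ^ n) -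
      (p ^ k • m).prod fun i n => h i ^ n := by
  have hpow : ∀ f : σ → R, ((p ^ k • m).prod fun i n => f i ^ n) =
      (m.prod fun i n => f i ^ n) ^ p ^ k := by
    intro f
    rw [Finsupp.prod_fintype _ _ (by simp), Finsupp.prod_fintype _ _ (by simp), ← Finset.prod_pow]
    exact Finset.prod_congr rfl fun i _ => by
      rw [← pow_mul, mul_comm, Finsupp.smul_apply, smul_eq_mul]
  rw [hpow, hpow]
  refine dvd_sub_pow_of_dvd_sub ?_ k
  have hq : ∀ i, Ideal.Quotient.mk (Ideal.span {(p : R)}) (g i) =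
      Ideal.Quotient.mk (Ideal.span {(p : R)}) (h i) := fun i => by
    rw [Ideal.Quotient.eq, Ideal.mem_span_singleton]
    exact hgh i
  rw [← Ideal.mem_span_singleton, ← Ideal.Quotient.eq]
  simp only [Finsupp.prod, map_prod, map_pow, hq]

theorem coeff_finsuppProd_mapSeries {A B σ τ : Type*} [CommRing A] [CommRing B] (φ : A →+* B)
    (f : σ → MvPowerSeries τ A) (a : σ →₀ ℕ) (m : τ →₀ ℕ) :
    coeff m (a.prod fun i k => mapSeries φ f i ^ k) = φ (coeff m (a.prod fun i k => f i ^ k)) := by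
  rw [← coeff_map]
  congr 1
  simp only [Finsupp.prod, mapSeries, map_prod, map_pow]

/-- Substituting power series with integral coefficients into a tuple of type `v` gives a tuple
that is annihilated by `v` modulo `p`. -/
theorem IsOfHondaType.subst {d e : ℕ} {v : Matrix (Fin d) (Fin d) (HondaRing p L)}
    {lam : Fin d → MvPowerSeries (Fin d) L} (hv : IsOfHondaType v lam)
    (f : Fin d → MvPowerSeries (Fin e) (PadicRingOfIntegers p L))
    (hf : ∀ i, constantCoeff (f i) = 0) (i : Fin d) (m : Fin e →₀ ℕ) :
    ∃ c : PadicRingOfIntegers p L, coeff m (∑ j, (v i j).act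
      (seriesComp lam (mapSeries (algebraMap (PadicRingOfIntegers p L) L) f) j)) = p * (c : L) := by
  have hp := (Fact.out : p.Prime)
  have hp0 : ∀ n, p ^ n ≠ 0 := fun n => pow_ne_zero n hp.ne_zero
  let I : Submodule (PadicRingOfIntegers p L) L :=
    Submodule.span (PadicRingOfIntegers p L) {(p : L)}
  have hI : ∀ x : L, x ∈ I ↔ ∃ c : PadicRingOfIntegers p L, x = p * (c : L) := by
    intro x
    rw [Submodule.mem_span_singleton]
    refine exists_congr fun c => ?_
    rw [Algebra.smul_def, mul_comm, eq_comm]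
    rfl
  have hImul : ∀ (c : PadicRingOfIntegers p L) {x : L}, x ∈ I → (c : L) * x ∈ I :=
    fun c x hx => I.smul_mem c hx
  rw [← hI]
  obtain ⟨h0, hv0, hv1⟩ := id hv
  set φ := algebraMap (PadicRingOfIntegers p L) L with hφ
  set σ : L →+* L := (padicFrobenius p L).toAlgHom.toRingHom with hσ
  have hF0 := constantCoeff_mapSeries φ f hf
  have hS := hasSubst_of_constantCoeff_zero hF0
  have hcomp0 := FormalGroupLaw.constantCoeff_seriesComp lam _ h0 hF0
  set D := m.degree with hD
  set fs := (Finsupp.finite_of_degree_le (σ := Fin d) D).toFinset with hfs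
  -- `▲ⁿ(lam ∘ f)` and `(▲ⁿ lam) ∘ f` are one and the same series, `lam` twisted by `σⁿ`, evaluated
  -- at `g n = ▲ⁿ f` and at `h n = f ^ pⁿ`. These agree modulo `p`.
  let g : ℕ → Fin d → MvPowerSeries (Fin e) (PadicRingOfIntegers p L) := fun n j =>
    expand (p ^ n) (hp0 n) ((f j).map (padicFrobeniusInt p L ^ n))
  let h : ℕ → Fin d → MvPowerSeries (Fin e) (PadicRingOfIntegers p L) := fun n j => f j ^ p ^ n
  have hg0 : ∀ n j, constantCoeff (g n j) = 0 := fun n j => by simp [g, hf]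
  have hh0 : ∀ n j, constantCoeff (h n j) = 0 := fun n j => by simp [h, hf, hp.ne_zero]
  -- the Frobenius operator applied to the composite
  have hcomp : ∀ n j, (frobeniusOperator p L)^[n] (seriesComp lam (mapSeries φ f) j) =
      ((lam j).map (σ ^ n)).subst (mapSeries φ (g n)) := by
    intro n j
    rw [frobeniusOperator_iterate, seriesComp, MvPowerSeries.map_subst hS,
      expand_subst _ _ (hS.map _)]
    congr 1
    funext l
    simp only [mapSeries, g, map_expand]
    congr 1
    ext m
    simp only [coeff_map]
    exact (coe_padicFrobeniusInt_pow p L n _).symm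
  -- the composite of the Frobenius operator
  have hcomp' : ∀ n j, ((frobeniusOperator p L)^[n] (lam j)).subst (mapSeries φ f) =
      ((lam j).map (σ ^ n)).subst (mapSeries φ (h n)) := by
    intro n j
    rw [frobeniusOperator_iterate, expand, substAlgHom_apply,
      subst_comp_subst_apply (HasSubst.X_pow (hp0 n)) hS]
    congr 1
    funext l
    rw [subst_pow hS, subst_X hS]
    simp [mapSeries, h]
  -- At a monomial `a` exactly divisible by `pᵏ`, the coefficient of `lam` has denominator at most
  -- `pᵏ`, while the difference of the monomials in `g` and `h` is divisible by `pᵏ⁺¹`.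
  have hdiff : ∀ n j, coeff m ((frobeniusOperator p L)^[n] (seriesComp lam (mapSeries φ f) j)) -
      coeff m (((frobeniusOperator p L)^[n] (lam j)).subst (mapSeries φ f)) ∈ I := by
    intro n j
    rw [hcomp, hcomp', coeff_subst_eq_sum _ _ (constantCoeff_mapSeries _ _ (hg0 n)) m le_rfl,
      coeff_subst_eq_sum _ _ (constantCoeff_mapSeries _ _ (hh0 n)) m le_rfl,
      ← Finset.sum_sub_distrib]
    refine Submodule.sum_mem _ fun a _ => ?_
    rw [← mul_sub, coeff_map]
    rw [coeff_finsuppProd_mapSeries, coeff_finsuppProd_mapSeries, ← map_sub, ← map_sub]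
    by_cases ha : a = 0
    · subst ha
      simp
    obtain ⟨k, hk, hk'⟩ := exists_pow_dvd_and_not_dvd ha hp.one_lt
    have hden := padicFrobenius_pow_mem n (hv.pow_mul_coeff_mem k a j hk')
    obtain ⟨a', rfl⟩ : ∃ a' : Fin d →₀ ℕ, a = p ^ k • a' := by
      choose a' ha' using hk
      exact ⟨Finsupp.equivFunOnFinite.symm a', Finsupp.ext fun i => by simp [ha' i]⟩
    obtain ⟨q, hq⟩ := pow_succ_dvd_finsuppProd_sub (k := k) (g := g n) (h := h n)
      (fun i => dvd_expand_map_padicFrobeniusInt_sub_pow p L n (f i)) a'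
    rw [hq, hI]
    rw [map_mul, map_pow, map_natCast] at hden
    refine ⟨⟨_, hden⟩ * coeff m q, ?_⟩
    rw [← map_natCast (C : PadicRingOfIntegers p L →+* MvPowerSeries (Fin e) _), ← map_pow,
      coeff_C_mul, map_mul, map_pow, map_natCast]
    change _ = (p : L) * (((p : L) ^ k * _) * φ (coeff m q))
    ring
  -- The sum is the coefficient at `m` of `(v lam) ∘ f`; here `v lam` is divisible by `p` and `f` is
  -- integral.
  have hmain : ∑ j, ∑ n ∈ Finset.range (D + 1), ((v i j).coeff n : L) *
      coeff m (((frobeniusOperator p L)^[n] (lam j)).subst (mapSeries φ f)) ∈ I := by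
    have hexp : ∀ j n, coeff m (((frobeniusOperator p L)^[n] (lam j)).subst (mapSeries φ f)) =
        ∑ a ∈ fs, coeff a ((frobeniusOperator p L)^[n] (lam j)) *
          coeff m (a.prod fun i k => mapSeries φ f i ^ k) :=
      fun j n => coeff_subst_eq_sum _ _ hF0 m le_rfl
    have hswap : ∑ j, ∑ n ∈ Finset.range (D + 1), ((v i j).coeff n : L) *
        coeff m (((frobeniusOperator p L)^[n] (lam j)).subst (mapSeries φ f)) =
        ∑ a ∈ fs, coeff a (∑ j, (v i j).act (lam j)) *
          coeff m (a.prod fun i k => mapSeries φ f i ^ k) := by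
      have hact : ∀ a ∈ fs, coeff a (∑ j, (v i j).act (lam j)) = ∑ j, ∑ n ∈ Finset.range (D + 1),
          ((v i j).coeff n : L) * coeff a ((frobeniusOperator p L)^[n] (lam j)) := by
        intro a ha
        rw [map_sum]
        refine Finset.sum_congr rfl fun j _ => HondaRing.coeff_act _ (h0 j) ?_
        exact Nat.lt_succ_of_le (by simpa [hfs] using ha)
      refine Eq.trans ?_ (Finset.sum_congr rfl fun a ha => by rw [hact a ha]).symm
      simp only [hexp, Finset.mul_sum, Finset.sum_mul, mul_assoc]
      conv_rhs => rw [Finset.sum_comm]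
      exact Finset.sum_congr rfl fun j _ => Finset.sum_comm
    rw [hswap]
    refine Submodule.sum_mem _ fun a _ => ?_
    obtain ⟨c, hc⟩ := hv1 i a
    rw [hc, hI]
    refine ⟨c * coeff m (a.prod fun i k => f i ^ k), ?_⟩
    rw [coeff_finsuppProd_mapSeries]
    change _ = (p : L) * ((c : L) * φ _)
    ring
  rw [map_sum, Finset.sum_congr rfl fun j _ => HondaRing.coeff_act (v i j) (hcomp0 j)
    (Nat.lt_succ_self _)]
  rw [← sub_add_cancel (∑ j, _) _]
  refine Submodule.add_mem _ ?_ hmain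
  rw [← Finset.sum_sub_distrib]
  refine Submodule.sum_mem _ fun j _ => ?_
  rw [← Finset.sum_sub_distrib]
  refine Submodule.sum_mem _ fun n _ => ?_
  rw [← mul_sub]
  exact hImul _ (hdiff n j)

end HondaType

end

noncomputable section

/-! ### Equivalence of the three conditions on a set of matrices -/

section KernelConditions

open Matrix

variable {O : Type*} [CommRing O] {r : ℕ}

theorem mem_iInf_ker_mulVecLin {α R : Type*} [CommRing R] {r : ℕ} {S : Set α}
    {g : α → Matrix (Fin r) (Fin r) R} {x : Fin r → R} :
    x ∈ (⨅ D ∈ S, LinearMap.ker (g D).mulVecLin) ↔ ∀ D ∈ S, g D *ᵥ x = 0 := by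
  simp [Submodule.mem_iInf]

theorem blockForm_mul {R : Type*} [CommRing R] {e : ℕ} (h : e ≤ r)
    (M N : Matrix (Fin r) (Fin r) R) : blockForm h (M * N) = blockForm h M * blockForm h N :=
  (Matrix.submatrix_mul_equiv M N _ _ _).symm

theorem blockForm_injective {R : Type*} [CommRing R] {e : ℕ} (h : e ≤ r) :
    Function.Injective (blockForm h : Matrix (Fin r) (Fin r) R → _) := by
  intro M N hMN
  ext i j
  have := congrFun (congrFun hMN ((blockIndex h).symm i)) ((blockIndex h).symm j)
  simpa [blockForm] using this

theorem blockForm_sum {R κ : Type*} [CommRing R] {e : ℕ} (h : e ≤ r) (s : Finset κ)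
    (M : κ → Matrix (Fin r) (Fin r) R) :
    blockForm h (∑ k ∈ s, M k) = ∑ k ∈ s, blockForm h (M k) := by
  ext i j
  simp [blockForm, Matrix.sum_apply]

theorem stdInclusion_blockIndex {e : ℕ} (h : e ≤ r) (i : Fin e ⊕ Fin (r - e)) (j : Fin e) :
    stdInclusion O r e (blockIndex h i) j = if i = .inl j then 1 else 0 := by
  rcases i with i | i
  · simp [stdInclusion, blockIndex, Fin.ext_iff]
  · simp only [stdInclusion, blockIndex, Matrix.of_apply, reduceCtorEq, if_false]
    rw [if_neg]
    simp
    omega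

theorem mul_stdInclusion_apply {e : ℕ} (h : e ≤ r) {n : Type*} (M : Matrix n (Fin r) O) (i : n)
    (j : Fin e) : (M * stdInclusion O r e) i j = M i (blockIndex h (.inl j)) := by
  rw [Matrix.mul_apply, ← (blockIndex h).sum_comp]
  simp [stdInclusion_blockIndex]

theorem stdInclusion_transpose_mul_apply {e : ℕ} (h : e ≤ r) {n : Type*} (M : Matrix (Fin r) n O)
    (i : Fin e) (j : n) : ((stdInclusion O r e)ᵀ * M) i j = M (blockIndex h (.inl i)) j := by
  rw [Matrix.mul_apply, ← (blockIndex h).sum_comp]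
  simp [stdInclusion_blockIndex]

theorem stdInclusion_transpose_mul_self {e : ℕ} (h : e ≤ r) :
    (stdInclusion O r e)ᵀ * stdInclusion O r e = 1 := by
  ext i j
  rw [stdInclusion_transpose_mul_apply h, stdInclusion_blockIndex, Matrix.one_apply]
  simp

theorem blockForm_one_sub_stdInclusion {e : ℕ} (h : e ≤ r) :
    blockForm h (1 - stdInclusion O r e * (stdInclusion O r e)ᵀ) = fromBlocks 0 0 0 1 := by
  have h1 : blockForm h (stdInclusion O r e * (stdInclusion O r e)ᵀ) = fromBlocks 1 0 0 0 := by
    ext i j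
    rw [blockForm, submatrix_apply, Matrix.mul_apply]
    simp only [transpose_apply, stdInclusion_blockIndex]
    rcases i with i | i <;> rcases j with j | j <;> simp [Matrix.one_apply, eq_comm]
  have h2 : blockForm h (1 : Matrix (Fin r) (Fin r) O) = 1 := by simp [blockForm]
  have h3 : ∀ M N : Matrix (Fin r) (Fin r) O, blockForm h (M - N) = blockForm h M - blockForm h N :=
    fun M N => rfl
  rw [h3, h1, h2, ← fromBlocks_one, sub_eq_add_neg, fromBlocks_neg, fromBlocks_add]
  simp

section

variable {S : Set (Matrix (Fin r) (Fin r) O)} {e : ℕ} {h : e ≤ r} {Q : GL (Fin r) O}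

theorem IsBlockTriangularization.mul_eq_zero (hQ : IsBlockTriangularization h Q S) :
    ∀ D ∈ S, D * (Q.val * stdInclusion O r e) = 0 := by
  obtain ⟨Dhat, Dtilde, hD, -⟩ := hQ
  intro D hDS
  have h1 : (Q⁻¹ : GL (Fin r) O).val * D * Q.val * stdInclusion O r e = 0 := by
    ext i j
    rw [mul_stdInclusion_apply h]
    obtain ⟨i, rfl⟩ := (blockIndex h).surjective i
    have := congrFun (congrFun (hD D hDS) i) (.inl j)
    rw [blockForm, submatrix_apply] at this
    rw [this]
    rcases i with i | i <;> rfl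
  have h2 := congrArg (Q.val * ·) h1
  simp only [← Matrix.mul_assoc, Matrix.mul_zero] at h2
  rwa [← Units.val_mul, mul_inv_cancel, Units.val_one, Matrix.one_mul, Matrix.mul_assoc] at h2

/-- Dividing by the invertible lower block turns the combination into the projection onto the last
`r - e` coordinates; conjugating back by `Q` frees condition (iii) from blocks. -/
theorem IsBlockTriangularization.exists_sum_eq (hQ : IsBlockTriangularization h Q S) :
    ∃ (m : ℕ) (B : Fin m → Matrix (Fin r) (Fin r) O) (D : Fin m → Matrix (Fin r) (Fin r) O),
      (∀ k, D k ∈ S) ∧ ∑ k, B k * D k =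
        1 - (Q.val * stdInclusion O r e) * ((stdInclusion O r e)ᵀ * (Q⁻¹ : GL (Fin r) O).val) := by
  obtain ⟨Dhat, Dtilde, hD, m, D, Chat, Ctilde, hDS, U, hU⟩ := hQ
  let Qi := (Q⁻¹ : GL (Fin r) O).val
  have hQQ : Q.val * Qi = 1 := by rw [← Units.val_mul, mul_inv_cancel, Units.val_one]
  let V := (U⁻¹ : (Matrix (Fin (r - e)) (Fin (r - e)) O)ˣ).val
  -- The first `e` rows are zero and the others are `Ĉₖ` and `C̃ₖ` normalized by the inverse `V` of
  -- their combination.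
  let C : Fin m → Matrix (Fin r) (Fin r) O := fun k =>
    (fromBlocks 0 0 (V * Chat k) (V * Ctilde k)).submatrix (blockIndex h).symm (blockIndex h).symm
  have hC : ∀ k, blockForm h (C k) = fromBlocks 0 0 (V * Chat k) (V * Ctilde k) := by
    intro k
    simp [C, blockForm]
  have key : ∑ k, C k * (Qi * D k * Q.val) = 1 - stdInclusion O r e * (stdInclusion O r e)ᵀ := by
    apply blockForm_injective h
    rw [blockForm_one_sub_stdInclusion, blockForm_sum]
    have hterm : ∀ k, blockForm h (C k * (Qi * D k * Q.val)) =
        fromBlocks 0 0 0 (V * (Chat k * Dhat (D k) + Ctilde k * Dtilde (D k))) := by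
      intro k
      rw [blockForm_mul, hC, hD _ (hDS k), fromBlocks_multiply]
      simp [Matrix.mul_add, Matrix.mul_assoc]
    have hsum : ∀ M : Fin m → Matrix (Fin (r - e)) (Fin (r - e)) O,
        ∑ k, (fromBlocks 0 0 0 (M k) : Matrix (Fin e ⊕ Fin (r - e)) (Fin e ⊕ Fin (r - e)) O) =
          fromBlocks 0 0 0 (∑ k, M k) := by
      intro M
      ext i j
      rcases i with i | i <;> rcases j with j | j <;> simp [Matrix.sum_apply]
    rw [Finset.sum_congr rfl fun k _ => hterm k, hsum, ← Finset.mul_sum, ← hU, ← Units.val_mul,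
      inv_mul_cancel, Units.val_one]
  refine ⟨m, fun k => Q.val * C k * Qi, D, hDS, ?_⟩
  have h1 := congrArg (fun M => Q.val * M * Qi) key
  simp only [Finset.mul_sum, Finset.sum_mul, Matrix.mul_sub, Matrix.sub_mul, Matrix.mul_one, hQQ]
    at h1
  simp only [Matrix.mul_assoc] at h1 ⊢
  simpa only [hQQ, Matrix.mul_one] using h1

theorem isBlockTriangularization_of_sum_eq
    (hzero : ∀ D ∈ S, D * (Q.val * stdInclusion O r e) = 0) {m : ℕ}
    {B D : Fin m → Matrix (Fin r) (Fin r) O} (hDS : ∀ k, D k ∈ S)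
    (hsum : ∑ k, B k * D k =
      1 - (Q.val * stdInclusion O r e) * ((stdInclusion O r e)ᵀ * (Q⁻¹ : GL (Fin r) O).val)) :
    IsBlockTriangularization h Q S := by
  let Qi := (Q⁻¹ : GL (Fin r) O).val
  have hQQ : Q.val * Qi = 1 := by rw [← Units.val_mul, mul_inv_cancel, Units.val_one]
  have hQQ' : Qi * Q.val = 1 := by rw [← Units.val_mul, inv_mul_cancel, Units.val_one]
  have hblock : ∀ D ∈ S, blockForm h (Qi * D * Q.val) =
      fromBlocks 0 (blockForm h (Qi * D * Q.val)).toBlocks₁₂ 0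
        (blockForm h (Qi * D * Q.val)).toBlocks₂₂ := by
    intro D hD
    have h1 : ∀ i j, blockForm h (Qi * D * Q.val) i (.inl j) = 0 := by
      intro i j
      have h2 := mul_stdInclusion_apply h (Qi * D * Q.val) (blockIndex h i) j
      rw [Matrix.mul_assoc, Matrix.mul_assoc, hzero D hD, Matrix.mul_zero] at h2
      exact h2.symm
    ext i j
    rcases j with j | j
    · rw [h1]
      rcases i with i | i <;> rfl
    · rcases i with i | i <;> rfl
  refine ⟨fun D => (blockForm h (Qi * D * Q.val)).toBlocks₁₂,
    fun D => (blockForm h (Qi * D * Q.val)).toBlocks₂₂, hblock, m, D,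
    fun k => (blockForm h (Qi * B k * Q.val)).toBlocks₂₁,
    fun k => (blockForm h (Qi * B k * Q.val)).toBlocks₂₂, hDS, ?_⟩
  have h1 : ∑ k, (Qi * B k * Q.val) * (Qi * D k * Q.val) =
      1 - stdInclusion O r e * (stdInclusion O r e)ᵀ := by
    have h2 := congrArg (fun M => Qi * M * Q.val) hsum
    simp only [Finset.mul_sum, Finset.sum_mul, Matrix.mul_sub, Matrix.sub_mul, Matrix.mul_one,
      hQQ'] at h2
    have h3 : ∀ k, (Qi * B k * Q.val) * (Qi * D k * Q.val) = Qi * (B k * D k) * Q.val := by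
      intro k
      calc _ = Qi * B k * (Q.val * Qi) * D k * Q.val := by simp only [Matrix.mul_assoc]
        _ = _ := by rw [hQQ, Matrix.mul_one, Matrix.mul_assoc Qi]
    rw [Finset.sum_congr rfl fun k _ => h3 k, h2]
    congr 1
    calc _ = (Qi * Q.val) * (stdInclusion O r e * (stdInclusion O r e)ᵀ) * (Qi * Q.val) := by
          simp only [Matrix.mul_assoc, Qi]
      _ = _ := by rw [hQQ', Matrix.one_mul, Matrix.mul_one]
  have h2 := congrArg (fun M => (blockForm h M).toBlocks₂₂) h1
  simp only [blockForm_one_sub_stdInclusion, toBlocks_fromBlocks₂₂, blockForm_sum] at h2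
  -- With the lower blocks of `Q⁻¹ Bₖ Q` as coefficients, the combination is the identity itself.
  convert isUnit_one (M := Matrix (Fin (r - e)) (Fin (r - e)) O)
  rw [← h2]
  have hk : ∀ k, (blockForm h ((Qi * B k * Q.val) * (Qi * D k * Q.val))).toBlocks₂₂ =
      (blockForm h (Qi * B k * Q.val)).toBlocks₂₁ * (blockForm h (Qi * D k * Q.val)).toBlocks₁₂ +
      (blockForm h (Qi * B k * Q.val)).toBlocks₂₂ *
        (blockForm h (Qi * D k * Q.val)).toBlocks₂₂ := by
    intro k
    rw [blockForm_mul]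
    conv_lhs => rw [← fromBlocks_toBlocks (blockForm h (Qi * B k * Q.val)), hblock _ (hDS k),
      fromBlocks_multiply]
    rw [toBlocks_fromBlocks₂₂]
  rw [Finset.sum_congr rfl fun k _ => (hk k).symm]
  ext i j
  simp only [Matrix.sum_apply, toBlocks₂₂, of_apply]

/-- With `x' = ∑ Bₖ y_{Dₖ}` one has `p x' = ∑ Bₖ Dₖ x = x - J R x`. Every `D` in the set kills `J`,
so `p D x' = D x = p y_D`, and `p` cancels. -/
theorem KernelBlockCondition.kernelLiftCondition [IsDomain O] {p : ℕ} (hp : (p : O) ≠ 0)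
    (hS : KernelBlockCondition S) : KernelLiftCondition p S := by
  obtain ⟨e, h, Q, hQ⟩ := hS
  obtain ⟨m, B, D, hDS, hsum⟩ := hQ.exists_sum_eq
  intro x y hxy
  refine ⟨∑ k, B k *ᵥ y (D k), fun D' hD' => ?_⟩
  have h1 : (p : O) • ∑ k, B k *ᵥ y (D k) = (∑ k, B k * D k) *ᵥ x := by
    rw [Finset.smul_sum, Matrix.sum_mulVec]
    refine Finset.sum_congr rfl fun k _ => ?_
    rw [← Matrix.mulVec_smul, ← hxy _ (hDS k), Matrix.mulVec_mulVec]
  have h2 : (p : O) • (D' *ᵥ ∑ k, B k *ᵥ y (D k)) = (p : O) • y D' := by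
    rw [← Matrix.mulVec_smul, h1, hsum, Matrix.mulVec_mulVec, Matrix.mul_sub, Matrix.mul_one,
      ← Matrix.mul_assoc, hQ.mul_eq_zero D' hD', Matrix.zero_mul, sub_zero, hxy D' hD']
  exact smul_right_injective _ hp h2

end

section CommonKer

variable (S : Set (Matrix (Fin r) (Fin r) O))

/-- The common kernel of a set of matrices. -/
abbrev commonKer : Submodule O (Fin r → O) := ⨅ D ∈ S, LinearMap.ker D.mulVecLin

variable {S}

theorem mem_commonKer {x : Fin r → O} : x ∈ commonKer S ↔ ∀ D ∈ S, D *ᵥ x = 0 :=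
  mem_iInf_ker_mulVecLin (g := fun D => D)

/-- Saturation of the common kernel: it makes the quotient torsion-free and keeps bases independent
modulo `p`. -/
theorem mem_commonKer_of_smul_mem [IsDomain O] {a : O} (ha : a ≠ 0) {x : Fin r → O}
    (hx : a • x ∈ commonKer S) : x ∈ commonKer S := by
  rw [mem_commonKer] at hx ⊢
  intro D hD
  have h := hx D hD
  rw [Matrix.mulVec_smul] at h
  exact (smul_eq_zero.mp h).resolve_left ha

/-- Left multiplication by matrix units moves any row of a matrix to any position, so the left ideal
generated by a set of matrices is determined by the span of their rows. -/
theorem mem_span_of_rows_mem {M : Matrix (Fin r) (Fin r) O}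
    (hM : ∀ i, M i ∈ Submodule.span O {w | ∃ D ∈ S, ∃ i, w = D i}) :
    M ∈ Submodule.span (Matrix (Fin r) (Fin r) O) S := by
  let W := (Submodule.span (Matrix (Fin r) (Fin r) O) S).restrictScalars O
  let φ : Fin r → (Fin r → O) →ₗ[O] Matrix (Fin r) (Fin r) O := fun j =>
    { toFun := fun v => vecMulVec (Pi.single j 1) v
      map_add' := fun v w => vecMulVec_add _ _ _
      map_smul' := fun a v => vecMulVec_smul _ _ _ }
  have hφ : ∀ j, Submodule.span O {w | ∃ D ∈ S, ∃ i, w = D i} ≤ W.comap (φ j) := by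
    intro j
    rw [Submodule.span_le]
    rintro _ ⟨D, hD, i, rfl⟩
    have h1 : φ j (D i) = (Matrix.single j i 1 : Matrix (Fin r) (Fin r) O) • D := by
      ext k l
      simp [φ, vecMulVec_apply, Matrix.mul_apply, Matrix.single_apply, Pi.single_apply, eq_comm,
        ite_and]
    change φ j (D i) ∈ Submodule.span (Matrix (Fin r) (Fin r) O) S
    rw [h1]
    exact Submodule.smul_mem _ _ (Submodule.subset_span hD)
  have hM' : M = ∑ j, φ j (M j) := by
    ext k l
    simp [φ, Matrix.sum_apply, vecMulVec_apply, Pi.single_apply]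
  rw [hM']
  exact W.sum_mem fun j _ => hφ j (hM j)

end CommonKer

section LocalRing

variable [IsLocalRing O] {p : ℕ}

theorem residue_eq_zero_iff_exists_mul (hp : IsLocalRing.maximalIdeal O = Ideal.span {(p : O)})
    (x : O) : IsLocalRing.residue O x = 0 ↔ ∃ z, x = p * z := by
  rw [IsLocalRing.residue_eq_zero_iff, hp, Ideal.mem_span_singleton]
  rfl

theorem exists_eq_add_smul_of_residue_comp_eq
    (hp : IsLocalRing.maximalIdeal O = Ideal.span {(p : O)}) {n : Type*} {x y : n → O}
    (h : IsLocalRing.residue O ∘ x = IsLocalRing.residue O ∘ y) :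
    ∃ z, x = y + (p : O) • z := by
  have hz : ∀ i, ∃ z, x i - y i = p * z := fun i => by
    rw [← residue_eq_zero_iff_exists_mul hp, map_sub, sub_eq_zero]
    exact congrFun h i
  choose z hz using hz
  exact ⟨z, funext fun i => by simp [← hz i]⟩

theorem residue_comp_mulVec (D : Matrix (Fin r) (Fin r) O) (x : Fin r → O) :
    D.map (IsLocalRing.residue O) *ᵥ (IsLocalRing.residue O ∘ x) =
      IsLocalRing.residue O ∘ (D *ᵥ x) :=
  funext fun i => (RingHom.map_mulVec (IsLocalRing.residue O) D x i).symm

theorem residue_comp_smul_eq_zero (hp : IsLocalRing.maximalIdeal O = Ideal.span {(p : O)})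
    {n : Type*} (z : n → O) : IsLocalRing.residue O ∘ ((p : O) • z) = 0 :=
  funext fun i => (residue_eq_zero_iff_exists_mul hp _).mpr ⟨z i, rfl⟩

theorem exists_residue_comp_eq {n : Type*} (x : n → IsLocalRing.ResidueField O) :
    ∃ y : n → O, IsLocalRing.residue O ∘ y = x := by
  choose y hy using fun i => IsLocalRing.residue_surjective (R := O) (x i)
  exact ⟨y, funext hy⟩

variable (S : Set (Matrix (Fin r) (Fin r) O))

/-- The common kernel of the reductions of a set of matrices. -/
abbrev commonKerResidue : Submodule (IsLocalRing.ResidueField O)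
    (Fin r → IsLocalRing.ResidueField O) :=
  ⨅ D ∈ S, LinearMap.ker (D.map (IsLocalRing.residue O)).mulVecLin

variable {S}

theorem mem_commonKerResidue {x : Fin r → IsLocalRing.ResidueField O} :
    x ∈ commonKerResidue S ↔ ∀ D ∈ S, D.map (IsLocalRing.residue O) *ᵥ x = 0 :=
  mem_iInf_ker_mulVecLin

theorem residue_comp_mem_commonKerResidue {x : Fin r → O} (hx : x ∈ commonKer S) :
    IsLocalRing.residue O ∘ x ∈ commonKerResidue S := by
  rw [mem_commonKerResidue]
  intro D hD
  rw [residue_comp_mulVec, mem_commonKer.mp hx D hD]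
  exact funext fun i => map_zero _

/-- The reduction of a basis of the common kernel. -/
def residueFamily {ι : Type*} (b : ι → commonKer S) : ι → commonKerResidue S :=
  fun j => ⟨IsLocalRing.residue O ∘ (b j : Fin r → O), residue_comp_mem_commonKerResidue (b j).2⟩

/-- A relation modulo `p` lifts to `∑ aⱼ bⱼ = p z`. By saturation `z` lies in the common kernel, and
comparing coordinates shows that `p` divides every `aⱼ`. -/
theorem linearIndependent_residueFamily [IsDomain O]
    (hp : IsLocalRing.maximalIdeal O = Ideal.span {(p : O)}) (hp0 : (p : O) ≠ 0) {ι : Type*}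
    [Fintype ι] (b : Module.Basis ι O (commonKer S)) :
    LinearIndependent (IsLocalRing.ResidueField O) (residueFamily b) := by
  rw [Fintype.linearIndependent_iff]
  intro c hc
  obtain ⟨a, rfl⟩ := exists_residue_comp_eq c
  have h1 : IsLocalRing.residue O ∘ ((∑ j, a j • b j : commonKer S) : Fin r → O) =
      IsLocalRing.residue O ∘ (0 : Fin r → O) := by
    have := congrArg Subtype.val hc
    funext i
    have hi := congrFun this i
    simpa [residueFamily] using hi
  obtain ⟨z, hz⟩ := exists_eq_add_smul_of_residue_comp_eq hp h1
  rw [zero_add] at hz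
  have hzm : z ∈ commonKer S := mem_commonKer_of_smul_mem hp0 (hz ▸ Subtype.property _)
  have h2 : ∑ j, a j • b j = (p : O) • (⟨z, hzm⟩ : commonKer S) := Subtype.ext hz
  intro j
  have h3 := congrArg (fun x => b.repr x j) h2
  simp only [b.repr_sum_self, map_smul, Finsupp.smul_apply, smul_eq_mul] at h3
  exact (residue_eq_zero_iff_exists_mul hp _).mpr ⟨_, h3⟩

theorem exists_sub_smul_mem_commonKer {ι : Type*} [Fintype ι]
    (hp : IsLocalRing.maximalIdeal O = Ideal.span {(p : O)}) (b : ι → commonKer S)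
    (hb : Submodule.span (IsLocalRing.ResidueField O) (Set.range (residueFamily b)) = ⊤)
    {x : Fin r → O} (hx : IsLocalRing.residue O ∘ x ∈ commonKerResidue S) :
    ∃ x', x - (p : O) • x' ∈ commonKer S := by
  have h1 : (⟨_, hx⟩ : commonKerResidue S) ∈
      Submodule.span (IsLocalRing.ResidueField O) (Set.range (residueFamily b)) := hb ▸ trivial
  obtain ⟨c, hc⟩ := (Submodule.mem_span_range_iff_exists_fun _).mp h1
  obtain ⟨a, rfl⟩ := exists_residue_comp_eq c
  have h2 : IsLocalRing.residue O ∘ x =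
      IsLocalRing.residue O ∘ ((∑ j, a j • b j : commonKer S) : Fin r → O) := by
    funext i
    have hi := congrFun (congrArg Subtype.val hc) i
    simpa [residueFamily] using hi.symm
  obtain ⟨z, hz⟩ := exists_eq_add_smul_of_residue_comp_eq hp h2
  refine ⟨z, ?_⟩
  rw [hz, add_sub_cancel_right]
  exact Subtype.property _

theorem residue_comp_mem_iff (hp : IsLocalRing.maximalIdeal O = Ideal.span {(p : O)})
    {x : Fin r → O} : IsLocalRing.residue O ∘ x ∈ commonKerResidue S ↔
      ∃ y : Matrix (Fin r) (Fin r) O → Fin r → O, ∀ D ∈ S, D *ᵥ x = (p : O) • y D := by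
  rw [mem_commonKerResidue]
  constructor
  · intro h
    have hz : ∀ D, ∃ z, D ∈ S → D *ᵥ x = (p : O) • z := by
      intro D
      by_cases hD : D ∈ S
      · have h1 := h D hD
        rw [residue_comp_mulVec] at h1
        obtain ⟨z, hz⟩ := exists_eq_add_smul_of_residue_comp_eq hp (x := D *ᵥ x) (y := 0)
          (h1.trans (funext fun i => (map_zero _).symm))
        exact ⟨z, fun _ => by rw [hz, zero_add]⟩
      · exact ⟨0, fun h => absurd h hD⟩
    choose y hy using hz
    exact ⟨y, hy⟩
  · rintro ⟨y, hy⟩ D hD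
    rw [residue_comp_mulVec, hy D hD, residue_comp_smul_eq_zero hp]

/-- When `D x = p y_D`, the equation `D x' = y_D` is equivalent to `D (x - p x') = 0`. The condition
thus says that the common kernel surjects onto the common kernel of the reductions. -/
theorem kernelLiftCondition_iff [IsDomain O]
    (hp : IsLocalRing.maximalIdeal O = Ideal.span {(p : O)}) (hp0 : (p : O) ≠ 0) :
    KernelLiftCondition p S ↔ ∀ x, IsLocalRing.residue O ∘ x ∈ commonKerResidue S →
      ∃ x', x - (p : O) • x' ∈ commonKer S := by
  have key : ∀ x x' (y : Matrix (Fin r) (Fin r) O → Fin r → O),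
      (∀ D ∈ S, D *ᵥ x = (p : O) • y D) →
      ((∀ D ∈ S, D *ᵥ x' = y D) ↔ x - (p : O) • x' ∈ commonKer S) := by
    intro x x' y hy
    rw [mem_commonKer]
    refine forall₂_congr fun D hD => ?_
    rw [Matrix.mulVec_sub, Matrix.mulVec_smul, hy D hD, ← smul_sub, smul_eq_zero_iff_right hp0,
      sub_eq_zero, eq_comm]
  constructor
  · intro h x hx
    obtain ⟨y, hy⟩ := (residue_comp_mem_iff hp).mp hx
    obtain ⟨x', hx'⟩ := h x y hy
    exact ⟨x', (key x x' y hy).mp hx'⟩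
  · intro h x y hy
    obtain ⟨x', hx'⟩ := h x ((residue_comp_mem_iff hp).mpr ⟨y, hy⟩)
    exact ⟨x', (key x x' y hy).mpr hx'⟩

variable [IsDomain O] [IsPrincipalIdealRing O]

/-- The reduced basis is independent, so equality of the ranks means that it spans, which is the
surjectivity just described. -/
theorem kernelRankCondition_iff_kernelLiftCondition
    (hp : IsLocalRing.maximalIdeal O = Ideal.span {(p : O)}) (hp0 : (p : O) ≠ 0) :
    KernelRankCondition S ↔ KernelLiftCondition p S := by
  let b := Module.finBasis O (commonKer S)
  have hli := linearIndependent_residueFamily hp hp0 b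
  rw [kernelLiftCondition_iff hp hp0]
  constructor
  · intro h x hx
    refine exists_sub_smul_mem_commonKer hp b ?_ hx
    refine hli.span_eq_top_of_card_eq_finrank' ?_
    rw [Fintype.card_fin]
    exact h
  · intro h
    have hspan : ⊤ ≤ Submodule.span (IsLocalRing.ResidueField O)
        (Set.range (residueFamily b)) := by
      rintro ⟨x, hx⟩ -
      obtain ⟨x, rfl⟩ := exists_residue_comp_eq x
      obtain ⟨x', hx'⟩ := h x hx
      rw [Submodule.mem_span_range_iff_exists_fun]
      refine ⟨fun j => IsLocalRing.residue O (b.repr ⟨_, hx'⟩ j), Subtype.ext ?_⟩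
      have h1 := congrArg Subtype.val (b.sum_repr ⟨_, hx'⟩)
      funext i
      have hi := congrArg (IsLocalRing.residue O) (congrFun h1 i)
      have hp1 : IsLocalRing.residue O (p : O) = 0 :=
        (residue_eq_zero_iff_exists_mul hp _).mpr ⟨1, (mul_one _).symm⟩
      change _ = IsLocalRing.residue O ((x - (p : O) • x') i) at hi
      rw [Pi.sub_apply, map_sub, Pi.smul_apply, smul_eq_mul, map_mul, hp1, zero_mul, sub_zero] at hi
      refine Eq.trans ?_ hi
      simp only [residueFamily, Submodule.coe_sum, SetLike.val_smul, Finset.sum_apply,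
        Pi.smul_apply,
        smul_eq_mul, map_sum, map_mul, Function.comp_apply]
    have h1 := Module.finrank_eq_card_basis (Module.Basis.mk hli hspan)
    rw [Fintype.card_fin] at h1
    exact h1.symm

/-- The common kernel is a direct summand: its bases extend to invertible matrices. -/
theorem exists_GL_mul_stdInclusion (S : Set (Matrix (Fin r) (Fin r) O)) :
    ∃ (e : ℕ) (_ : e ≤ r) (Q : GL (Fin r) O) (b : Module.Basis (Fin e) O (commonKer S)),
      ∀ i j, (Q.val * stdInclusion O r e) i j = (b j : Fin r → O) i := by
  let b := Module.finBasis O (commonKer S)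
  have htf : Module.IsTorsionFree O ((Fin r → O) ⧸ commonKer S) := by
    refine ⟨fun a ha x y hxy => ?_⟩
    induction x using Submodule.Quotient.induction_on with | _ x => ?_
    induction y using Submodule.Quotient.induction_on with | _ y => ?_
    have hxy' : a • Submodule.Quotient.mk (p := commonKer S) x =
      a • Submodule.Quotient.mk (p := commonKer S) y := hxy
    rw [← Submodule.Quotient.mk_smul, ← Submodule.Quotient.mk_smul, Submodule.Quotient.eq,
      ← smul_sub] at hxy'
    exact (Submodule.Quotient.eq _).mpr (mem_commonKer_of_smul_mem ha.ne_zero hxy')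
  have hfree : Module.Free O ((Fin r → O) ⧸ commonKer S) := Module.free_of_finite_type_torsion_free'
  let c := Module.finBasis O ((Fin r → O) ⧸ commonKer S)
  let bc := b.sumQuot c
  have hcard := Module.finrank_eq_card_basis bc
  rw [Module.finrank_fin_fun, Fintype.card_sum, Fintype.card_fin, Fintype.card_fin] at hcard
  have he : Module.finrank O (commonKer S) ≤ r := by omega
  let B := bc.reindex ((Equiv.sumCongr (Equiv.refl _) (finCongr (by omega))).trans (blockIndex he))
  have hB : ∀ j, B (blockIndex he (.inl j)) = b j := by
    intro j
    rw [Module.Basis.reindex_apply]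
    simp [bc]
  let P := Pi.basisFun O (Fin r)
  refine ⟨_, he, ⟨P.toMatrix B, B.toMatrix P, P.toMatrix_mul_toMatrix_flip B,
    B.toMatrix_mul_toMatrix_flip P⟩, b, fun i j => ?_⟩
  rw [mul_stdInclusion_apply he, ← hB]
  rfl

/-- Let `V` be the row span and `N'` the annihilator of the common kernel. The lifting condition
gives `N' ⊆ V + p N'`, since modulo `p` nothing in `N'` escapes the reduction of `V`; Nakayama then
gives `N' ⊆ V`. -/
theorem row_mem_of_annihilates (hp : IsLocalRing.maximalIdeal O = Ideal.span {(p : O)})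
    (hp0 : (p : O) ≠ 0) (hS : KernelLiftCondition p S) {v : Fin r → O}
    (hv : ∀ x ∈ commonKer S, v ⬝ᵥ x = 0) :
    v ∈ Submodule.span O {w | ∃ D ∈ S, ∃ i, w = D i} := by
  set V := Submodule.span O {w | ∃ D ∈ S, ∃ i, w = D i} with hV
  let N' : Submodule O (Fin r → O) :=
    { carrier := {v | ∀ x ∈ commonKer S, v ⬝ᵥ x = 0}
      add_mem' := fun ha hb x hx => by rw [add_dotProduct, ha x hx, hb x hx, add_zero]
      zero_mem' := fun x _ => zero_dotProduct x
      smul_mem' := fun a v hv x hx => by rw [smul_dotProduct, hv x hx, smul_zero] }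
  have hVN : V ≤ N' := by
    rw [hV, Submodule.span_le]
    rintro _ ⟨D, hD, i, rfl⟩ x hx
    exact congrFun (mem_commonKer.mp hx D hD) i
  set V' := Submodule.span (IsLocalRing.ResidueField O)
    {w | ∃ D ∈ S, ∃ i, w = IsLocalRing.residue O ∘ D i} with hV'
  have hlift : ∀ w ∈ V', ∃ v ∈ V, IsLocalRing.residue O ∘ v = w := by
    intro w hw
    induction hw using Submodule.span_induction with
    | mem w hw =>
      obtain ⟨D, hD, i, rfl⟩ := hw
      exact ⟨D i, Submodule.subset_span ⟨D, hD, i, rfl⟩, rfl⟩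
    | zero => exact ⟨0, V.zero_mem, funext fun i => map_zero _⟩
    | add w w' _ _ h h' =>
      obtain ⟨v, hv, rfl⟩ := h
      obtain ⟨v', hv', rfl⟩ := h'
      exact ⟨v + v', V.add_mem hv hv', funext fun i => map_add _ _ _⟩
    | smul c w _ h =>
      obtain ⟨v, hv, rfl⟩ := h
      obtain ⟨a, rfl⟩ := IsLocalRing.residue_surjective c
      exact ⟨a • v, V.smul_mem a hv, funext fun i => map_mul _ _ _⟩
  have hred : ∀ v ∈ N', IsLocalRing.residue O ∘ v ∈ V' := by
    intro v hv
    by_contra hnot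
    -- A functional separating `v` from the reduced rows is the pairing with a vector `x` killed by
    -- all the `D` modulo `p`. Lifting gives `x - p x'` in the common kernel, so `v ⬝ᵥ x = p (v ⬝ᵥ
    -- x')`, a contradiction.
    obtain ⟨f, hfv, hf⟩ := Submodule.exists_le_ker_of_notMem hnot
    obtain ⟨x, hx⟩ := exists_residue_comp_eq
      (fun i => f (Pi.single i 1) : Fin r → IsLocalRing.ResidueField O)
    have hfx : ∀ w : Fin r → O,
        f (IsLocalRing.residue O ∘ w) = IsLocalRing.residue O (w ⬝ᵥ x) := by
      intro w
      rw [RingHom.map_dotProduct, hx]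
      conv_lhs => rw [pi_eq_sum_univ' (IsLocalRing.residue O ∘ w), map_sum]
      simp only [map_smul, smul_eq_mul, dotProduct]
    have hxm : IsLocalRing.residue O ∘ x ∈ commonKerResidue S := by
      rw [mem_commonKerResidue]
      intro D hD
      rw [residue_comp_mulVec]
      funext i
      have h1 := hf (Submodule.subset_span ⟨D, hD, i, rfl⟩)
      rw [LinearMap.mem_ker, hfx] at h1
      exact h1
    obtain ⟨x', hx'⟩ := (kernelLiftCondition_iff hp hp0).mp hS x hxm
    have h2 := hv _ hx'
    rw [dotProduct_sub, dotProduct_smul, sub_eq_zero, smul_eq_mul] at h2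
    rw [hfx] at hfv
    exact hfv ((residue_eq_zero_iff_exists_mul hp _).mpr ⟨_, h2⟩)
  have hle : N' ≤ V ⊔ IsLocalRing.maximalIdeal O • N' := by
    intro v hv
    obtain ⟨v0, hv0, h0⟩ := hlift _ (hred v hv)
    obtain ⟨z, hz⟩ := exists_eq_add_smul_of_residue_comp_eq hp h0.symm
    -- Both `v` and `v0` annihilate the common kernel, hence so does `p z`, and `p` cancels.
    have hzN : z ∈ N' := by
      intro x hx
      have h1 := hv x hx
      rw [hz, add_dotProduct, hVN hv0 x hx, zero_add, smul_dotProduct, smul_eq_mul] at h1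
      exact (mul_eq_zero.mp h1).resolve_left hp0
    rw [hz]
    refine Submodule.add_mem_sup hv0 (Submodule.smul_mem_smul ?_ hzN)
    rw [hp]
    exact Ideal.mem_span_singleton_self _
  exact Submodule.le_of_le_smul_of_le_jacobson_bot (IsNoetherian.noetherian N')
    (IsLocalRing.maximalIdeal_le_jacobson _) hle hv

/-- The columns of `J` are a basis of the common kernel and `J R` is a projection onto it. The rows
of `1 - J R` therefore annihilate the kernel, so this matrix lies in the left ideal generated by
`S`. -/
theorem KernelLiftCondition.kernelBlockCondition
    (hp : IsLocalRing.maximalIdeal O = Ideal.span {(p : O)}) (hp0 : (p : O) ≠ 0)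
    (hS : KernelLiftCondition p S) : KernelBlockCondition S := by
  obtain ⟨e, he, Q, b, hb⟩ := exists_GL_mul_stdInclusion S
  have hzero : ∀ D ∈ S, D * (Q.val * stdInclusion O r e) = 0 := by
    intro D hD
    ext i j
    have h1 := congrFun (mem_commonKer.mp (b j).2 D hD) i
    rw [Matrix.mul_apply]
    simp only [hb]
    exact h1
  set J := Q.val * stdInclusion O r e with hJ
  set R := (stdInclusion O r e)ᵀ * (Q⁻¹ : GL (Fin r) O).val with hR
  have hRJ : R * J = 1 := by
    rw [hR, hJ, Matrix.mul_assoc, ← Matrix.mul_assoc _ Q.val, ← Units.val_mul, inv_mul_cancel,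
      Units.val_one, Matrix.one_mul, stdInclusion_transpose_mul_self he]
  have hmem : (1 - J * R) ∈ Submodule.span (Matrix (Fin r) (Fin r) O) S := by
    refine mem_span_of_rows_mem fun i => row_mem_of_annihilates hp hp0 hS fun x hx => ?_
    have hxJ : x = J *ᵥ b.repr ⟨x, hx⟩ := by
      funext k
      have h1 := congrFun (congrArg Subtype.val (b.sum_repr ⟨x, hx⟩)) k
      simp only [mulVec, dotProduct, hb]
      refine h1.symm.trans ?_
      simp only [Submodule.coe_sum, SetLike.val_smul, Finset.sum_apply, Pi.smul_apply,
        smul_eq_mul, mul_comm]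
    have h2 : (1 - J * R) *ᵥ x = 0 := by
      rw [hxJ, Matrix.mulVec_mulVec, Matrix.sub_mul, Matrix.mul_assoc, hRJ, Matrix.one_mul,
        Matrix.mul_one, sub_self, Matrix.zero_mulVec]
    exact congrFun h2 i
  obtain ⟨m, B, D, hsum⟩ := Submodule.mem_span_set'.mp hmem
  exact ⟨e, he, Q, isBlockTriangularization_of_sum_eq hzero (fun k => (D k).2) hsum⟩

theorem kernelConditions_tfae (hp : IsLocalRing.maximalIdeal O = Ideal.span {(p : O)})
    (hp0 : (p : O) ≠ 0) (S : Set (Matrix (Fin r) (Fin r) O)) :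
    [KernelRankCondition S, KernelLiftCondition p S, KernelBlockCondition S].TFAE := by
  tfae_have 1 ↔ 2 := kernelRankCondition_iff_kernelLiftCondition hp hp0
  tfae_have 2 → 3 := fun h => h.kernelBlockCondition hp hp0
  tfae_have 3 → 2 := fun h => h.kernelLiftCondition hp0
  tfae_finish

end LocalRing

end KernelConditions

end

noncomputable section

/-! ### Conjugation of types by constant matrices, and the conclusion -/

namespace SkewPowerSeries

variable {R : Type*} [CommRing R] {σ : R →+* R}

theorem coeff_const_mul (a : R) (c : SkewPowerSeries σ) (n : ℕ) :
    (const σ a * c).coeff n = a * c.coeff n := by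
  rw [coeff_mul, Finset.sum_eq_single (0, n)]
  · simp [const]
  · rintro ⟨i, j⟩ hij hne
    rw [Finset.HasAntidiagonal.mem_antidiagonal] at hij
    have : i ≠ 0 := by rintro rfl; simp_all
    simp [const, this]
  · simp

theorem coeff_mul_const (a : R) (c : SkewPowerSeries σ) (n : ℕ) :
    (c * const σ a).coeff n = c.coeff n * (σ ^ n) a := by
  rw [coeff_mul, Finset.sum_eq_single (n, 0)]
  · simp [const]
  · rintro ⟨i, j⟩ hij hne
    rw [Finset.HasAntidiagonal.mem_antidiagonal] at hij
    have : j ≠ 0 := by rintro rfl; simp_all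
    simp [const, this]
  · simp

/-- The constant term, as a ring homomorphism. -/
def constTerm (σ : R →+* R) : SkewPowerSeries σ →+* R where
  toFun c := c.coeff 0
  map_one' := rfl
  map_zero' := rfl
  map_add' _ _ := rfl
  map_mul' a b := by simp [coeff_mul]

end SkewPowerSeries

section HondaRing

open MvPowerSeries

variable {p : ℕ} [Fact p.Prime] {L : Type*} [Field L] [Algebra ℚ_[p] L] [Algebra ℤ_[p] L]
  [IsScalarTower ℤ_[p] ℚ_[p] L] [FiniteDimensional ℚ_[p] L]
  [Algebra.Unramified ℤ_[p] (PadicRingOfIntegers p L)] {τ : Type*}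

theorem HondaRing.coeff_act_def (c : HondaRing p L) (f : MvPowerSeries τ L) (m : τ →₀ ℕ) :
    coeff m (c.act f) = ∑ n ∈ Finset.range (m.degree + 1),
      (c.coeff n : L) * coeff m ((frobeniusOperator p L)^[n] f) := rfl

/-- The action on a given power series, as an additive homomorphism. -/
def HondaRing.actLeft (f : MvPowerSeries τ L) : HondaRing p L →+ MvPowerSeries τ L where
  toFun c := c.act f
  map_zero' := by
    ext m
    simp [HondaRing.coeff_act_def, SkewPowerSeries.coeff_zero]
  map_add' a b := by
    ext m
    simp [HondaRing.coeff_act_def, SkewPowerSeries.coeff_add, add_mul, Finset.sum_add_distrib]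

/-- The action of a given element, as an additive homomorphism. -/
def HondaRing.actRight (c : HondaRing p L) : MvPowerSeries τ L →+ MvPowerSeries τ L where
  toFun f := c.act f
  map_zero' := by
    ext m
    simp [HondaRing.coeff_act_def, frobeniusOperator_iterate]
  map_add' f g := by
    ext m
    simp [HondaRing.coeff_act_def, frobeniusOperator_iterate, mul_add, Finset.sum_add_distrib]

theorem HondaRing.const_mul_act (a : PadicRingOfIntegers p L) (c : HondaRing p L)
    (f : MvPowerSeries τ L) :
    HondaRing.act (SkewPowerSeries.const _ a * c) f = (a : L) • c.act f := by
  ext m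
  simp [HondaRing.coeff_act_def, SkewPowerSeries.coeff_const_mul, Finset.mul_sum, mul_assoc]

/-- The rule `▲ a = σ(a) ▲` mirrors the semilinearity of the operator: the constant passes `▲ⁿ` as
`σⁿ(a)` on both sides. -/
theorem HondaRing.mul_const_act (a : PadicRingOfIntegers p L) (c : HondaRing p L)
    (f : MvPowerSeries τ L) :
    HondaRing.act (c * SkewPowerSeries.const _ a) f = c.act ((a : L) • f) := by
  ext m
  rw [HondaRing.coeff_act_def, HondaRing.coeff_act_def]
  refine Finset.sum_congr rfl fun n _ => ?_
  rw [SkewPowerSeries.coeff_mul_const, frobeniusOperator_iterate, frobeniusOperator_iterate,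
    smul_eq_C_mul, map_mul, map_mul, map_C, expand_C, coeff_C_mul, ← coe_padicFrobeniusInt_pow]
  push_cast
  ring

/-- If `f` has integral coefficients and `Lam ∘ f = (Q I) lam`, then the type of `lam` is a block of
the conjugate by `Q` of the type of `Lam`. -/
theorem IsOfHondaType.of_seriesComp_eq {r e : ℕ} (h : e ≤ r)
    {v : Matrix (Fin r) (Fin r) (HondaRing p L)} {Lam : Fin r → MvPowerSeries (Fin r) L}
    (hv : IsOfHondaType v Lam) (Q : GL (Fin r) (PadicRingOfIntegers p L))
    {f : Fin r → MvPowerSeries (Fin e) (PadicRingOfIntegers p L)}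
    (hf : ∀ i, constantCoeff (f i) = 0) {lam : Fin e → MvPowerSeries (Fin e) L}
    (hlam : ∀ i, constantCoeff (lam i) = 0)
    (hcomp : seriesComp Lam (mapSeries (algebraMap (PadicRingOfIntegers p L) L) f) =
      matrixMulSeries ((Q.val * stdInclusion (PadicRingOfIntegers p L) r e).map
        (algebraMap (PadicRingOfIntegers p L) L)) lam) :
    IsOfHondaType (blockForm h
      ((Q⁻¹ : GL (Fin r) (PadicRingOfIntegers p L)).val.map (SkewPowerSeries.const _) *
        v * Q.val.map (SkewPowerSeries.const _))).toBlocks₁₁ lam := by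
  set Qi := (Q⁻¹ : GL (Fin r) (PadicRingOfIntegers p L)).val with hQi
  refine ⟨hlam, ?_, ?_⟩
  -- Taking constant terms is multiplicative, and the scalar matrix `p` is unchanged by conjugation
  -- with `Q`.
  · let ct := SkewPowerSeries.constTerm (padicFrobeniusInt p L)
    have hconst : ∀ M : Matrix (Fin r) (Fin r) (PadicRingOfIntegers p L),
        (M.map (SkewPowerSeries.const (padicFrobeniusInt p L))).map ct = M := by
      intro M
      funext i j
      change (if (0 : ℕ) = 0 then M i j else 0) = M i j
      exact if_pos rfl
    have h1 : (Qi.map (SkewPowerSeries.const _) * v * Q.val.map (SkewPowerSeries.const _)).map ct =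
        (p : Matrix (Fin r) (Fin r) (PadicRingOfIntegers p L)) := by
      rw [Matrix.map_mul, Matrix.map_mul, hconst, hconst]
      have hv0 : v.map ct = (p : Matrix (Fin r) (Fin r) (PadicRingOfIntegers p L)) := hv.2.1
      rw [hv0, ← (Nat.cast_commute p Qi).eq, Matrix.mul_assoc, hQi, ← Units.val_mul, inv_mul_cancel,
        Units.val_one, Matrix.mul_one]
    ext i j : 1
    have h2 := congrFun (congrFun h1 (blockIndex h (.inl i))) (blockIndex h (.inl j))
    rw [Matrix.natCast_apply] at h2 ⊢
    refine h2.trans ?_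
    simp
  · intro i m
    have hsub := fun k => hv.subst f hf k m
    choose c hc using hsub
    have hG : ∀ l, seriesComp Lam (mapSeries (algebraMap (PadicRingOfIntegers p L) L) f) l =
        ∑ j, (Q.val l (blockIndex h (.inl j)) : L) • lam j := by
      intro l
      rw [hcomp]
      simp only [matrixMulSeries, Matrix.map_apply, mul_stdInclusion_apply h]
      rfl
    let W : Matrix (Fin r) (Fin r) (HondaRing p L) :=
      Qi.map (SkewPowerSeries.const _) * v * Q.val.map (SkewPowerSeries.const _)
    -- As `Q I_{r,e}` involves only the first `e` columns of `Q`, the upper-left block of `W`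
    -- applied to `lam` is the top part of `Q⁻¹ v` applied to `Lam ∘ f`.
    have hmain : ∑ j, HondaRing.act ((blockForm h W).toBlocks₁₁ i j) (lam j) =
        ∑ k, (Qi (blockIndex h (.inl i)) k : L) • ∑ l, (v k l).act
          (seriesComp Lam (mapSeries (algebraMap (PadicRingOfIntegers p L) L) f) l) := by
      have hterm : ∀ j, HondaRing.act ((blockForm h W).toBlocks₁₁ i j) (lam j) =
          ∑ l, ∑ k, (Qi (blockIndex h (.inl i)) k : L) •
            (v k l).act ((Q.val l (blockIndex h (.inl j)) : L) • lam j) := by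
        intro j
        change HondaRing.actLeft (lam j)
          (W (blockIndex h (.inl i)) (blockIndex h (.inl j))) = _
        simp only [W, Matrix.mul_apply, Matrix.map_apply, Finset.sum_mul, map_sum]
        refine Finset.sum_congr rfl fun l _ => Finset.sum_congr rfl fun k _ => ?_
        change HondaRing.act _ _ = _
        rw [HondaRing.mul_const_act, HondaRing.const_mul_act]
      rw [Finset.sum_congr rfl fun j _ => hterm j]
      have hact : ∀ k l, (v k l).act
          (seriesComp Lam (mapSeries (algebraMap (PadicRingOfIntegers p L) L) f) l) =
          ∑ j, (v k l).act ((Q.val l (blockIndex h (.inl j)) : L) • lam j) := by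
        intro k l
        rw [hG]
        exact map_sum (HondaRing.actRight (v k l)) _ _
      simp only [hact, Finset.smul_sum]
      rw [Finset.sum_comm]
      conv_rhs => rw [Finset.sum_comm]
      refine Finset.sum_congr rfl fun l _ => ?_
      rw [Finset.sum_comm]
    refine ⟨∑ k, Qi (blockIndex h (.inl i)) k * c k, ?_⟩
    change coeff m (∑ j, HondaRing.act ((blockForm h W).toBlocks₁₁ i j) (lam j)) = _
    rw [hmain, map_sum]
    simp only [coeff_smul, hc]
    push_cast
    rw [Finset.mul_sum]
    exact Finset.sum_congr rfl fun k _ => by ring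

end HondaRing

/-- Each matrix of the linearized action is the linear coefficient of a group element minus 1, so
the block-free form of (iii) supplies the data for the general construction. -/
theorem exists_isUniversalFixedPair_of_isBlockTriangularization {p : ℕ} [Fact p.Prime] {L : Type*}
    [Field L] [Algebra ℚ_[p] L] [Algebra ℤ_[p] L] [IsScalarTower ℤ_[p] ℚ_[p] L]
    [FiniteDimensional ℚ_[p] L] {r e : ℕ} {Φ : FormalGroupLaw (PadicRingOfIntegers p L) r}
    {Lam : Fin r → MvPowerSeries (Fin r) L} (hLam : Φ.IsLogarithm Lam) {G : Type*} [Group G]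
    (ρ : G →* Φ.Aut) (h : e ≤ r) (Q : GL (Fin r) (PadicRingOfIntegers p L))
    (hQ : IsBlockTriangularization h Q (FormalGroupLaw.linearizedAction ρ Lam)) :
    ∃ (F : FormalGroupLaw (PadicRingOfIntegers p L) e) (f : F.Hom Φ)
      (lam : Fin e → MvPowerSeries (Fin e) L), FormalGroupLaw.IsUniversalFixedPair ρ F f ∧
      linearCoeff f.toSeries = Q.val * stdInclusion (PadicRingOfIntegers p L) r e ∧
      F.IsLogarithm lam ∧
      seriesComp Lam (mapSeries (algebraMap (PadicRingOfIntegers p L) L) f.toSeries) =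
        matrixMulSeries ((Q.val * stdInclusion (PadicRingOfIntegers p L) r e).map
          (algebraMap (PadicRingOfIntegers p L) L)) lam := by
  have hinj : Function.Injective (algebraMap (PadicRingOfIntegers p L) L) :=
    Subtype.val_injective
  have : CharZero L := charZero_of_injective_algebraMap (algebraMap ℚ_[p] L).injective
  have hzero := hQ.mul_eq_zero
  obtain ⟨m, B, D, hD, hsum⟩ := hQ.exists_sum_eq
  rw [FormalGroupLaw.linearizedAction_eq_range hinj ρ hLam] at hzero hD
  choose s hs using hD
  refine FormalGroupLaw.exists_isUniversalFixedPair hinj Φ Lam hLam ρ _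
    ((stdInclusion (PadicRingOfIntegers p L) r e).transpose *
      (Q⁻¹ : GL (Fin r) (PadicRingOfIntegers p L)).val) ?_ (fun g => hzero _ ⟨g, rfl⟩) B s ?_
  · rw [Matrix.mul_assoc, ← Matrix.mul_assoc _ Q.val, ← Units.val_mul, inv_mul_cancel,
      Units.val_one, Matrix.one_mul, stdInclusion_transpose_mul_self h]
  · rw [← hsum]
    exact Finset.sum_congr rfl fun k _ => by rw [← hs k]

end

theorem mainTheorem9 (p : ℕ) [Fact p.Prime] (L : Type*) [Field L] [Algebra ℚ_[p] L]
    [Algebra ℤ_[p] L] [IsScalarTower ℤ_[p] ℚ_[p] L] [FiniteDimensional ℚ_[p] L]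
    [Algebra.Unramified ℤ_[p] (PadicRingOfIntegers p L)] (r : ℕ) :
    (∀ S : Set (Matrix (Fin r) (Fin r) (PadicRingOfIntegers p L)),
      [KernelRankCondition S, KernelLiftCondition p S, KernelBlockCondition S].TFAE) ∧
    (∀ (Φ : FormalGroupLaw (PadicRingOfIntegers p L) r) (Lam : Fin r → MvPowerSeries (Fin r) L),
      Φ.IsLogarithm Lam →
      ∀ (G : Type*) [Group G] (ρ : G →* Φ.Aut),
        (KernelRankCondition (FormalGroupLaw.linearizedAction ρ Lam) ∨
          KernelLiftCondition p (FormalGroupLaw.linearizedAction ρ Lam) ∨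
          KernelBlockCondition (FormalGroupLaw.linearizedAction ρ Lam) →
            ∃ (e : ℕ) (F : FormalGroupLaw (PadicRingOfIntegers p L) e) (f : F.Hom Φ),
              FormalGroupLaw.IsUniversalFixedPair ρ F f) ∧
        (∀ (e : ℕ) (h : e ≤ r) (Q : GL (Fin r) (PadicRingOfIntegers p L)),
          IsBlockTriangularization h Q (FormalGroupLaw.linearizedAction ρ Lam) →
          ∀ v : Matrix (Fin r) (Fin r) (HondaRing p L), IsOfHondaType v Lam →
            ∃ (F : FormalGroupLaw (PadicRingOfIntegers p L) e) (f : F.Hom Φ)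
              (lam : Fin e → MvPowerSeries (Fin e) L),
              FormalGroupLaw.IsUniversalFixedPair ρ F f ∧
              linearCoeff f.toSeries = Q.val * stdInclusion (PadicRingOfIntegers p L) r e ∧
              F.IsLogarithm lam ∧
              IsOfHondaType
                (blockForm h
                  ((Q⁻¹ : GL (Fin r) (PadicRingOfIntegers p L)).val.map (SkewPowerSeries.const _) *
                    v * Q.val.map (SkewPowerSeries.const _))).toBlocks₁₁ lam)) := by
  have hp := padicRingOfIntegers_maximalIdeal p L
  have hp0 := padicRingOfIntegers_prime_ne_zero p L
  have := padicRingOfIntegers_isPrincipalIdealRing p L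
  have htfae := fun S : Set (Matrix (Fin r) (Fin r) (PadicRingOfIntegers p L)) =>
    kernelConditions_tfae hp hp0 S
  refine ⟨htfae, fun Φ Lam hLam G _ ρ => ⟨fun hS => ?_, fun e h Q hQ v hv => ?_⟩⟩
  · have hblock : KernelBlockCondition (FormalGroupLaw.linearizedAction ρ Lam) := by
      rcases hS with hS | hS | hS
      · exact ((htfae _).out 0 2).mp hS
      · exact ((htfae _).out 1 2).mp hS
      · exact hS
    obtain ⟨e, h, Q, hQ⟩ := hblock
    obtain ⟨F, f, -, hf, -⟩ :=
      exists_isUniversalFixedPair_of_isBlockTriangularization hLam ρ h Q hQ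
    exact ⟨e, F, f, hf⟩
  · obtain ⟨F, f, lam, hf, hlin, hlam, hcomp⟩ :=
      exists_isUniversalFixedPair_of_isBlockTriangularization hLam ρ h Q hQ
    exact ⟨F, f, lam, hf, hlin, hlam,
      hv.of_seriesComp_eq h Q f.isHom.zero hlam.1.zero hcomp⟩
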